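/- Let $N\in\mathbb N_0\cup\{\infty\}$, let $\mathcal X=\{0,1,\dots,N\}$ ($\mathcal X=\mathbb N_0$ if $N=\infty$), and let $\pi$ be a probability distribution on $\mathcal X$ with $\pi(i)>0$ for all $i\in\mathcal X$. Let $L=(L(i,j))_{i,j\in\mathcal X}$ be a generator matrix (off-diagonal entries nonnegative, finite diagonal entries, every row sum equal to $0$) that is irreducible, let $X=(X_t)_{t\ge0}$ be the continuous-time Markov chain with generator $L$ (it jumps from $i$ to $j\ne i$ at rate $L(i,j)$), with transition function $P_t(i,j)=\mathbb P_i(X_t=j)$, and suppose that $\pi$ is stationary, $\pi P_t=\pi$ for all $t\ge0$. Let $\tau_j=\inf\{t\ge 0: X_t=j\}$, and put $$t_{av}=\sum_{i,j\in\mathcal X}\mathbb E_i(\tau_j)\pi(i)\pi(j),\qquad t_{dev}=\sup_{i,k\in\mathcal X}\sum_{j\in\mathcal X}|\mathbb E_i(\tau_j)-\mathbb E_k(\tau_j)|\,\pi(j)$$ (both in $[0,\infty]$). Integrals $\int_0^\infty$ below are the limits of $\int_0^T$ as $T\to\infty$. The deviation kernel is $D(i,j)=\int_0^\infty (P_t(i,j)-\pi(j))\,dt$,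 and for a function $h$ on $\mathcal X$ with $\pi(|h|)=\sum_i\pi(i)|h(i)|<\infty$ we put $f_h(i)=\int_0^\infty (P_th(i)-\pi(h))\,dt$ whenever this integral exists. (1) The deviation kernel exists and is finite (for all $i,j$) if and only if $\sum_{i\in\mathcal X}\pi(i)\,\mathbb E_i(\tau_0)<\infty$. (2) Suppose that this is the case and that $L$ is reversible, i.e. $\pi(i)L(i,j)=\pi(j)L(j,i)$ for all $i,j$. Then all $\mathbb E_i(\tau_j)$ are finite, and for all $i,j\in\mathcal X$ $$D(j,j)=\pi(j)\sum_{i\in\mathcal X}\pi(i)\,\mathbb E_i(\tau_j)<\infty,\qquad D(i,j)=D(j,j)-\pi(j)\,\mathbb E_i(\tau_j).$$ If moreover $h:\mathcal X\to\mathbb R$ satisfies $\pi(|h|)<\infty$ and $\sum_{i\in\mathcal X}\pi(i)|h(i)|\,\mathbb E_i(\tau_k)<\infty$ for some $k\in\mathcal X$, then $f_h$ exists and, with absolutely convergent series, $$f_h(i)=\sum_{j\in\mathcal X}h(j)D(i,j)\quad(i\in\mathcal X),$$ $$\triangledown f_h(i):=f_h(i+1)-f_h(i)=\sum_{j\in\mathcal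 X}h(j)\pi(j)\bigl(\mathbb E_i(\tau_j)-\mathbb E_{i+1}(\tau_j)\bigr)\quad(i\in\mathcal X,\ i<N).$$ In particular, for every $j\in\mathcal X$ and $h=\delta_j$ (the function equal to $1$ at $j$ and $0$ elsewhere), $f_{\delta_j}$ exists and $$\|f_{\delta_j}\|_\infty\le 2t_{av},\qquad \|\triangledown f_{\delta_j}\|_\infty=\pi(j)\sup_{i<N}|\mathbb E_i(\tau_j)-\mathbb E_{i+1}(\tau_j)|\le t_{dev}.$$ (3) For every such $\pi$ one can choose $L$ to be a birth-death generator ($L(i,j)=0$ if $|i-j|>1$): the one with $b_i=L(i,i+1)=(i+1)\pi(i+1)/\pi(i)$ for $i<N$ and $L(i,i-1)=i$ for $i\geq 1$ is irreducible and reversible with stationary distribution $\pi$, and for its chain $$\mathbb E_i(\tau_j)=\sum_{i\le k<j}\frac{\pi(\{0,\dots,k\})}{b_k\pi(k)}+\sum_{j\le k<i}\frac{\pi(\{m\in\mathcal X: m>k\})}{b_k\pi(k)}\qquad(i,j\in\mathcal X).$$ -/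

import Mathlib

open MeasureTheory ProbabilityTheory Filter Topology
open scoped ENNReal NNReal

noncomputable section

namespace HittingStein

/-! ### Continuous-time Markov chains on a countable state space -/

/-- `L` is a (stable, conservative) generator matrix: the off-diagonal entries are nonnegative
and every row sums to zero. -/
structure IsGenerator {S : Type*} (L : S → S → ℝ) : Prop where
  nonneg : ∀ i j, i ≠ j → 0 ≤ L i j
  row_sum : ∀ i, HasSum (L i) 0

/-- Every state can be reached from every state by transitions of positive rate. -/
def IsIrreducibleGen {S : Type*} (L : S → S → ℝ) : Prop :=
  ∀ i j, Relation.ReflTransGen (fun a b => 0 < L a b) i j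

open Classical in
/-- The rate of jumps from `i` to `j`; it is zero for `j = i`. -/
def jumpRate {S : Type*} (L : S → S → ℝ) (i j : S) : ℝ≥0∞ :=
  if j = i then 0 else ENNReal.ofReal (L i j)

/-- The total rate `q i` of jumps out of `i`; for a generator, `q i = - L i i`. -/
def exitRate {S : Type*} (L : S → S → ℝ) (i : S) : ℝ≥0∞ := ∑' j, jumpRate L i j

open Classical in
/-- The law of the next state after `i`: `j ≠ i` has probability `L i j / q i`.
A state with `q i = 0` is absorbing. -/
def jumpLaw {S : Type*} (L : S → S → ℝ) (i : S) : PMF S :=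
  if h : exitRate L i ≠ 0 ∧ exitRate L i ≠ ∞ then PMF.normalize (jumpRate L i) h.1 h.2
  else PMF.pure i

/-- The transition kernel of the jump chain at step `n`, as a function of the past. -/
def jumpKernel {S : Type*} [Countable S] [MeasurableSpace S] [MeasurableSingletonClass S]
    (L : S → S → ℝ) (n : ℕ) : Kernel (Π _ : Finset.Iic n, S) S :=
  (Kernel.ofFunOfCountable (fun i : S => (jumpLaw L i).toMeasure)).comap
    (fun x => x ⟨n, Finset.mem_Iic.2 le_rfl⟩) (measurable_pi_apply _)

instance {S : Type*} [Countable S] [MeasurableSpace S] [MeasurableSingletonClass S]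
    (L : S → S → ℝ) (n : ℕ) : IsMarkovKernel (jumpKernel L n) :=
  ⟨fun x => PMF.toMeasure.isProbabilityMeasure
    (jumpLaw L (x ⟨n, Finset.mem_Iic.2 le_rfl⟩))⟩

instance : IsProbabilityMeasure (expMeasure 1) := isProbabilityMeasure_expMeasure one_pos

/-- The law `ℙ_i` of the pair consisting of the jump chain started at `i` and an independent
sequence of i.i.d. exponential variables of parameter one. -/
def chainLaw {S : Type*} [Countable S] [MeasurableSpace S] [MeasurableSingletonClass S]
    (L : S → S → ℝ) (i : S) : Measure ((ℕ → S) × (ℕ → ℝ)) :=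
  (Kernel.traj (X := fun _ : ℕ => S) (jumpKernel L) 0 (fun _ => i)).prod
    (Measure.infinitePi (fun _ : ℕ => expMeasure 1))

/-- The time of the `n`-th jump. The chain stays in its `m`-th state `ω.1 m` for the time
`ω.2 m / q (ω.1 m)`, which is exponential of parameter `q (ω.1 m)`
(and infinite if this rate is zero). -/
def jumpTime {S : Type*} (L : S → S → ℝ) (n : ℕ) (ω : (ℕ → S) × (ℕ → ℝ)) : ℝ≥0∞ :=
  ∑ m ∈ Finset.range n, ENNReal.ofReal (ω.2 m) / exitRate L (ω.1 m)

open Classical in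
/-- The continuous-time Markov chain `X_t` with generator `L`; it is sent to the cemetery `none`
if infinitely many jumps have occurred before time `t`. -/
def stateAt {S : Type*} (L : S → S → ℝ) (t : ℝ≥0) (ω : (ℕ → S) × (ℕ → ℝ)) : Option S :=
  if h : ∃ n, jumpTime L n ω ≤ t ∧ (t : ℝ≥0∞) < jumpTime L (n + 1) ω then
    some (ω.1 h.choose)
  else none

/-- The transition function `P_t(i,j) = ℙ_i(X_t = j)`. -/
def transition {S : Type*} [Countable S] [MeasurableSpace S] [MeasurableSingletonClass S]
    (L : S → S → ℝ) (t : ℝ≥0) (i j : S) : ℝ :=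
  (chainLaw L i).real {ω | stateAt L t ω = some j}

/-- The hitting time `τ_j = inf {t ; X_t = j}`, with `inf ∅ = ∞`. -/
def hittingTime {S : Type*} (L : S → S → ℝ) (j : S) (ω : (ℕ → S) × (ℕ → ℝ)) : ℝ≥0∞ :=
  ⨅ (t : ℝ≥0) (_ : stateAt L t ω = some j), (t : ℝ≥0∞)

/-- The expected hitting time `𝔼_i(τ_j)`, in `[0, ∞]`. -/
def meanHit {S : Type*} [Countable S] [MeasurableSpace S] [MeasurableSingletonClass S]
    (L : S → S → ℝ) (i j : S) : ℝ≥0∞ :=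
  ∫⁻ ω, hittingTime L j ω ∂(chainLaw L i)

/-- The expected hitting time `𝔼_i(τ_j)` as a real number (meaningful when it is finite). -/
def meanHitReal {S : Type*} [Countable S] [MeasurableSpace S] [MeasurableSingletonClass S]
    (L : S → S → ℝ) (i j : S) : ℝ :=
  (meanHit L i j).toReal

/-- `π` is a stationary distribution of the chain: `π P_t = π` for all `t`. -/
def IsStationaryLaw {S : Type*} [Countable S] [MeasurableSpace S] [MeasurableSingletonClass S]
    (L : S → S → ℝ) (π : S → ℝ) : Prop :=
  ∀ (t : ℝ≥0) (j : S), HasSum (fun i => π i * transition L t i j) (π j)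

/-- `L` is reversible with respect to `π` (detailed balance). -/
def IsReversible {S : Type*} (L : S → S → ℝ) (π : S → ℝ) : Prop :=
  ∀ i j, π i * L i j = π j * L j i

/-! ### Deviation kernel and Stein solution -/

/-- The integral of `g` over `(0, ∞)` exists, as the limit of its integrals over `(0, T)`, and
has the finite value `v`. -/
def HasImproperIntegral (g : ℝ → ℝ) (v : ℝ) : Prop :=
  (∀ T : ℝ, 0 ≤ T → IntervalIntegrable g volume 0 T) ∧
    Tendsto (fun T : ℝ => ∫ t in (0 : ℝ)..T, g t) atTop (𝓝 v)

/-- `D` is the (finite) deviation kernel `∫_0^∞ (P_t - π) dt`. -/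
def IsDeviationKernel {S : Type*} [Countable S] [MeasurableSpace S] [MeasurableSingletonClass S]
    (L : S → S → ℝ) (π : S → ℝ) (D : S → S → ℝ) : Prop :=
  ∀ i j, HasImproperIntegral (fun t => transition L t.toNNReal i j - π j) (D i j)

/-- `f` is the function `f_h = ∫_0^∞ (P_t h - π(h)) dt`; the series defining `P_t h` and the
integral are required to converge. -/
def IsSteinSolution {S : Type*} [Countable S] [MeasurableSpace S] [MeasurableSingletonClass S]
    (L : S → S → ℝ) (π : S → ℝ) (h f : S → ℝ) : Prop :=
  ∀ i, (∀ t : ℝ≥0, Summable (fun j => transition L t i j * h j)) ∧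
    HasImproperIntegral
      (fun t => ∑' j, transition L t.toNNReal i j * h j - ∑' j, π j * h j) (f i)

/-- The average hitting time `t_av = ∑_{i,j} 𝔼_i(τ_j) π(i) π(j)`, in `[0, ∞]`. -/
def tAv {S : Type*} [Countable S] [MeasurableSpace S] [MeasurableSingletonClass S]
    (L : S → S → ℝ) (π : S → ℝ) : ℝ≥0∞ :=
  ∑' i, ∑' j, meanHit L i j * ENNReal.ofReal (π i) * ENNReal.ofReal (π j)

/-- The deviation parameter `t_dev = sup_{i,k} ∑_j |𝔼_i(τ_j) - 𝔼_k(τ_j)| π(j)`, in `[0, ∞]`. -/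
def tDev {S : Type*} [Countable S] [MeasurableSpace S] [MeasurableSingletonClass S]
    (L : S → S → ℝ) (π : S → ℝ) : ℝ≥0∞ :=
  ⨆ (i : S) (k : S), ∑' j,
    ENNReal.ofReal |meanHitReal L i j - meanHitReal L k j| * ENNReal.ofReal (π j)

/-! ### The state space `{0, …, N}` -/

/-- The set `{0, …, N}`, which is all of `ℕ` for `N = ∞`. -/
abbrev StateSpace (N : ℕ∞) : Type := {i : ℕ // (i : ℕ∞) ≤ N}

/-- The state `0`. -/
def zeroState (N : ℕ∞) : StateSpace N := ⟨0, by simp⟩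

/-- The state `i + 1`, provided that `i < N`. -/
def next {N : ℕ∞} (i : StateSpace N) (hi : ((i.1 + 1 : ℕ) : ℕ∞) ≤ N) : StateSpace N :=
  ⟨i.1 + 1, hi⟩

/-- The forward gradient `f (i + 1) - f i`, for `i < N`. -/
def grad {N : ℕ∞} (f : StateSpace N → ℝ) (i : StateSpace N)
    (hi : ((i.1 + 1 : ℕ) : ℕ∞) ≤ N) : ℝ :=
  f (next i hi) - f i

/-- The sup-norm, in `[0, ∞]`. -/
def supNorm {N : ℕ∞} (f : StateSpace N → ℝ) : ℝ≥0∞ := ⨆ i, ENNReal.ofReal |f i|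

/-- The sup-norm of the forward gradient, in `[0, ∞]`. -/
def gradNorm {N : ℕ∞} (f : StateSpace N → ℝ) : ℝ≥0∞ :=
  ⨆ (i : StateSpace N) (hi : ((i.1 + 1 : ℕ) : ℕ∞) ≤ N), ENNReal.ofReal |grad f i hi|

open Classical in
/-- The Dirac mass `δ_j`, as a function. -/
def dirac {N : ℕ∞} (j : StateSpace N) : StateSpace N → ℝ := fun i => if i = j then 1 else 0

/-- `L` only allows jumps to neighbouring states. -/
def IsBirthDeath {N : ℕ∞} (L : StateSpace N → StateSpace N → ℝ) : Prop :=
  ∀ i j, i.1 + 1 < j.1 ∨ j.1 + 1 < i.1 → L i j = 0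

open Classical in
/-- The birth rate `b_k = L(k, k + 1)` (zero at `k = N`). -/
def birthRate {N : ℕ∞} (L : StateSpace N → StateSpace N → ℝ) (k : StateSpace N) : ℝ :=
  if hk : ((k.1 + 1 : ℕ) : ℕ∞) ≤ N then L k (next k hk) else 0

/-- The `π`-mass of a set of states. -/
def mass {N : ℕ∞} (π : StateSpace N → ℝ) (A : Set (StateSpace N)) : ℝ≥0∞ :=
  ∑' m : A, ENNReal.ofReal (π m)

end HittingStein

end

open HittingStein

/-! The deviation kernel is governed by the first passage decomposition P_t(i,j) =
E_i[P_{t-τ_j}(j,j)] (`trans_first_passage`). Integrated over [0,T] it says that the occupation times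
of j from j and from i differ by ∫_0^T P_{T-r}(j,j) ℙ_i(τ_j > r) dr (`occupation_eq_add`). Averaging
over a stationary start and subtracting gives ∫_0^T (P_t(i,j) - π(j)) dt = ∫_0^T P_{T-r}(j,j)
ℙ_π(τ_j > r) dr - ∫_0^T P_{T-r}(j,j) ℙ_i(τ_j > r) dr (`integral_transition_sub_eq`). As P_t(j,j) →
π(j), dominated convergence yields D(i,j) = π(j)(E_π τ_j - E_i τ_j) whenever E_π τ_j is finite;
conversely, for i = j the last integral vanishes, and Fatou's lemma bounds E_π τ_j once D(j,j)
exists. This needs no reversibility.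

Two inputs remain. Convergence to equilibrium (`tendsto_trans`): the energy ∑ π(i) P_t(i,j)²
decreases, its loss over a unit of time is an averaged variance, and irreducibility makes all
weights in this variance positive, so P_t(·,j) becomes constant. Finiteness of E_i τ_j
(`meanHit_ne_top`): the same Fatou argument bounds the mean return time, and comparison with
supersolutions of the first step equations moves the bound from one target to the next along
positive rates.

For the Stein solution, sum and limit must be exchanged. Reversibility swaps i and j at the price of
π(j)/π(i), so the truncated integrals are bounded by π(j)/π(i) (E_π τ_i + E_j τ_i), uniformly in T
and summably against |h| (`abs_integral_transition_sub_le`, `steinSolution`). The choice h = 1 shows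
that the rows of D sum to zero, that is, ∑_j π(j) E_i τ_j does not depend on i (the random target
identity); hence |D(i,j)| ≤ t_av.

For the birth-death chain, detailed balance is built into the rates, so stationarity reduces to
non-explosion. The limit u of the Laplace transforms of the jump times is bounded and solves Lu = u.
Its flux (n+1)π(n+1)(u(n+1)-u(n)) is then increasing, and as π ≤ 1 a positive flux would force u to
grow like the harmonic series; so u = 0. The explicit formula solves the first step equations, hence
dominates the hitting times; a strict deficit would again produce harmonic growth, against
nonnegativity of the hitting times (`eq_passageTime`).

All facts about the path law are inductions on the number of jumps: the transition function is the
sum of the probabilities `nJump` of being at j after exactly n jumps, which satisfy a convolution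
recursion. -/

noncomputable section

namespace HittingStein

set_option linter.unusedSectionVars false

/-! ### First step decomposition of the law of the chain -/

/-- The sequence `a, f 0, f 1, …`. -/
def seqCons {α : Type*} (a : α) (f : ℕ → α) : ℕ → α
  | 0 => a
  | n + 1 => f n

@[simp] lemma seqCons_zero {α : Type*} (a : α) (f : ℕ → α) : seqCons a f 0 = a := rfl

@[simp] lemma seqCons_succ {α : Type*} (a : α) (f : ℕ → α) (n : ℕ) :
    seqCons a f (n + 1) = f n := rfl

lemma measurable_seqCons {α : Type*} [MeasurableSpace α] :
    Measurable (fun p : α × (ℕ → α) => seqCons p.1 p.2) := by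
  refine measurable_pi_iff.2 fun n => ?_
  cases n with
  | zero => exact measurable_fst
  | succ n => exact (measurable_pi_apply n).comp measurable_snd

lemma measurable_seqCons_left {α : Type*} [MeasurableSpace α] (a : α) :
    Measurable (seqCons a) :=
  measurable_seqCons.comp (measurable_const.prodMk measurable_id)

section FirstStep

variable {S : Type*} [Countable S] [MeasurableSpace S] [MeasurableSingletonClass S]

/-- The law of the jump chain started at `i`. -/
def pathLaw (L : S → S → ℝ) (i : S) : Measure (ℕ → S) :=
  Kernel.traj (X := fun _ : ℕ => S) (jumpKernel L) 0 (fun _ => i)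

instance (L : S → S → ℝ) (i : S) : IsProbabilityMeasure (pathLaw L i) := by
  unfold pathLaw; infer_instance

instance (L : S → S → ℝ) (i : S) : IsProbabilityMeasure (chainLaw L i) := by
  unfold chainLaw; infer_instance

lemma cylinder_eq (x : ℕ → S) (n : ℕ) :
    {y : ℕ → S | ∀ m ≤ n, y m = x m}
      = Preorder.frestrictLe (π := fun _ => S) n ⁻¹' {Preorder.frestrictLe (π := fun _ => S) n x} := by
  ext y
  simp only [Set.mem_ofPred_eq, Set.mem_preimage, Set.mem_singleton_iff, funext_iff,
    Preorder.frestrictLe_apply, Subtype.forall, Finset.mem_Iic]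

lemma measurableSet_cylinder (x : ℕ → S) (n : ℕ) :
    MeasurableSet {y : ℕ → S | ∀ m ≤ n, y m = x m} := by
  rw [cylinder_eq]
  exact (Preorder.measurable_frestrictLe n) (MeasurableSet.singleton _)

lemma pathLaw_cylinder_zero (L : S → S → ℝ) (i : S) (x : ℕ → S) :
    pathLaw L i {y | ∀ m ≤ 0, y m = x m} = Set.indicator {x 0} 1 i := by
  rw [cylinder_eq, ← Measure.map_apply (Preorder.measurable_frestrictLe 0)
    (MeasurableSet.singleton _), pathLaw, Kernel.traj_map_frestrictLe_apply,
    Kernel.partialTraj_self, Kernel.id_apply, Measure.dirac_apply' _ (MeasurableSet.singleton _)]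
  by_cases h : i = x 0
  · rw [Set.indicator_of_mem, Set.indicator_of_mem (by simpa using h)]
    · rfl
    · simp only [Set.mem_singleton_iff]
      ext ⟨m, hm⟩
      obtain rfl : m = 0 := by simpa using hm
      simpa using h
  · rw [Set.indicator_of_notMem, Set.indicator_of_notMem (by simpa using h)]
    simp only [Set.mem_singleton_iff]
    intro h'
    exact h (congrFun h' ⟨0, by simp⟩)

/-- The joint law of the history up to time n and the next state is the composition product of the
law of the history with the jump kernel; it is evaluated here at a single point. -/
lemma pathLaw_cylinder_succ (L : S → S → ℝ) (i : S) (x : ℕ → S) (n : ℕ) :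
    pathLaw L i {y | ∀ m ≤ n + 1, y m = x m}
      = pathLaw L i {y | ∀ m ≤ n, y m = x m} * jumpLaw L (x n) (x (n + 1)) := by
  have h := Kernel.partialTraj_compProd_eq_map_traj (X := fun _ : ℕ => S) (κ := jumpKernel L)
    (Nat.zero_le n) (x₀ := fun _ => i)
  have h2 := congrArg (fun μ : Measure _ =>
    μ ({Preorder.frestrictLe (π := fun _ => S) n x} ×ˢ {x (n + 1)})) h
  rw [Measure.compProd_apply_prod (MeasurableSet.singleton _) (MeasurableSet.singleton _),
    lintegral_singleton, Measure.map_apply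
      ((Preorder.measurable_frestrictLe n).prodMk (measurable_pi_apply (n + 1)))
      ((MeasurableSet.singleton _).prod (MeasurableSet.singleton _)),
    ← Kernel.traj_map_frestrictLe_apply, Measure.map_apply (Preorder.measurable_frestrictLe n)
    (MeasurableSet.singleton _), ← cylinder_eq] at h2
  have h3 : (fun y : ℕ → S => (Preorder.frestrictLe (π := fun _ => S) n y, y (n + 1))) ⁻¹'
      ({Preorder.frestrictLe (π := fun _ => S) n x} ×ˢ {x (n + 1)})
      = {y | ∀ m ≤ n + 1, y m = x m} := by
    rw [Set.mk_preimage_prod, ← cylinder_eq]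
    ext y
    simp only [Set.mem_inter_iff, Set.mem_ofPred_eq, Set.mem_preimage, Set.mem_singleton_iff]
    constructor
    · rintro ⟨h1, h2⟩ m hm
      rcases Nat.le_succ_iff.1 hm with hm | rfl
      exacts [h1 m hm, h2]
    · exact fun h => ⟨fun m hm => h m (by omega), h _ le_rfl⟩
  rw [h3] at h2
  rw [pathLaw, ← h2, mul_comm]
  congr 1
  have h4 : jumpKernel L n (Preorder.frestrictLe (π := fun _ => S) n x)
      = (jumpLaw L (x n)).toMeasure := rfl
  rw [h4, PMF.toMeasure_apply_singleton _ _ (MeasurableSet.singleton _)]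

/-- A finite measure on sequences is determined by its values on cylinders. -/
lemma measure_seq_ext {μ ν : Measure (ℕ → S)} [IsFiniteMeasure μ]
    (h : ∀ (x : ℕ → S) (n : ℕ), μ {y | ∀ m ≤ n, y m = x m} = ν {y | ∀ m ≤ n, y m = x m}) :
    μ = ν := by
  rcases isEmpty_or_nonempty S with hS | ⟨⟨a⟩⟩
  · exact Measure.ext fun s _ => by rw [Set.eq_empty_of_isEmpty s]; simp
  have hμ : IsProjectiveMeasureFamily (α := fun _ => S)
      (fun I : Finset ℕ => μ.map (I.restrict (π := fun _ => S))) := by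
    intro I J hJI
    rw [Measure.map_map (Finset.measurable_restrict₂ hJI) (Finset.measurable_restrict I)]
    rfl
  refine IsProjectiveLimit.unique (α := fun _ => S)
    (P := fun I : Finset ℕ => μ.map (I.restrict (π := fun _ => S))) (fun I => rfl) ?_
  refine (isProjectiveLimit_nat_iff' hμ ν 0).2 fun n _ => ?_
  refine Measure.ext_of_singleton fun z => ?_
  -- The finite history is continued by the arbitrary state `a`, so that its singleton comes from a
  -- cylinder.
  have hz : z = Preorder.frestrictLe (π := fun _ => S) n
      (fun m => if hm : m ∈ Finset.Iic n then z ⟨m, hm⟩ else a) := by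
    ext ⟨m, hm⟩
    simp only [Preorder.frestrictLe_apply, hm, dif_pos]
  rw [Measure.map_apply (Preorder.measurable_frestrictLe n) (MeasurableSet.singleton _), hz,
    ← cylinder_eq, ← h, cylinder_eq]
  exact (Measure.map_apply (Preorder.measurable_frestrictLe n) (MeasurableSet.singleton _)).symm

/-- It suffices to compare cylinders. `pathLaw_cylinder_succ` removes the last jump of a cylinder,
whereas the claim removes the first; the induction `key` passes from one to the other. -/
lemma pathLaw_first_step (L : S → S → ℝ) (i : S) :
    pathLaw L i = Measure.sum (fun k => jumpLaw L i k • (pathLaw L k).map (seqCons i)) := by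
  refine measure_seq_ext fun x n => ?_
  have hm := fun n => measurableSet_cylinder x n
  have key : ∀ n, pathLaw L i {y | ∀ m ≤ n + 1, y m = x m} = Set.indicator {x 0} 1 i *
      ∑' k, jumpLaw L i k * pathLaw L k {y | ∀ m ≤ n, y m = x (m + 1)} := by
    intro n
    induction n with
    | zero =>
      rw [pathLaw_cylinder_succ, pathLaw_cylinder_zero]
      simp_rw [pathLaw_cylinder_zero L _ (fun m => x (m + 1))]
      by_cases h : i = x 0
      · rw [tsum_eq_single (x 1)]
        · simp [h]
        · intro k hk
          simp [hk]
      · simp [h]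
    | succ n ih =>
      rw [pathLaw_cylinder_succ, ih, mul_assoc, ← ENNReal.tsum_mul_right]
      congr 1
      refine tsum_congr fun k => ?_
      rw [mul_assoc, ← pathLaw_cylinder_succ L k (fun m => x (m + 1))]
  rw [Measure.sum_apply _ (hm n)]
  simp_rw [Measure.smul_apply, smul_eq_mul, Measure.map_apply (measurable_seqCons_left i) (hm n)]
  cases n with
  | zero =>
    rw [pathLaw_cylinder_zero]
    by_cases h : i = x 0
    · have : seqCons i ⁻¹' {y | ∀ m ≤ 0, y m = x m} = Set.univ := by
        ext y
        simp [h]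
      simp only [this, measure_univ, mul_one, (jumpLaw L i).tsum_coe]
      simp [h]
    · have : seqCons i ⁻¹' {y | ∀ m ≤ 0, y m = x m} = ∅ := by
        ext y
        simp [h]
      simp [h]
  | succ n =>
    rw [key]
    by_cases h : i = x 0
    · have : seqCons i ⁻¹' {y | ∀ m ≤ n + 1, y m = x m} = {y | ∀ m ≤ n, y m = x (m + 1)} := by
        ext y
        simp only [Set.mem_preimage, Set.mem_ofPred_eq]
        constructor
        · exact fun hy m hmn => hy (m + 1) (by omega)
        · intro hy m hmn
          cases m with
          | zero => exact h
          | succ m => exact hy m (by omega)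
      rw [this]
      simp [h]
    · have : seqCons i ⁻¹' {y | ∀ m ≤ n + 1, y m = x m} = ∅ := by
        ext y
        simp only [Set.mem_preimage, Set.mem_ofPred_eq, Set.mem_empty_iff_false, iff_false]
        exact fun hy => h (hy 0 (by omega))
      simp [this, h]

lemma lintegral_pathLaw_first_step (L : S → S → ℝ) (i : S) {F : (ℕ → S) → ℝ≥0∞}
    (hF : Measurable F) :
    ∫⁻ y, F y ∂(pathLaw L i) = ∑' k, jumpLaw L i k * ∫⁻ y, F (seqCons i y) ∂(pathLaw L k) := by
  conv_lhs => rw [pathLaw_first_step]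
  rw [lintegral_sum_measure]
  refine tsum_congr fun k => ?_
  rw [lintegral_smul_measure, lintegral_map hF (measurable_seqCons_left i), smul_eq_mul]

lemma infinitePi_eq_map_seqCons {α : Type*} [MeasurableSpace α] (μ : Measure α)
    [IsProbabilityMeasure μ] :
    Measure.infinitePi (fun _ : ℕ => μ)
      = (μ.prod (Measure.infinitePi (fun _ : ℕ => μ))).map (fun p => seqCons p.1 p.2) := by
  symm
  refine Measure.eq_infinitePi _ fun s t ht => ?_
  classical
  obtain ⟨n, hn⟩ : ∃ n, s ⊆ Finset.range (n + 1) := by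
    obtain ⟨n, hn⟩ := s.exists_nat_subset_range
    exact ⟨n, hn.trans (Finset.range_mono (Nat.le_succ n))⟩
  -- Filling the unconstrained coordinates with `Set.univ` makes the index set an initial segment,
  -- which splits into the coordinate 0 and a shifted initial segment.
  let u : ℕ → Set α := fun m => if m ∈ s then t m else Set.univ
  have hu : ∀ m, MeasurableSet (u m) := fun m => by
    by_cases h : m ∈ s <;> simp [u, h, ht]
  have h1 : Set.pi (s : Set ℕ) t = Set.pi (Finset.range (n + 1) : Set ℕ) u := by
    ext y
    simp only [Set.mem_pi, Finset.mem_coe, u]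
    constructor
    · intro h m _
      by_cases hm : m ∈ s <;> simp [hm, h]
    · intro h m hm
      simpa [hm] using h m (hn hm)
  have h2 : ∏ m ∈ s, μ (t m) = ∏ m ∈ Finset.range (n + 1), μ (u m) := by
    rw [← Finset.prod_subset hn]
    · exact Finset.prod_congr rfl fun m hm => by simp [u, hm]
    · intro m _ hm
      simp [u, hm]
  rw [h1, h2, Measure.map_apply measurable_seqCons
    (MeasurableSet.pi (Finset.countable_toSet _) fun m _ => hu m)]
  have h3 : (fun p : α × (ℕ → α) => seqCons p.1 p.2) ⁻¹' Set.pi (Finset.range (n + 1) : Set ℕ) u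
      = u 0 ×ˢ Set.pi (Finset.range n : Set ℕ) (fun m => u (m + 1)) := by
    ext ⟨a, y⟩
    simp only [Set.mem_preimage, Set.mem_pi, Finset.mem_coe, Finset.mem_range, Set.mem_prod]
    constructor
    · exact fun h => ⟨h 0 (by omega), fun m hm => h (m + 1) (by omega)⟩
    · rintro ⟨h0, h⟩ m hm
      cases m with
      | zero => exact h0
      | succ m => exact h m (by omega)
  rw [h3, Measure.prod_prod, Measure.infinitePi_pi _ (fun m _ => hu (m + 1)),
    Finset.prod_range_succ', mul_comm]

/-- First step decomposition: after the first state and the first holding time, the chain starts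
afresh from the second state. -/
lemma lintegral_chainLaw_first_step (L : S → S → ℝ) (i : S)
    {F : (ℕ → S) × (ℕ → ℝ) → ℝ≥0∞} (hF : Measurable F) :
    ∫⁻ ω, F ω ∂(chainLaw L i) = ∫⁻ s, ∑' k, jumpLaw L i k *
      ∫⁻ ω, F (seqCons i ω.1, seqCons s ω.2) ∂(chainLaw L k) ∂(expMeasure 1) := by
  set E := Measure.infinitePi (fun _ : ℕ => expMeasure 1) with hE
  have hc : ∀ k, chainLaw L k = (pathLaw L k).prod E := fun k => rfl
  have hG : Measurable fun p : ℝ × ((ℕ → S) × (ℕ → ℝ)) =>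
      F (seqCons i p.2.1, seqCons p.1 p.2.2) :=
    hF.comp (((measurable_seqCons_left i).comp (measurable_fst.comp measurable_snd)).prodMk
      (measurable_seqCons.comp (measurable_fst.prodMk (measurable_snd.comp measurable_snd))))
  have hk : ∀ k, ∫⁻ y, ∫⁻ e, F (seqCons i y, e) ∂E ∂(pathLaw L k)
      = ∫⁻ s, ∫⁻ ω, F (seqCons i ω.1, seqCons s ω.2) ∂(chainLaw L k) ∂(expMeasure 1) := by
    intro k
    have : ∀ y, ∫⁻ e, F (seqCons i y, e) ∂E
        = ∫⁻ s, ∫⁻ e, F (seqCons i y, seqCons s e) ∂E ∂(expMeasure 1) := by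
      intro y
      conv_lhs => rw [hE, infinitePi_eq_map_seqCons]
      rw [lintegral_map (f := fun e => F (seqCons i y, e))
        (hF.comp (measurable_const.prodMk measurable_id)) measurable_seqCons]
      exact lintegral_prod _ (hF.comp (measurable_const.prodMk measurable_seqCons)).aemeasurable
    simp_rw [this]
    rw [lintegral_lintegral_swap]
    · refine lintegral_congr fun s => ?_
      rw [hc]
      exact (lintegral_prod (fun ω => F (seqCons i ω.1, seqCons s ω.2))
        (hG.comp (measurable_const.prodMk measurable_id)).aemeasurable).symm
    · refine Measurable.aemeasurable (Measurable.lintegral_prod_right'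
        (f := fun q : ((ℕ → S) × ℝ) × (ℕ → ℝ) => F (seqCons i q.1.1, seqCons q.1.2 q.2)) ?_)
      exact hG.comp ((measurable_snd.comp measurable_fst).prodMk
        ((measurable_fst.comp measurable_fst).prodMk measurable_snd))
  rw [hc, lintegral_prod _ hF.aemeasurable, lintegral_pathLaw_first_step L i
    (Measurable.lintegral_prod_right' hF), lintegral_tsum]
  · refine tsum_congr fun k => ?_
    rw [hk, lintegral_const_mul]
    exact Measurable.lintegral_prod_right' hG
  · exact fun k => ((Measurable.lintegral_prod_right' hG).const_mul _).aemeasurable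

end FirstStep

/-! ### Transition probabilities through the number of jumps -/

lemma indicator_one_congr {α β : Type*} {s : Set α} {t : Set β} {a : α} {b : β}
    (h : a ∈ s ↔ b ∈ t) : s.indicator (1 : α → ℝ≥0∞) a = t.indicator 1 b := by
  by_cases hb : b ∈ t
  · rw [Set.indicator_of_mem (h.2 hb), Set.indicator_of_mem hb]; rfl
  · rw [Set.indicator_of_notMem (fun ha => hb (h.1 ha)), Set.indicator_of_notMem hb]

section Transition

variable {S : Type*}

/-- The exit rate as a real number. -/
def rate (L : S → S → ℝ) (i : S) : ℝ := (exitRate L i).toReal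

lemma rate_nonneg (L : S → S → ℝ) (i : S) : 0 ≤ rate L i := ENNReal.toReal_nonneg

/-- The probability `e^{-q t}` that the holding time in `i` exceeds `t`, extended by zero to
negative `t`. -/
def survival (L : S → S → ℝ) (i : S) (t : ℝ) : ℝ≥0∞ :=
  if 0 ≤ t then ENNReal.ofReal (Real.exp (-(rate L i * t))) else 0

lemma survival_of_nonneg (L : S → S → ℝ) (i : S) {t : ℝ} (ht : 0 ≤ t) :
    survival L i t = ENNReal.ofReal (Real.exp (-(rate L i * t))) := if_pos ht

lemma survival_of_neg (L : S → S → ℝ) (i : S) {t : ℝ} (ht : t < 0) :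
    survival L i t = 0 := if_neg ht.not_ge

@[fun_prop]
lemma measurable_survival (L : S → S → ℝ) (i : S) : Measurable (survival L i) := by
  unfold survival
  exact Measurable.ite measurableSet_Ici (by fun_prop) measurable_const

lemma jumpRate_eq_zero_of_exitRate {L : S → S → ℝ} {i : S} (h : exitRate L i = 0) (k : S) :
    jumpRate L i k = 0 := by
  unfold exitRate at h
  exact (ENNReal.tsum_eq_zero.1 h) k

lemma jumpLaw_eq {L : S → S → ℝ} {i : S} (h0 : exitRate L i ≠ 0) (hq : exitRate L i ≠ ∞) (k : S) :
    jumpLaw L i k = jumpRate L i k * (exitRate L i)⁻¹ := by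
  rw [jumpLaw, dif_pos ⟨h0, hq⟩]
  exact PMF.normalize_apply h0 hq k

lemma lintegral_expMeasure_one {G : ℝ → ℝ≥0∞} (hG : Measurable G) :
    ∫⁻ s, G s ∂(expMeasure 1)
      = ∫⁻ s, (if 0 ≤ s then ENNReal.ofReal (Real.exp (-s)) else 0) * G s := by
  have h : expMeasure 1 = volume.withDensity (exponentialPDF 1) := rfl
  have hm : Measurable (exponentialPDF 1) := (measurable_exponentialPDFReal 1).ennreal_ofReal
  rw [h, lintegral_withDensity_eq_lintegral_mul _ hm hG]
  refine lintegral_congr fun s => ?_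
  simp only [Pi.mul_apply]
  congr 1
  rw [exponentialPDF_eq]
  split_ifs <;> simp

lemma lintegral_comp_mul_left_real {a : ℝ} (ha : 0 < a) {G : ℝ → ℝ≥0∞} (hG : Measurable G) :
    ∫⁻ s, G s = ENNReal.ofReal a * ∫⁻ s, G (a * s) := by
  conv_lhs => rw [← Real.smul_map_volume_mul_left ha.ne']
  rw [lintegral_smul_measure, lintegral_map hG (by fun_prop), abs_of_pos ha, smul_eq_mul]

lemma expMeasure_one_Ioi {x : ℝ} (hx : 0 ≤ x) :
    expMeasure 1 (Set.Ioi x) = ENNReal.ofReal (Real.exp (-x)) := by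
  have h := cdf_expMeasure_eq one_pos x
  rw [if_pos hx, cdf_eq_real] at h
  have h2 : (expMeasure 1).real (Set.Ioi x) = Real.exp (-x) := by
    rw [← Set.compl_Iic, probReal_compl_eq_one_sub measurableSet_Iic, h]
    simp
  rw [← h2, ofReal_measureReal]

variable [Countable S] [MeasurableSpace S] [MeasurableSingletonClass S]

@[fun_prop]
lemma measurable_jumpTime (L : S → S → ℝ) (n : ℕ) : Measurable (jumpTime L n) := by
  unfold jumpTime
  refine Finset.measurable_sum _ fun m _ => ?_
  have h1 : Measurable fun ω : (ℕ → S) × (ℕ → ℝ) => ω.2 m :=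
    (measurable_pi_apply m).comp measurable_snd
  have h2 : Measurable fun ω : (ℕ → S) × (ℕ → ℝ) => ω.1 m :=
    (measurable_pi_apply m).comp measurable_fst
  exact h1.ennreal_ofReal.div ((measurable_of_countable (exitRate L)).comp h2)

lemma jumpTime_seqCons {L : S → S → ℝ} {i : S} (h0 : exitRate L i ≠ 0) (hq : exitRate L i ≠ ∞)
    {s : ℝ} (n : ℕ) (ω : (ℕ → S) × (ℕ → ℝ)) :
    jumpTime L (n + 1) (seqCons i ω.1, seqCons (rate L i * s) ω.2)
      = ENNReal.ofReal s + jumpTime L n ω := by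
  unfold jumpTime
  rw [Finset.sum_range_succ', add_comm]
  congr 1
  simp only [seqCons_zero]
  rw [ENNReal.ofReal_mul (rate_nonneg L i), rate, ENNReal.ofReal_toReal hq,
    ENNReal.mul_div_right_comm, ENNReal.div_self h0 hq, one_mul]

lemma ae_start (L : S → S → ℝ) (i : S) : ∀ᵐ ω ∂(chainLaw L i), ω.1 0 = i := by
  have hm : MeasurableSet {ω : (ℕ → S) × (ℕ → ℝ) | ω.1 0 = i} :=
    measurableSet_eq_fun ((measurable_pi_apply 0).comp measurable_fst) measurable_const
  have h : {ω : (ℕ → S) × (ℕ → ℝ) | ¬ ω.1 0 = i} = {ω | ω.1 0 = i}ᶜ := rfl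
  rw [ae_iff, h, ← lintegral_indicator_one hm.compl,
    lintegral_chainLaw_first_step L i (measurable_one.indicator hm.compl)]
  simp

lemma ae_holding_pos (L : S → S → ℝ) (i : S) : ∀ᵐ ω ∂(chainLaw L i), ∀ m, 0 < ω.2 m := by
  refine ae_all_iff.2 fun m => ?_
  have h1 : ∀ᵐ s ∂(expMeasure 1), 0 < s := by
    rw [ae_iff]
    have := expMeasure_one_Ioi le_rfl
    have h2 : {s : ℝ | ¬ 0 < s} = (Set.Ioi 0)ᶜ := rfl
    rw [h2, prob_compl_eq_zero_iff measurableSet_Ioi, this]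
    simp
  have h2 : ∀ᵐ e ∂(Measure.infinitePi (fun _ : ℕ => expMeasure 1)), 0 < e m :=
    (measurePreserving_eval_infinitePi (fun _ : ℕ => expMeasure 1) m).quasiMeasurePreserving.ae h1
  exact Measure.quasiMeasurePreserving_snd.ae h2

/-- First step decomposition in terms of the jump rates. -/
lemma lintegral_chainLaw_rate {L : S → S → ℝ} {i : S} (hq : exitRate L i ≠ ∞)
    {F : (ℕ → S) × (ℕ → ℝ) → ℝ≥0∞} (hF : Measurable F)
    (hF0 : exitRate L i = 0 → ∀ ω, jumpTime L 1 ω = ∞ → F ω = 0)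
    {G : ℝ → (ℕ → S) × (ℕ → ℝ) → ℝ≥0∞}
    (hG : exitRate L i ≠ 0 → ∀ s, 0 ≤ s → ∀ ω,
      F (seqCons i ω.1, seqCons (rate L i * s) ω.2) = G s ω) :
    ∫⁻ ω, F ω ∂(chainLaw L i)
      = ∫⁻ s, survival L i s * ∑' k, jumpRate L i k * ∫⁻ ω, G s ω ∂(chainLaw L k) := by
  by_cases h0 : exitRate L i = 0
  -- From an absorbing state both sides vanish: the right side has no jump rates, and on the left
  -- the first jump time is almost surely infinite, where `hF0` applies.
  · simp_rw [jumpRate_eq_zero_of_exitRate h0]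
    simp only [zero_mul, tsum_zero, mul_zero, lintegral_zero]
    rw [lintegral_eq_zero_iff hF]
    filter_upwards [ae_start L i, ae_holding_pos L i] with ω h1 h2
    refine hF0 h0 ω ?_
    simp only [jumpTime, Finset.sum_range_one, h1, h0]
    exact ENNReal.div_zero (by simpa using h2 0)
  · have hr : 0 < rate L i := ENNReal.toReal_pos h0 hq
    have hK : Measurable fun s => ∑' k, jumpLaw L i k *
        ∫⁻ ω, F (seqCons i ω.1, seqCons s ω.2) ∂(chainLaw L k) := by
      refine Measurable.tsum fun k => Measurable.const_mul ?_ _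
      refine Measurable.lintegral_prod_right'
        (f := fun p : ℝ × ((ℕ → S) × (ℕ → ℝ)) => F (seqCons i p.2.1, seqCons p.1 p.2.2)) ?_
      exact hF.comp (((measurable_seqCons_left i).comp
        (measurable_fst.comp measurable_snd)).prodMk
        (measurable_seqCons.comp (measurable_fst.prodMk (measurable_snd.comp measurable_snd))))
    have hE : Measurable fun s : ℝ => if 0 ≤ s then ENNReal.ofReal (Real.exp (-s)) else 0 :=
      Measurable.ite measurableSet_Ici (by fun_prop) measurable_const
    rw [lintegral_chainLaw_first_step L i hF, lintegral_expMeasure_one hK]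
    -- Rescaling the unit exponential variable by the exit rate gives the actual holding time; the
    -- Jacobian cancels the normalization of `jumpLaw`.
    refine (lintegral_comp_mul_left_real hr (hE.mul hK)).trans ?_
    rw [← lintegral_const_mul]
    · refine lintegral_congr fun s => ?_
      simp only [Pi.mul_apply]
      by_cases hs : 0 ≤ s
      · rw [survival_of_nonneg L i hs, if_pos (by positivity), ← mul_assoc,
          mul_comm (ENNReal.ofReal (rate L i)), mul_assoc, ← ENNReal.tsum_mul_left]
        congr 1
        refine tsum_congr fun k => ?_
        rw [jumpLaw_eq h0 hq, rate, ENNReal.ofReal_toReal hq, ← mul_assoc, ← rate]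
        congr 1
        · rw [mul_comm, mul_assoc, ENNReal.inv_mul_cancel h0 hq, mul_one]
        · exact lintegral_congr fun ω => hG h0 s hs ω
      · rw [survival_of_neg L i (not_le.1 hs), if_neg (by
          rw [not_le] at hs ⊢; exact mul_neg_of_pos_of_neg hr hs)]
        simp
    · exact (hE.mul hK).comp (measurable_const_mul _)

/-- The convolution of the first holding time in `i` with `f k`, where `k` is the next state. -/
def stepConv (L : S → S → ℝ) (i : S) (f : S → ℝ → ℝ≥0∞) (t : ℝ) : ℝ≥0∞ :=
  ∫⁻ s, survival L i s * ∑' k, jumpRate L i k * f k (t - s)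

open Classical in
/-- The probability that the chain started at `i` is in `j` at time `t`, after exactly `n` jumps;
zero for `t < 0`. -/
def nJump (L : S → S → ℝ) : ℕ → S → S → ℝ → ℝ≥0∞
  | 0, i, j => if i = j then survival L i else 0
  | n + 1, i, j => stepConv L i (fun k => nJump L n k j)

lemma nJump_zero_self (L : S → S → ℝ) (j : S) : nJump L 0 j j = survival L j := by
  simp [nJump]

lemma nJump_zero_of_ne (L : S → S → ℝ) {i j : S} (h : i ≠ j) : nJump L 0 i j = 0 := by
  simp [nJump, h]

lemma nJump_succ (L : S → S → ℝ) (n : ℕ) (i j : S) (t : ℝ) : nJump L (n + 1) i j t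
    = ∫⁻ s, survival L i s * ∑' k, jumpRate L i k * nJump L n k j (t - s) := rfl

@[fun_prop]
lemma measurable_stepConv (L : S → S → ℝ) (i : S) {f : S → ℝ → ℝ≥0∞}
    (hf : ∀ k, Measurable (f k)) : Measurable (stepConv L i f) := by
  unfold stepConv
  refine Measurable.lintegral_prod_right'
    (f := fun p : ℝ × ℝ => survival L i p.2 * ∑' k, jumpRate L i k * f k (p.1 - p.2)) ?_
  refine ((measurable_survival L i).comp measurable_snd).mul (Measurable.tsum fun k => ?_)
  exact ((hf k).comp (measurable_fst.sub measurable_snd)).const_mul _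

@[fun_prop]
lemma measurable_nJump (L : S → S → ℝ) (n : ℕ) (i j : S) : Measurable (nJump L n i j) := by
  induction n generalizing i with
  | zero =>
    by_cases h : i = j
    · subst h; rw [nJump_zero_self]; fun_prop
    · rw [nJump_zero_of_ne L h]; exact measurable_const
  | succ n ih => exact measurable_stepConv L i fun k => ih k

lemma nJump_of_neg (L : S → S → ℝ) (n : ℕ) (i j : S) {t : ℝ} (ht : t < 0) :
    nJump L n i j t = 0 := by
  induction n generalizing i t with
  | zero =>
    by_cases h : i = j
    · subst h; rw [nJump_zero_self, survival_of_neg L i ht]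
    · rw [nJump_zero_of_ne L h]; rfl
  | succ n ih =>
    rw [nJump_succ, lintegral_eq_zero_iff]
    · refine Eventually.of_forall fun s => ?_
      simp only [Pi.zero_apply]
      rcases lt_or_ge s 0 with hs | hs
      · rw [survival_of_neg L i hs, zero_mul]
      · simp [fun k => ih k (show t - s < 0 by linarith)]
    · exact (measurable_survival L i).mul (Measurable.tsum fun k =>
        ((measurable_nJump L n k j).comp (measurable_const.sub measurable_id)).const_mul _)

/-- The event that the chain is in `j` at time `t ≥ 0`, after exactly `n` jumps. -/
def jumpEvent (L : S → S → ℝ) (n : ℕ) (j : S) (t : ℝ) : Set ((ℕ → S) × (ℕ → ℝ)) :=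
  {ω | 0 ≤ t ∧ jumpTime L n ω ≤ ENNReal.ofReal t ∧ ENNReal.ofReal t < jumpTime L (n + 1) ω ∧
    ω.1 n = j}

lemma measurableSet_jumpEvent (L : S → S → ℝ) (n : ℕ) (j : S) (t : ℝ) :
    MeasurableSet (jumpEvent L n j t) := by
  refine (MeasurableSet.const _).inter ((measurableSet_le (measurable_jumpTime L n)
    measurable_const).inter ((measurableSet_lt measurable_const
    (measurable_jumpTime L (n + 1))).inter ?_))
  exact measurableSet_eq_fun ((measurable_pi_apply n).comp measurable_fst) measurable_const

/-- First step analysis: after a first jump at time s, being in `j` at time t after n + 1 jumps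
means being there after n jumps in the remaining time t - s. -/
lemma chainLaw_jumpEvent {L : S → S → ℝ} (hq : ∀ i, exitRate L i ≠ ∞) (n : ℕ) (i j : S) (t : ℝ) :
    chainLaw L i (jumpEvent L n j t) = nJump L n i j t := by
  induction n generalizing i t with
  | zero =>
    rcases lt_or_ge t 0 with ht | ht
    · rw [nJump_of_neg L 0 i j ht]
      have : jumpEvent L 0 j t = ∅ := by
        ext ω; simp [jumpEvent, ht]
      simp [this]
    rw [← lintegral_indicator_one (measurableSet_jumpEvent L 0 j t),
      lintegral_chainLaw_first_step L i
        (measurable_one.indicator (measurableSet_jumpEvent L 0 j t))]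
    have h1 : ∀ (s : ℝ) (ω : (ℕ → S) × (ℕ → ℝ)),
        (jumpEvent L 0 j t).indicator 1 (seqCons i ω.1, seqCons s ω.2)
          = {s : ℝ | i = j ∧ ENNReal.ofReal t < ENNReal.ofReal s / exitRate L i}.indicator
            (1 : ℝ → ℝ≥0∞) s := by
      intro s ω
      refine indicator_one_congr ?_
      simp [jumpEvent, jumpTime, ht, and_comm]
    simp_rw [h1]
    simp only [lintegral_const, measure_univ, mul_one, ENNReal.tsum_mul_right,
      (jumpLaw L i).tsum_coe, one_mul]
    by_cases hij : i = j
    · subst hij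
      simp only [true_and]
      rw [lintegral_indicator_one (measurableSet_lt measurable_const
        (ENNReal.measurable_ofReal.div_const _)), nJump_zero_self, survival_of_nonneg L i ht]
      by_cases h0 : exitRate L i = 0
      -- In an absorbing state the holding time is a division by zero: infinite for s > 0, but zero
      -- for s ≤ 0.
      · have h2 : {s : ℝ | ENNReal.ofReal t < ENNReal.ofReal s / exitRate L i} = Set.Ioi 0 := by
          ext s
          simp only [h0, Set.mem_ofPred_eq, Set.mem_Ioi]
          rcases lt_or_ge 0 s with hs | hs
          · rw [ENNReal.div_zero (by simpa using hs)]
            simp [hs]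
          · simp [ENNReal.ofReal_of_nonpos hs, hs.not_gt]
        rw [h2, expMeasure_one_Ioi le_rfl]
        simp [rate, h0]
      · have hr : 0 < rate L i := ENNReal.toReal_pos h0 (hq i)
        have h2 : {s : ℝ | ENNReal.ofReal t < ENNReal.ofReal s / exitRate L i}
            = Set.Ioi (rate L i * t) := by
          ext s
          simp only [Set.mem_ofPred_eq, Set.mem_Ioi]
          rw [ENNReal.lt_div_iff_mul_lt (Or.inl h0) (Or.inl (hq i)),
            ← ENNReal.ofReal_toReal (hq i), ← ENNReal.ofReal_mul ht, mul_comm t, ← rate,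
            ENNReal.ofReal_lt_ofReal_iff_of_nonneg (by positivity)]
        rw [h2, expMeasure_one_Ioi (by positivity)]
    · simp [hij, nJump_zero_of_ne]
  | succ n ih =>
    rw [← lintegral_indicator_one (measurableSet_jumpEvent L (n + 1) j t), nJump_succ,
      lintegral_chainLaw_rate (hq i) (measurable_one.indicator
        (measurableSet_jumpEvent L (n + 1) j t)) (G := fun s => (jumpEvent L n j (t - s)).indicator 1)]
    · refine lintegral_congr fun s => ?_
      simp_rw [lintegral_indicator_one (measurableSet_jumpEvent L n j (t - s)), ih]
    · intro _ ω hω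
      refine Set.indicator_of_notMem (fun h => ?_) _
      have h2 : jumpTime L 1 ω ≤ jumpTime L (n + 1) ω := by
        unfold jumpTime
        exact Finset.sum_le_sum_of_subset (Finset.range_mono (by omega))
      rw [hω, top_le_iff] at h2
      have := h.2.1
      rw [h2] at this
      simp at this
    · intro h0 s hs ω
      have h1 : (seqCons i ω.1, seqCons (rate L i * s) ω.2) ∈ jumpEvent L (n + 1) j t
          ↔ ω ∈ jumpEvent L n j (t - s) := by
        simp only [jumpEvent, Set.mem_ofPred_eq, jumpTime_seqCons h0 (hq i), seqCons_succ]
        rcases le_or_gt s t with hst | hst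
        · have h3 : ENNReal.ofReal t = ENNReal.ofReal s + ENNReal.ofReal (t - s) := by
            rw [← ENNReal.ofReal_add hs (by linarith)]; congr 1; ring
          rw [h3, ENNReal.add_le_add_iff_left ENNReal.ofReal_ne_top,
            ENNReal.add_lt_add_iff_left ENNReal.ofReal_ne_top]
          simp [hst, hs.trans hst]
        · constructor
          · rintro ⟨ht, h4, -⟩
            have h5 := le_self_add.trans h4
            rw [ENNReal.ofReal_le_ofReal_iff ht] at h5
            linarith
          · rintro ⟨h4, -⟩
            linarith
      exact indicator_one_congr h1

/-- The transition function, as an extended nonnegative function of a real time; zero for negative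
times. -/
def trans (L : S → S → ℝ) (i j : S) (t : ℝ) : ℝ≥0∞ := ∑' n, nJump L n i j t

@[fun_prop]
lemma measurable_trans (L : S → S → ℝ) (i j : S) : Measurable (trans L i j) :=
  Measurable.tsum fun n => measurable_nJump L n i j

lemma trans_of_neg (L : S → S → ℝ) (i j : S) {t : ℝ} (ht : t < 0) : trans L i j t = 0 := by
  simp [trans, nJump_of_neg L _ i j ht]

lemma jumpTime_mono (L : S → S → ℝ) (ω : (ℕ → S) × (ℕ → ℝ)) :
    Monotone fun n => jumpTime L n ω := fun _ _ h =>
  Finset.sum_le_sum_of_subset (Finset.range_mono h)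

lemma stateAt_eq_some_iff (L : S → S → ℝ) (t : ℝ≥0) (j : S) (ω : (ℕ → S) × (ℕ → ℝ)) :
    stateAt L t ω = some j ↔ ∃ n, ω ∈ jumpEvent L n j t := by
  have ht : ENNReal.ofReal (t : ℝ) = t := ENNReal.ofReal_coe_nnreal
  simp only [jumpEvent, Set.mem_ofPred_eq, ht, NNReal.zero_le_coe, true_and, stateAt]
  constructor
  · intro h
    split_ifs at h with h1
    exact ⟨h1.choose, h1.choose_spec.1, h1.choose_spec.2, Option.some_injective _ h⟩
  · rintro ⟨n, h1, h2, h3⟩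
    have hex : ∃ n, jumpTime L n ω ≤ t ∧ (t : ℝ≥0∞) < jumpTime L (n + 1) ω := ⟨n, h1, h2⟩
    rw [dif_pos hex]
    have h4 := hex.choose_spec
    have h5 : hex.choose = n := by
      refine le_antisymm ?_ ?_
      · by_contra hc
        exact (h4.1.trans_lt h2).not_ge (jumpTime_mono L ω (show n + 1 ≤ hex.choose by omega))
      · by_contra hc
        exact (h1.trans_lt h4.2).not_ge (jumpTime_mono L ω (show hex.choose + 1 ≤ n by omega))
    rw [h5, h3]

lemma disjoint_jumpEvent (L : S → S → ℝ) (t : ℝ) {p q : ℕ × S} (h : p ≠ q) :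
    Disjoint (jumpEvent L p.1 p.2 t) (jumpEvent L q.1 q.2 t) := by
  rw [Set.disjoint_left]
  rintro ω ⟨_, h1, h2, h3⟩ ⟨_, h4, h5, h6⟩
  have : p.1 = q.1 := by
    refine le_antisymm ?_ ?_
    · by_contra hc
      exact (h1.trans_lt h5).not_ge (jumpTime_mono L ω (show q.1 + 1 ≤ p.1 by omega))
    · by_contra hc
      exact (h4.trans_lt h2).not_ge (jumpTime_mono L ω (show p.1 + 1 ≤ q.1 by omega))
  exact h (Prod.ext this (by rw [← h3, ← h6, this]))

lemma chainLaw_stateAt {L : S → S → ℝ} (hq : ∀ i, exitRate L i ≠ ∞) (t : ℝ≥0) (i j : S) :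
    chainLaw L i {ω | stateAt L t ω = some j} = trans L i j t := by
  have : {ω | stateAt L t ω = some j} = ⋃ n, jumpEvent L n j t := by
    ext ω
    simp [stateAt_eq_some_iff]
  rw [this, measure_iUnion _ (fun n => measurableSet_jumpEvent L n j t), trans]
  · simp_rw [chainLaw_jumpEvent hq]
  · intro m n hmn
    exact disjoint_jumpEvent L t (p := (m, j)) (q := (n, j)) (by simpa using hmn)

lemma transition_eq {L : S → S → ℝ} (hq : ∀ i, exitRate L i ≠ ∞) (t : ℝ≥0) (i j : S) :
    transition L t i j = (trans L i j t).toReal := by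
  rw [transition, Measure.real, chainLaw_stateAt hq]

lemma tsum_trans {L : S → S → ℝ} (hq : ∀ i, exitRate L i ≠ ∞) (i : S) (t : ℝ) :
    ∑' j, trans L i j t = chainLaw L i (⋃ p : ℕ × S, jumpEvent L p.1 p.2 t) := by
  rw [measure_iUnion (fun p q h => disjoint_jumpEvent L t h)
    (fun p => measurableSet_jumpEvent L p.1 p.2 t)]
  simp_rw [chainLaw_jumpEvent hq, trans]
  rw [ENNReal.tsum_comm]
  exact (ENNReal.tsum_prod (f := fun n j => nJump L n i j t)).symm

lemma tsum_trans_le_one {L : S → S → ℝ} (hq : ∀ i, exitRate L i ≠ ∞) (i : S) (t : ℝ) :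
    ∑' j, trans L i j t ≤ 1 := by
  rw [tsum_trans hq]
  exact prob_le_one

lemma trans_le_one {L : S → S → ℝ} (hq : ∀ i, exitRate L i ≠ ∞) (i j : S) (t : ℝ) :
    trans L i j t ≤ 1 :=
  (ENNReal.le_tsum j).trans (tsum_trans_le_one hq i t)

end Transition

/-! ### Semigroup property, forward equation, reversibility and positivity -/

section Semigroup

variable {S : Type*} [Countable S] [MeasurableSpace S] [MeasurableSingletonClass S]

lemma lconvolution_apply_sub (f g : ℝ → ℝ≥0∞) (t : ℝ) :
    (f ⋆ₗ g) t = ∫⁻ s, f s * g (t - s) := by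
  rw [lconvolution_def]
  refine lintegral_congr fun s => ?_
  rw [neg_add_eq_sub]

lemma lconvolution_tsum_right {ι : Type*} [Countable ι] {f : ℝ → ℝ≥0∞} (hf : Measurable f)
    (c : ι → ℝ≥0∞) {g : ι → ℝ → ℝ≥0∞} (hg : ∀ k, Measurable (g k)) (t : ℝ) :
    (f ⋆ₗ (fun u => ∑' k, c k * g k u)) t = ∑' k, c k * (f ⋆ₗ g k) t := by
  have hm : ∀ k, Measurable fun s => f s * g k (t - s) := fun k =>
    hf.mul ((hg k).comp (measurable_const.sub measurable_id))
  simp_rw [lconvolution_apply_sub]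
  have hc : ∀ k, c k * ∫⁻ s, f s * g k (t - s) = ∫⁻ s, c k * (f s * g k (t - s)) :=
    fun k => (lintegral_const_mul (c k) (hm k)).symm
  simp_rw [hc]
  rw [← lintegral_tsum fun k => ((hm k).const_mul _).aemeasurable]
  refine lintegral_congr fun s => ?_
  rw [← ENNReal.tsum_mul_left]
  exact tsum_congr fun k => by ring

lemma lconvolution_tsum_left {ι : Type*} [Countable ι] {f : ℝ → ℝ≥0∞} (hf : Measurable f)
    (c : ι → ℝ≥0∞) {g : ι → ℝ → ℝ≥0∞} (hg : ∀ k, Measurable (g k)) (t : ℝ) :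
    ((fun u => ∑' k, c k * g k u) ⋆ₗ f) t = ∑' k, c k * (g k ⋆ₗ f) t := by
  rw [lconvolution_comm, lconvolution_tsum_right hf c hg]
  exact tsum_congr fun k => by rw [lconvolution_comm]

lemma stepConv_eq_tsum (L : S → S → ℝ) (i : S) {f : S → ℝ → ℝ≥0∞} (hf : ∀ k, Measurable (f k))
    (t : ℝ) : stepConv L i f t = ∑' k, jumpRate L i k * (survival L i ⋆ₗ f k) t := by
  rw [← lconvolution_tsum_right (measurable_survival L i) _ hf, lconvolution_apply_sub, stepConv]

lemma nJump_backward (L : S → S → ℝ) (n : ℕ) (i j : S) (t : ℝ) :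
    nJump L (n + 1) i j t = ∑' k, jumpRate L i k * (survival L i ⋆ₗ nJump L n k j) t :=
  stepConv_eq_tsum L i (fun k => measurable_nJump L n k j) t

/-- The definition cuts a path at its first jump. Cutting at the last one gives the same result:
both become a double sum over the first and last jumps, matched by associativity of convolution. -/
lemma nJump_forward (L : S → S → ℝ) (n : ℕ) (i j : S) (t : ℝ) :
    nJump L (n + 1) i j t = ∑' k, jumpRate L k j * (nJump L n i k ⋆ₗ survival L j) t := by
  induction n generalizing i t with
  | zero =>
    rw [nJump_backward, tsum_eq_single j, tsum_eq_single i, nJump_zero_self, nJump_zero_self]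
    · intro k hk
      rw [nJump_zero_of_ne L hk.symm]; simp
    · intro k hk
      rw [nJump_zero_of_ne L hk]; simp
  | succ n ih =>
    have hm : ∀ k l, Measurable (nJump L n k l ⋆ₗ survival L j) := fun k l =>
      measurable_lconvolution _ (measurable_nJump L n k l) (measurable_survival L j)
    have hm' : ∀ k l, Measurable (survival L i ⋆ₗ nJump L n k l) := fun k l =>
      measurable_lconvolution _ (measurable_survival L i) (measurable_nJump L n k l)
    have h1 : ∀ k, nJump L (n + 1) k j
        = fun u => ∑' l, jumpRate L l j * (nJump L n k l ⋆ₗ survival L j) u :=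
      fun k => funext fun u => ih k u
    have h2 : ∀ l, nJump L (n + 1) i l
        = fun u => ∑' k, jumpRate L i k * (survival L i ⋆ₗ nJump L n k l) u :=
      fun l => funext fun u => nJump_backward L n i l u
    rw [nJump_backward]
    simp_rw [h1]
    simp_rw [fun k => lconvolution_tsum_right (measurable_survival L i)
      (fun l => jumpRate L l j) (hm k) t, h2]
    simp_rw [fun l => lconvolution_tsum_left (measurable_survival L j)
      (fun k => jumpRate L i k) (fun k => hm' k l) t, ← ENNReal.tsum_mul_left]
    rw [ENNReal.tsum_comm]
    refine tsum_congr fun l => tsum_congr fun k => ?_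
    rw [lconvolution_assoc (measurable_survival L i) (measurable_nJump L n k l)
      (measurable_survival L j)]
    ring

lemma jumpRate_reversible {L : S → S → ℝ} {π : S → ℝ} (hπ : ∀ i, 0 ≤ π i)
    (hrev : IsReversible L π) (i j : S) :
    ENNReal.ofReal (π i) * jumpRate L i j = ENNReal.ofReal (π j) * jumpRate L j i := by
  by_cases h : i = j
  · rw [h]
  · rw [jumpRate, jumpRate, if_neg (Ne.symm h), if_neg h, ← ENNReal.ofReal_mul (hπ i),
      ← ENNReal.ofReal_mul (hπ j), hrev]

/-- Detailed balance turns the backward equation for (i,j) into the forward equation for (j,i), term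
by term. Working with a fixed number of jumps makes this independent of any explosion. -/
lemma nJump_reversible {L : S → S → ℝ} {π : S → ℝ} (hπ : ∀ i, 0 ≤ π i)
    (hrev : IsReversible L π) (n : ℕ) (i j : S) (t : ℝ) :
    ENNReal.ofReal (π i) * nJump L n i j t = ENNReal.ofReal (π j) * nJump L n j i t := by
  induction n generalizing i j t with
  | zero =>
    by_cases h : i = j
    · rw [h]
    · rw [nJump_zero_of_ne L h, nJump_zero_of_ne L (Ne.symm h)]; simp
  | succ n ih =>
    rw [nJump_backward, nJump_forward, ← ENNReal.tsum_mul_left, ← ENNReal.tsum_mul_left]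
    refine tsum_congr fun k => ?_
    have hm : ∀ a b, Measurable fun s => survival L i s * nJump L n a b (t - s) := fun a b =>
      (measurable_survival L i).mul
        ((measurable_nJump L n a b).comp (measurable_const.sub measurable_id))
    rw [← mul_assoc, jumpRate_reversible hπ hrev, lconvolution_comm (f := nJump L n j k),
      lconvolution_apply_sub, lconvolution_apply_sub, mul_comm _ (jumpRate L k i), mul_assoc,
      mul_left_comm (ENNReal.ofReal (π j)), ← lintegral_const_mul _ (hm k j),
      ← lintegral_const_mul _ (hm j k)]
    congr 1
    refine lintegral_congr fun s => ?_
    rw [mul_left_comm, ih k j, mul_left_comm]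

lemma trans_reversible {L : S → S → ℝ} {π : S → ℝ} (hπ : ∀ i, 0 ≤ π i)
    (hrev : IsReversible L π) (i j : S) (t : ℝ) :
    ENNReal.ofReal (π i) * trans L i j t = ENNReal.ofReal (π j) * trans L j i t := by
  rw [trans, trans, ← ENNReal.tsum_mul_left, ← ENNReal.tsum_mul_left]
  exact tsum_congr fun n => nJump_reversible hπ hrev n i j t

lemma survival_add (L : S → S → ℝ) (i : S) {t s : ℝ} (ht : 0 ≤ t) (hs : 0 ≤ s) :
    survival L i (t + s) = survival L i t * survival L i s := by
  rw [survival_of_nonneg L i ht, survival_of_nonneg L i hs, survival_of_nonneg L i (by positivity),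
    ← ENNReal.ofReal_mul (Real.exp_pos _).le, ← Real.exp_add]
  ring_nf

/-- Induction on the number of jumps, according to whether the first jump comes before or after time
`t`. The summand with no jump before `t` is shifted in `hB` so that both cases become integrals over
the same variable, the time `u` of the first jump. -/
lemma nJump_chapman_kolmogorov (L : S → S → ℝ) (n : ℕ) (i j : S) {t s : ℝ} (ht : 0 ≤ t)
    (hs : 0 ≤ s) : nJump L n i j (t + s)
      = ∑ p ∈ Finset.HasAntidiagonal.antidiagonal n, ∑' k, nJump L p.1 i k t * nJump L p.2 k j s := by
  induction n generalizing i t with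
  | zero =>
    rw [Finset.Nat.antidiagonal_zero, Finset.sum_singleton, tsum_eq_single i]
    · rw [nJump_zero_self]
      by_cases h : i = j
      · subst h
        rw [nJump_zero_self, survival_add L i ht hs]
      · simp [nJump_zero_of_ne L h]
    · intro k hk
      simp [nJump_zero_of_ne L hk.symm]
  | succ n ih =>
    have hmt : ∀ k l m, Measurable fun u => survival L i u * nJump L m k l (t - u) :=
      fun k l m => (measurable_survival L i).mul
        ((measurable_nJump L m k l).comp (measurable_const.sub measurable_id))
    have hA : ∀ (p : ℕ × ℕ) (l : S), nJump L (p.1 + 1) i l t * nJump L p.2 l j s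
        = ∫⁻ u, survival L i u * (∑' k, jumpRate L i k * nJump L p.1 k l (t - u)) *
          nJump L p.2 l j s := by
      intro p l
      rw [nJump_succ, lintegral_mul_const]
      exact (measurable_survival L i).mul (Measurable.tsum fun k =>
        ((measurable_nJump L p.1 k l).comp (measurable_const.sub measurable_id)).const_mul _)
    have hAm : ∀ (p : ℕ × ℕ) (l : S), Measurable fun u =>
        survival L i u * (∑' k, jumpRate L i k * nJump L p.1 k l (t - u)) *
          nJump L p.2 l j s := fun p l =>
      ((measurable_survival L i).mul (Measurable.tsum fun k =>
        ((measurable_nJump L p.1 k l).comp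
          (measurable_const.sub measurable_id)).const_mul _)).mul_const _
    have hB : survival L i t * nJump L (n + 1) i j s
        = ∫⁻ u, survival L i t * (survival L i (u - t) *
            ∑' k, jumpRate L i k * nJump L n k j (s - (u - t))) := by
      rw [nJump_succ, ← lintegral_sub_right_eq_self (μ := volume) _ t, lintegral_const_mul]
      refine ((measurable_survival L i).comp (measurable_id.sub_const t)).mul
        (Measurable.tsum fun k => ((measurable_nJump L n k j).comp
          (measurable_const.sub (measurable_id.sub_const t))).const_mul _)
    rw [Finset.Nat.sum_antidiagonal_succ, tsum_eq_single i, nJump_zero_self]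
    · simp_rw [hA]
      have hT : ∀ p : ℕ × ℕ, ∑' l, ∫⁻ u, survival L i u *
          (∑' k, jumpRate L i k * nJump L p.1 k l (t - u)) * nJump L p.2 l j s
          = ∫⁻ u, ∑' l, survival L i u *
          (∑' k, jumpRate L i k * nJump L p.1 k l (t - u)) * nJump L p.2 l j s :=
        fun p => (lintegral_tsum fun l => (hAm p l).aemeasurable).symm
      simp_rw [hT]
      rw [← lintegral_finsetSum _ fun p _ => Measurable.tsum fun l => hAm p l, hB,
        ← lintegral_add_right _ (Finset.measurable_sum _ fun p _ =>
          Measurable.tsum fun l => hAm p l), nJump_succ]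
      -- At `u = t` both cases may contribute; this is a null set.
      have hne : ∀ᵐ u : ℝ, u ≠ t := by simp [ae_iff]
      refine lintegral_congr_ae (hne.mono fun u hu => ?_)
      simp only
      rcases lt_or_gt_of_ne hu with h | h
      · rw [survival_of_neg L i (show u - t < 0 by linarith)]
        have h1 : ∀ k, nJump L n k j (t + s - u)
            = ∑ p ∈ Finset.HasAntidiagonal.antidiagonal n, ∑' l, nJump L p.1 k l (t - u) * nJump L p.2 l j s := by
          intro k
          rw [← ih k (show 0 ≤ t - u by linarith)]
          congr 1; ring
        simp_rw [h1, Finset.mul_sum]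
        rw [Summable.tsum_finsetSum fun _ _ => ENNReal.summable, Finset.mul_sum, zero_mul, mul_zero,
          zero_add]
        refine Finset.sum_congr rfl fun p _ => ?_
        simp_rw [← ENNReal.tsum_mul_left, ← ENNReal.tsum_mul_right]
        rw [ENNReal.tsum_comm]
        exact tsum_congr fun l => tsum_congr fun k => by ring
      -- The first jump comes after `t`: only the summand without earlier jumps is left, and the
      -- holding time is memoryless.
      · have h1 : ∀ (p : ℕ × ℕ) l k, nJump L p.1 k l (t - u) = 0 := fun p l k =>
          nJump_of_neg L _ _ _ (by linarith)
        simp only [h1, mul_zero, tsum_zero, zero_mul, Finset.sum_const_zero, add_zero]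
        rw [← mul_assoc, ← survival_add L i ht (by linarith)]
        have h2 : s - (u - t) = t + s - u := by ring
        rw [h2, add_sub_cancel]
    · intro k hk
      simp [nJump_zero_of_ne L hk.symm]

lemma chapman_kolmogorov (L : S → S → ℝ) (i j : S) {t s : ℝ} (ht : 0 ≤ t) (hs : 0 ≤ s) :
    trans L i j (t + s) = ∑' k, trans L i k t * trans L k j s := by
  have h1 : ∀ k, trans L i k t * trans L k j s
      = ∑' n, ∑ p ∈ Finset.HasAntidiagonal.antidiagonal n, nJump L p.1 i k t * nJump L p.2 k j s := by
    intro k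
    rw [trans, trans, ← ENNReal.tsum_mul_right]
    simp_rw [← ENNReal.tsum_mul_left]
    rw [← ENNReal.tsum_prod (f := fun m n => nJump L m i k t * nJump L n k j s),
      ← Finset.HasAntidiagonal.sigmaAntidiagonalEquivProd.tsum_eq, ENNReal.tsum_sigma']
    refine tsum_congr fun n => ?_
    exact Finset.tsum_subtype (Finset.HasAntidiagonal.antidiagonal n)
      (fun p : ℕ × ℕ => nJump L p.1 i k t * nJump L p.2 k j s)
  simp_rw [h1]
  rw [ENNReal.tsum_comm, trans]
  refine tsum_congr fun n => ?_
  rw [nJump_chapman_kolmogorov L n i j ht hs, Summable.tsum_finsetSum fun _ _ => ENNReal.summable]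

lemma nJump_pos {L : S → S → ℝ} {i j : S} (h : Relation.ReflTransGen (fun a b => 0 < L a b) i j) :
    ∃ n, ∀ t, 0 < t → 0 < nJump L n i j t := by
  induction h using Relation.ReflTransGen.head_induction_on with
  | refl =>
    refine ⟨0, fun t ht => ?_⟩
    rw [nJump_zero_self, survival_of_nonneg L j ht.le]
    simpa using Real.exp_pos _
  | @head a b hab _ ih =>
    obtain ⟨n, hn⟩ := ih
    -- A step from a state to itself is not a jump and is skipped.
    by_cases hne : b = a
    · exact ⟨n, hne ▸ hn⟩
    refine ⟨n + 1, fun t ht => ?_⟩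
    have hm : Measurable fun s => survival L a s * ∑' k, jumpRate L a k * nJump L n k j (t - s) :=
      (measurable_survival L a).mul (Measurable.tsum fun k =>
        ((measurable_nJump L n k j).comp (measurable_const.sub measurable_id)).const_mul _)
    rw [nJump_succ, lintegral_pos_iff_support hm]
    refine lt_of_lt_of_le ?_ (measure_mono (s := Set.Ioo 0 t) fun s hs => ?_)
    · simpa using ht
    · rw [Function.mem_support]
      refine (ENNReal.mul_pos ?_ ?_).ne'
      · rw [survival_of_nonneg L a hs.1.le]
        simpa using Real.exp_pos _
      · refine (lt_of_lt_of_le (ENNReal.mul_pos ?_ (hn (t - s) (by linarith [hs.2])).ne')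
          (ENNReal.le_tsum b)).ne'
        rw [jumpRate, if_neg hne]
        simpa using hab

lemma trans_pos {L : S → S → ℝ} (hirr : IsIrreducibleGen L) (i j : S) {t : ℝ} (ht : 0 < t) :
    0 < trans L i j t := by
  obtain ⟨n, hn⟩ := nJump_pos (hirr i j)
  exact (hn t ht).trans_le (ENNReal.le_tsum n)

end Semigroup

/-! ### Hitting times -/

section Hitting

variable {S : Type*} [Countable S] [MeasurableSpace S] [MeasurableSingletonClass S]

open Classical in
/-- The time of the first jump after which the chain is in `j`; almost surely equal to the hitting
time. -/
def firstHit (L : S → S → ℝ) (j : S) (ω : (ℕ → S) × (ℕ → ℝ)) : ℝ≥0∞ :=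
  ⨅ n, if ω.1 n = j then jumpTime L n ω else ∞

lemma measurableSet_at (n : ℕ) (j : S) :
    MeasurableSet {ω : (ℕ → S) × (ℕ → ℝ) | ω.1 n = j} :=
  measurableSet_eq_fun ((measurable_pi_apply n).comp measurable_fst) measurable_const

@[fun_prop]
lemma measurable_firstHit (L : S → S → ℝ) (j : S) : Measurable (firstHit L j) := by
  unfold firstHit
  exact Measurable.iInf fun n =>
    Measurable.ite (measurableSet_at n j) (measurable_jumpTime L n) measurable_const

/-- A visit to `j` takes place in a holding interval, whose left endpoint is a jump time. Conversely
a finite jump time lies in the half-open interval that it starts, because the holding time is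
positive. -/
lemma hittingTime_eq_firstHit {L : S → S → ℝ} (hq : ∀ i, exitRate L i ≠ ∞) (j : S)
    {ω : (ℕ → S) × (ℕ → ℝ)} (hω : ∀ m, 0 < ω.2 m) : hittingTime L j ω = firstHit L j ω := by
  refine le_antisymm (le_iInf fun n => ?_) (le_iInf₂ fun t ht => ?_)
  · split_ifs with h
    · rcases eq_or_ne (jumpTime L n ω) ∞ with hJ | hJ
      · simp [hJ]
      · have h1 : stateAt L (jumpTime L n ω).toNNReal ω = some j := by
          rw [stateAt_eq_some_iff]
          have h2 : ENNReal.ofReal ((jumpTime L n ω).toNNReal : ℝ) = jumpTime L n ω := by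
            rw [ENNReal.ofReal_coe_nnreal, ENNReal.coe_toNNReal hJ]
          refine ⟨n, NNReal.coe_nonneg _, h2.ge, ?_, h⟩
          rw [h2, jumpTime, jumpTime, Finset.sum_range_succ, ← jumpTime]
          refine ENNReal.lt_add_right hJ ?_
          rw [Ne, ENNReal.div_eq_zero_iff, not_or]
          exact ⟨by simpa using hω n, hq _⟩
        exact iInf_le_of_le _ (iInf_le_of_le h1 (ENNReal.coe_toNNReal hJ).le)
    · exact le_top
  · obtain ⟨n, h1⟩ := (stateAt_eq_some_iff L t j ω).1 ht
    refine (iInf_le _ n).trans ?_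
    rw [if_pos h1.2.2.2]
    simpa using h1.2.1

lemma meanHit_eq_firstHit {L : S → S → ℝ} (hq : ∀ i, exitRate L i ≠ ∞) (i j : S) :
    meanHit L i j = ∫⁻ ω, firstHit L j ω ∂(chainLaw L i) :=
  lintegral_congr_ae ((ae_holding_pos L i).mono fun _ hω => hittingTime_eq_firstHit hq j hω)

lemma firstHit_eq_zero {L : S → S → ℝ} {j : S} {ω : (ℕ → S) × (ℕ → ℝ)} (h : ω.1 0 = j) :
    firstHit L j ω = 0 := by
  refine le_antisymm ((iInf_le _ 0).trans ?_) zero_le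
  rw [if_pos h]
  simp [jumpTime]

lemma meanHit_self {L : S → S → ℝ} (hq : ∀ i, exitRate L i ≠ ∞) (j : S) : meanHit L j j = 0 := by
  rw [meanHit_eq_firstHit hq, lintegral_eq_zero_iff (measurable_firstHit L j)]
  exact (ae_start L j).mono fun ω hω => firstHit_eq_zero hω

lemma firstHit_seqCons {L : S → S → ℝ} {i j : S} (hij : i ≠ j) (h0 : exitRate L i ≠ 0)
    (hq : exitRate L i ≠ ∞) {s : ℝ} (ω : (ℕ → S) × (ℕ → ℝ)) :
    firstHit L j (seqCons i ω.1, seqCons (rate L i * s) ω.2)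
      = ENNReal.ofReal s + firstHit L j ω := by
  unfold firstHit
  rw [ENNReal.add_iInf]
  refine le_antisymm (le_iInf fun n => (iInf_le _ (n + 1)).trans ?_) (le_iInf fun n => ?_)
  · rw [jumpTime_seqCons h0 hq]
    by_cases hn : ω.1 n = j
    · rw [if_pos (by exact hn), if_pos hn]
    · rw [if_neg (by exact hn), if_neg hn]; simp
  · cases n with
    | zero => simp [hij]
    | succ n =>
      refine (iInf_le _ n).trans ?_
      rw [jumpTime_seqCons h0 hq]
      by_cases hn : ω.1 n = j
      · rw [if_pos hn, if_pos (by exact hn)]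
      · rw [if_neg hn, if_neg (by exact hn)]; simp

/-! ### First passage decomposition. -/

/-- The event that `j` is reached for the first time at the `n`-th jump. -/
def hitEvent (n : ℕ) (j : S) : Set ((ℕ → S) × (ℕ → ℝ)) :=
  {ω | ω.1 n = j ∧ ∀ m < n, ω.1 m ≠ j}

lemma measurableSet_hitEvent (n : ℕ) (j : S) : MeasurableSet (hitEvent n j) := by
  refine (measurableSet_at n j).inter ?_
  have : {ω : (ℕ → S) × (ℕ → ℝ) | ∀ m < n, ω.1 m ≠ j} = ⋂ m, ⋂ (_ : m < n), {ω | ω.1 m = j}ᶜ := by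
    ext ω; simp
  change MeasurableSet {ω : (ℕ → S) × (ℕ → ℝ) | ∀ m < n, ω.1 m ≠ j}
  rw [this]
  exact MeasurableSet.iInter fun m => MeasurableSet.iInter fun _ => (measurableSet_at m j).compl

/-- At most one of the events occurs, and on it the jump time is `firstHit`; if none occurs, `Φ ∞ =
0` settles the case. -/
lemma tsum_hitEvent_indicator (L : S → S → ℝ) (j : S) {Φ : ℝ≥0∞ → ℝ≥0∞} (hΦ : Φ ∞ = 0)
    (ω : (ℕ → S) × (ℕ → ℝ)) :
    ∑' n, (hitEvent n j).indicator (fun ω => Φ (jumpTime L n ω)) ω = Φ (firstHit L j ω) := by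
  classical
  by_cases h : ∃ n, ω.1 n = j
  · have h1 : ω ∈ hitEvent (Nat.find h) j := ⟨Nat.find_spec h, fun m hm => Nat.find_min h hm⟩
    have h2 : firstHit L j ω = jumpTime L (Nat.find h) ω := by
      refine le_antisymm ((iInf_le _ (Nat.find h)).trans ?_) (le_iInf fun n => ?_)
      · rw [if_pos (Nat.find_spec h)]
      · split_ifs with hn
        · exact jumpTime_mono L ω (Nat.find_min' h hn)
        · exact le_top
    rw [tsum_eq_single (Nat.find h), Set.indicator_of_mem h1, h2]
    intro n hn
    refine Set.indicator_of_notMem (fun h3 => ?_) _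
    exact h3.2 _ (lt_of_le_of_ne (Nat.find_min' h h3.1) (Ne.symm hn)) (Nat.find_spec h)
  · have h1 : firstHit L j ω = ∞ := by
      simp only [firstHit, iInf_eq_top]
      intro n
      rw [if_neg (fun hn => h ⟨n, hn⟩)]
    rw [h1, hΦ]
    refine ENNReal.tsum_eq_zero.2 fun n => Set.indicator_of_notMem (fun h3 => h ⟨n, h3.1⟩) _

open Classical in
/-- The value `f (t - u)`, where `f` is understood to vanish at `-∞`. -/
def delayed (f : ℝ → ℝ≥0∞) (t : ℝ) (u : ℝ≥0∞) : ℝ≥0∞ := if u = ∞ then 0 else f (t - u.toReal)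

lemma delayed_top (f : ℝ → ℝ≥0∞) (t : ℝ) : delayed f t ∞ = 0 := if_pos rfl

lemma delayed_ofReal_add (f : ℝ → ℝ≥0∞) (t : ℝ) {s : ℝ} (hs : 0 ≤ s) (u : ℝ≥0∞) :
    delayed f t (ENNReal.ofReal s + u) = delayed f (t - s) u := by
  rcases eq_or_ne u ∞ with rfl | hu
  · simp [delayed_top]
  · rw [delayed, delayed, if_neg (by simp [hu]), if_neg hu,
      ENNReal.toReal_add ENNReal.ofReal_ne_top hu, ENNReal.toReal_ofReal hs]
    congr 1; ring

lemma measurable_delayed {f : ℝ → ℝ≥0∞} (hf : Measurable f) :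
    Measurable fun p : ℝ × ℝ≥0∞ => delayed f p.1 p.2 := by
  unfold delayed
  exact Measurable.ite (measurable_snd (measurableSet_singleton _)) measurable_const
    (hf.comp (measurable_fst.sub measurable_snd.ennreal_toReal))

lemma measurable_hitEvent_indicator (L : S → S → ℝ) (n : ℕ) (j : S) {f : ℝ → ℝ≥0∞}
    (hf : Measurable f) (t : ℝ) :
    Measurable ((hitEvent n j).indicator (fun ω => delayed f t (jumpTime L n ω))) :=
  Measurable.indicator ((measurable_delayed hf).comp
    (measurable_const.prodMk (measurable_jumpTime L n))) (measurableSet_hitEvent n j)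

/-- The n jumps are split into those up to the first visit of `j` and those after it. From `i = j`
only the summand with no jump before the visit survives; from `i ≠ j` that summand vanishes and a
first step reduces n. -/
lemma nJump_first_passage {L : S → S → ℝ} (hq : ∀ i, exitRate L i ≠ ∞) (n : ℕ) (i j : S) (t : ℝ) :
    nJump L n i j t = ∑ p ∈ Finset.HasAntidiagonal.antidiagonal n, ∫⁻ ω,
      (hitEvent p.1 j).indicator (fun ω => delayed (nJump L p.2 j j) t (jumpTime L p.1 ω)) ω
        ∂(chainLaw L i) := by
  classical
  have hzero : ∀ (n : ℕ) (i : S) (t : ℝ), ∫⁻ ω, (hitEvent 0 j).indicator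
      (fun ω => delayed (nJump L n j j) t (jumpTime L 0 ω)) ω ∂(chainLaw L i)
      = if i = j then nJump L n j j t else 0 := by
    intro n i t
    rw [lintegral_congr_ae (g := fun _ => if i = j then nJump L n j j t else 0)]
    · simp
    · filter_upwards [ae_start L i] with ω hω
      by_cases h : i = j
      · rw [if_pos h, Set.indicator_of_mem (by simp [hitEvent, hω, h])]
        simp [delayed, jumpTime]
      · rw [if_neg h, Set.indicator_of_notMem (by simp [hitEvent, hω, h])]
  induction n generalizing i t with
  | zero =>
    rw [Finset.Nat.antidiagonal_zero, Finset.sum_singleton, hzero]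
    by_cases h : i = j
    · simp [h]
    · simp [h, nJump_zero_of_ne L h]
  | succ n ih =>
    rw [Finset.Nat.sum_antidiagonal_succ, hzero]
    by_cases hij : i = j
    · subst hij
      rw [if_pos rfl, Finset.sum_eq_zero, add_zero]
      intro p _
      rw [lintegral_eq_zero_iff (measurable_hitEvent_indicator L _ i (measurable_nJump L _ i i) t)]
      filter_upwards [ae_start L i] with ω hω
      exact Set.indicator_of_notMem (fun h => h.2 0 (by omega) hω) _
    · rw [if_neg hij, zero_add, nJump_succ]
      have hstep : ∀ p : ℕ × ℕ, ∫⁻ ω, (hitEvent (p.1 + 1) j).indicator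
          (fun ω => delayed (nJump L p.2 j j) t (jumpTime L (p.1 + 1) ω)) ω ∂(chainLaw L i)
          = ∫⁻ s, survival L i s * ∑' k, jumpRate L i k * ∫⁻ ω, (hitEvent p.1 j).indicator
            (fun ω => delayed (nJump L p.2 j j) (t - s) (jumpTime L p.1 ω)) ω
              ∂(chainLaw L k) := by
        intro p
        refine lintegral_chainLaw_rate (hq i)
          (measurable_hitEvent_indicator L _ j (measurable_nJump L _ j j) t) ?_ ?_
        · intro _ ω hω
          have h2 : jumpTime L (p.1 + 1) ω = ∞ := by
            rw [← top_le_iff, ← hω]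
            exact jumpTime_mono L ω (by omega)
          refine Set.indicator_apply_eq_zero.2 fun _ => ?_
          rw [h2, delayed_top]
        · intro h0 s hs ω
          have h1 : (seqCons i ω.1, seqCons (rate L i * s) ω.2) ∈ hitEvent (p.1 + 1) j
              ↔ ω ∈ hitEvent p.1 j := by
            simp only [hitEvent, Set.mem_ofPred_eq, seqCons_succ]
            refine and_congr_right fun _ => ⟨fun h m hm => h (m + 1) (by omega), fun h m hm => ?_⟩
            cases m with
            | zero => exact hij
            | succ m => exact h m (by omega)
          by_cases hω : ω ∈ hitEvent p.1 j
          · rw [Set.indicator_of_mem (h1.2 hω), Set.indicator_of_mem hω, jumpTime_seqCons h0 (hq i),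
              delayed_ofReal_add _ _ hs]
          · rw [Set.indicator_of_notMem (fun h => hω (h1.1 h)), Set.indicator_of_notMem hω]
      have hmeas : ∀ (p : ℕ × ℕ) (k : S), Measurable fun s => ∫⁻ ω, (hitEvent p.1 j).indicator
            (fun ω => delayed (nJump L p.2 j j) (t - s) (jumpTime L p.1 ω)) ω
              ∂(chainLaw L k) := by
        intro p k
        refine Measurable.lintegral_prod_right' (f := fun q : ℝ × ((ℕ → S) × (ℕ → ℝ)) =>
          (hitEvent p.1 j).indicator
            (fun ω => delayed (nJump L p.2 j j) (t - q.1) (jumpTime L p.1 ω)) q.2) ?_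
        exact Measurable.indicator (s := Prod.snd ⁻¹' hitEvent p.1 j)
          ((measurable_delayed (measurable_nJump L p.2 j j)).comp
          ((measurable_const.sub measurable_fst).prodMk
            ((measurable_jumpTime L p.1).comp measurable_snd)))
          (measurable_snd (measurableSet_hitEvent p.1 j))
      have hmeas' : ∀ p : ℕ × ℕ, Measurable fun s => survival L i s * ∑' k, jumpRate L i k *
          ∫⁻ ω, (hitEvent p.1 j).indicator
            (fun ω => delayed (nJump L p.2 j j) (t - s) (jumpTime L p.1 ω)) ω ∂(chainLaw L k) :=
        fun p => (measurable_survival L i).mul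
          (Measurable.tsum fun k => (hmeas p k).const_mul _)
      rw [Finset.sum_congr rfl fun p _ => hstep p, ← lintegral_finsetSum _ fun p _ => hmeas' p]
      refine lintegral_congr fun s => ?_
      rw [← Finset.mul_sum, ← Summable.tsum_finsetSum fun _ _ => ENNReal.summable]
      congr 1
      refine tsum_congr fun k => ?_
      rw [← Finset.mul_sum, ih]

/-- First passage decomposition: the chain is in `j` at time `t` if it has hit `j` at some time
`u ≤ t` and, started afresh at `j`, it is in `j` after the time `t - u`. -/
lemma trans_first_passage {L : S → S → ℝ} (hq : ∀ i, exitRate L i ≠ ∞) (i j : S) (t : ℝ) :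
    trans L i j t = ∫⁻ ω, delayed (trans L j j) t (firstHit L j ω) ∂(chainLaw L i) := by
  have h1 : ∀ u, delayed (trans L j j) t u = ∑' n, delayed (nJump L n j j) t u := by
    intro u
    rcases eq_or_ne u ∞ with rfl | hu
    · simp [delayed_top]
    · simp [delayed, hu, trans]
  simp_rw [← fun ω => tsum_hitEvent_indicator L j (delayed_top (trans L j j) t) ω]
  rw [lintegral_tsum fun n =>
    (measurable_hitEvent_indicator L n j (measurable_trans L j j) t).aemeasurable]
  have h2 : ∀ m, ∫⁻ ω, (hitEvent m j).indicator
      (fun ω => delayed (trans L j j) t (jumpTime L m ω)) ω ∂(chainLaw L i)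
      = ∑' n, ∫⁻ ω, (hitEvent m j).indicator
      (fun ω => delayed (nJump L n j j) t (jumpTime L m ω)) ω ∂(chainLaw L i) := by
    intro m
    rw [← lintegral_tsum fun n =>
      (measurable_hitEvent_indicator L m j (measurable_nJump L n j j) t).aemeasurable]
    refine lintegral_congr fun ω => ?_
    by_cases h : ω ∈ hitEvent m j
    · simp [h, h1]
    · simp [h]
  simp_rw [h2]
  rw [← ENNReal.tsum_prod (f := fun m n => ∫⁻ ω, (hitEvent m j).indicator
      (fun ω => delayed (nJump L n j j) t (jumpTime L m ω)) ω ∂(chainLaw L i)),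
    ← Finset.HasAntidiagonal.sigmaAntidiagonalEquivProd.tsum_eq, ENNReal.tsum_sigma', trans]
  refine tsum_congr fun n => ?_
  rw [nJump_first_passage hq]
  exact (Finset.tsum_subtype (Finset.HasAntidiagonal.antidiagonal n) (fun p : ℕ × ℕ => ∫⁻ ω,
    (hitEvent p.1 j).indicator (fun ω => delayed (nJump L p.2 j j) t (jumpTime L p.1 ω)) ω
        ∂(chainLaw L i))).symm

/-- The probability that `j` is not hit until time `r`. -/
def hitTail (L : S → S → ℝ) (i j : S) (r : ℝ) : ℝ≥0∞ :=
  chainLaw L i {ω | ENNReal.ofReal r < firstHit L j ω}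

lemma hitTail_le_one (L : S → S → ℝ) (i j : S) (r : ℝ) : hitTail L i j r ≤ 1 := prob_le_one

lemma antitone_hitTail (L : S → S → ℝ) (i j : S) : Antitone (hitTail L i j) := fun _ _ h =>
  measure_mono fun _ hω => (ENNReal.ofReal_le_ofReal h).trans_lt hω

@[fun_prop]
lemma measurable_hitTail (L : S → S → ℝ) (i j : S) : Measurable (hitTail L i j) :=
  (antitone_hitTail L i j).measurable

/-- The expected time spent in `j` until time `T`. -/
def occupation (L : S → S → ℝ) (i j : S) (T : ℝ) : ℝ≥0∞ := ∫⁻ t in Set.Iic T, trans L i j t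

/-- The first passage decomposition is integrated over `t ≤ T` path by path. With τ the hitting
time, the substitution r = T + τ - t turns `t ≤ T` into τ ≤ r and t - τ into T - r, so the integrand
depends on τ only through the event τ ≤ r. -/
lemma occupation_first_passage {L : S → S → ℝ} (hq : ∀ i, exitRate L i ≠ ∞) (i j : S) (T : ℝ) :
    occupation L i j T = ∫⁻ r in Set.Ici 0, trans L j j (T - r) *
      chainLaw L i {ω | firstHit L j ω ≤ ENNReal.ofReal r} := by
  have hm1 : Measurable fun p : ℝ × ((ℕ → S) × (ℕ → ℝ)) =>
      delayed (trans L j j) p.1 (firstHit L j p.2) :=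
    (measurable_delayed (measurable_trans L j j)).comp
      (measurable_fst.prodMk ((measurable_firstHit L j).comp measurable_snd))
  have hm2 : MeasurableSet {p : ℝ × ((ℕ → S) × (ℕ → ℝ)) |
      firstHit L j p.2 ≤ ENNReal.ofReal p.1} :=
    measurableSet_le ((measurable_firstHit L j).comp measurable_snd) measurable_fst.ennreal_ofReal
  have hm3 : Measurable fun p : ℝ × ((ℕ → S) × (ℕ → ℝ)) => trans L j j (T - p.1) *
      {p : ℝ × ((ℕ → S) × (ℕ → ℝ)) |
        firstHit L j p.2 ≤ ENNReal.ofReal p.1}.indicator 1 p :=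
    ((measurable_trans L j j).comp (measurable_const.sub measurable_fst)).mul
      (measurable_one.indicator hm2)
  have h1 : ∀ r, trans L j j (T - r) * chainLaw L i {ω | firstHit L j ω ≤ ENNReal.ofReal r}
      = ∫⁻ ω, trans L j j (T - r) * {p : ℝ × ((ℕ → S) × (ℕ → ℝ)) |
        firstHit L j p.2 ≤ ENNReal.ofReal p.1}.indicator 1 (r, ω) ∂(chainLaw L i) := by
    intro r
    have hm4 : Measurable fun ω : (ℕ → S) × (ℕ → ℝ) => {p : ℝ × ((ℕ → S) × (ℕ → ℝ)) |
        firstHit L j p.2 ≤ ENNReal.ofReal p.1}.indicator (1 : ℝ × ((ℕ → S) × (ℕ → ℝ)) → ℝ≥0∞) (r, ω) :=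
      (measurable_one.indicator hm2).comp (measurable_const.prodMk measurable_id)
    rw [lintegral_const_mul _ hm4, ← lintegral_indicator_one
      (measurableSet_le (measurable_firstHit L j) measurable_const)]
    congr 1
  simp_rw [occupation, trans_first_passage hq i j, h1]
  rw [lintegral_lintegral_swap hm1.aemeasurable,
    lintegral_lintegral_swap (μ := volume.restrict (Set.Ici 0)) hm3.aemeasurable]
  refine lintegral_congr fun ω => ?_
  rcases eq_or_ne (firstHit L j ω) ∞ with h | h
  · simp [h, delayed_top]
  · rw [← lintegral_indicator measurableSet_Iic, ← lintegral_indicator measurableSet_Ici,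
      ← lintegral_sub_left_eq_self _ (T + (firstHit L j ω).toReal)]
    refine lintegral_congr fun r => ?_
    have hu : 0 ≤ (firstHit L j ω).toReal := ENNReal.toReal_nonneg
    have h4 : delayed (trans L j j) (T + (firstHit L j ω).toReal - r) (firstHit L j ω)
        = trans L j j (T - r) := by
      rw [delayed, if_neg h]
      congr 1; ring
    by_cases hr : (firstHit L j ω).toReal ≤ r
    · have h2 : firstHit L j ω ≤ ENNReal.ofReal r := (ENNReal.le_ofReal_iff_toReal_le h
        (hu.trans hr)).2 hr
      rw [Set.indicator_of_mem (by simp only [Set.mem_Iic]; linarith),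
        Set.indicator_of_mem (by simp only [Set.mem_Ici]; linarith),
        Set.indicator_of_mem (by exact h2), h4, Pi.one_apply, mul_one]
    · rw [Set.indicator_of_notMem (by simp only [Set.mem_Iic]; linarith)]
      by_cases h0 : 0 ≤ r
      · rw [Set.indicator_of_mem (by exact h0), Set.indicator_of_notMem, mul_zero]
        exact fun h2 => hr ((ENNReal.le_ofReal_iff_toReal_le h h0).1 h2)
      · rw [Set.indicator_of_notMem (by exact h0)]

/-- The expected times spent in `j` by the chains started at `j` and at `i` differ by the
contribution of the time before the first visit to `j`. -/
lemma occupation_eq_add {L : S → S → ℝ} (hq : ∀ i, exitRate L i ≠ ∞) (i j : S) (T : ℝ) :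
    occupation L j j T = occupation L i j T +
      ∫⁻ r in Set.Ici 0, trans L j j (T - r) * hitTail L i j r := by
  have hm : Measurable fun r => trans L j j (T - r) * hitTail L i j r :=
    ((measurable_trans L j j).comp (measurable_const.sub measurable_id)).mul
      (measurable_hitTail L i j)
  rw [occupation_first_passage hq i j, ← lintegral_add_right _ hm, occupation,
    ← lintegral_indicator measurableSet_Iic, ← lintegral_indicator measurableSet_Ici,
      ← lintegral_sub_left_eq_self _ T]
  refine lintegral_congr fun r => ?_
  by_cases hr : 0 ≤ r
  · rw [Set.indicator_of_mem (by simp only [Set.mem_Iic]; linarith),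
      Set.indicator_of_mem (by exact hr), ← mul_add, hitTail]
    have h1 : {ω | ENNReal.ofReal r < firstHit L j ω}
        = {ω | firstHit L j ω ≤ ENNReal.ofReal r}ᶜ := by ext ω; simp
    rw [h1, measure_add_measure_compl
      (measurableSet_le (measurable_firstHit L j) measurable_const), measure_univ, mul_one]
  · rw [Set.indicator_of_notMem (by simp only [Set.mem_Iic]; linarith),
      Set.indicator_of_notMem (by exact hr)]

lemma lintegral_hitTail {L : S → S → ℝ} (hq : ∀ i, exitRate L i ≠ ∞) (i j : S) :
    ∫⁻ r in Set.Ici 0, hitTail L i j r = meanHit L i j := by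
  have hm2 : MeasurableSet {p : ℝ × ((ℕ → S) × (ℕ → ℝ)) |
      ENNReal.ofReal p.1 < firstHit L j p.2} :=
    measurableSet_lt measurable_fst.ennreal_ofReal ((measurable_firstHit L j).comp measurable_snd)
  have h1 : ∀ r, hitTail L i j r = ∫⁻ ω, {p : ℝ × ((ℕ → S) × (ℕ → ℝ)) |
      ENNReal.ofReal p.1 < firstHit L j p.2}.indicator 1 (r, ω) ∂(chainLaw L i) := by
    intro r
    rw [hitTail, ← lintegral_indicator_one
      (measurableSet_lt measurable_const (measurable_firstHit L j))]
    rfl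
  simp_rw [h1]
  rw [meanHit_eq_firstHit hq, lintegral_lintegral_swap (f := fun r ω =>
    {p : ℝ × ((ℕ → S) × (ℕ → ℝ)) | ENNReal.ofReal p.1 < firstHit L j p.2}.indicator 1 (r, ω))
    (Measurable.aemeasurable (measurable_one.indicator hm2))]
  refine lintegral_congr fun ω => ?_
  have h2 : ∀ r, {p : ℝ × ((ℕ → S) × (ℕ → ℝ)) |
      ENNReal.ofReal p.1 < firstHit L j p.2}.indicator (1 : ℝ × ((ℕ → S) × (ℕ → ℝ)) → ℝ≥0∞) (r, ω)
      = {r | ENNReal.ofReal r < firstHit L j ω}.indicator 1 r := fun r => rfl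
  simp_rw [h2]
  rw [lintegral_indicator_one (measurableSet_lt ENNReal.measurable_ofReal measurable_const),
    Measure.restrict_apply (measurableSet_lt ENNReal.measurable_ofReal measurable_const)]
  rcases eq_or_ne (firstHit L j ω) ∞ with h | h
  · simp [h]
  · have h3 : {r | ENNReal.ofReal r < firstHit L j ω} ∩ Set.Ici 0
        = Set.Ico 0 (firstHit L j ω).toReal := by
      ext r
      simp only [Set.mem_inter_iff, Set.mem_ofPred_eq, Set.mem_Ici, Set.mem_Ico]
      rw [and_comm]
      refine and_congr_right fun hr => ?_
      rw [ENNReal.ofReal_lt_iff_lt_toReal hr h]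
    rw [h3]
    simp [h]

/-! ### First step equations for mean hitting times. -/

lemma lintegral_survival {L : S → S → ℝ} {i : S} (h0 : exitRate L i ≠ 0)
    (hq : exitRate L i ≠ ∞) : ∫⁻ s, survival L i s = (exitRate L i)⁻¹ := by
  have hr : 0 < rate L i := ENNReal.toReal_pos h0 hq
  have h1 : ∫⁻ s, exponentialPDF (rate L i) s = 1 := lintegral_exponentialPDF_eq_one hr
  have h2 : ∀ s, exponentialPDF (rate L i) s = exitRate L i * survival L i s := by
    intro s
    rw [exponentialPDF_eq, survival]
    split_ifs
    · rw [ENNReal.ofReal_mul hr.le, rate, ENNReal.ofReal_toReal hq]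
    · simp
  simp_rw [h2] at h1
  rw [lintegral_const_mul _ (measurable_survival L i)] at h1
  exact ENNReal.eq_inv_of_mul_eq_one_left (by rwa [mul_comm])

lemma measurable_survival_mul_ofReal (L : S → S → ℝ) (i : S) :
    Measurable fun s => survival L i s * ENNReal.ofReal s :=
  (measurable_survival L i).mul ENNReal.measurable_ofReal

lemma lintegral_survival_mul {L : S → S → ℝ} {i : S} (h0 : exitRate L i ≠ 0)
    (hq : exitRate L i ≠ ∞) :
    ∫⁻ s, survival L i s * ENNReal.ofReal s = (exitRate L i)⁻¹ * (exitRate L i)⁻¹ := by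
  have hr : 0 < rate L i := ENNReal.toReal_pos h0 hq
  have h1 : ∫⁻ s, gammaPDF 2 (rate L i) s = 1 := lintegral_gammaPDF_eq_one two_pos hr
  have h2 : ∀ s, gammaPDF 2 (rate L i) s
      = exitRate L i * exitRate L i * (survival L i s * ENNReal.ofReal s) := by
    intro s
    rw [gammaPDF_eq, survival]
    split_ifs with hs
    · have : exitRate L i = ENNReal.ofReal (rate L i) := (ENNReal.ofReal_toReal hq).symm
      rw [this, ← ENNReal.ofReal_mul hr.le, ← ENNReal.ofReal_mul (Real.exp_pos _).le,
        ← ENNReal.ofReal_mul (by positivity)]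
      congr 1
      rw [Real.Gamma_two, show (2 : ℝ) - 1 = 1 by norm_num, Real.rpow_one, Real.rpow_two]
      ring
    · simp
  simp_rw [h2] at h1
  rw [lintegral_const_mul _ (measurable_survival_mul_ofReal L i)] at h1
  rw [← ENNReal.mul_inv (Or.inl h0) (Or.inl hq)]
  exact ENNReal.eq_inv_of_mul_eq_one_left (by rwa [mul_comm])

/-- First step analysis for functionals that accumulate the first holding time. -/
lemma exitRate_mul_lintegral {L : S → S → ℝ} {i : S} (h0 : exitRate L i ≠ 0)
    (hq : exitRate L i ≠ ∞) {F G : (ℕ → S) × (ℕ → ℝ) → ℝ≥0∞} (hF : Measurable F)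
    (hG : Measurable G) (hFG : ∀ s, 0 ≤ s → ∀ ω,
      F (seqCons i ω.1, seqCons (rate L i * s) ω.2) = ENNReal.ofReal s + G ω) :
    exitRate L i * ∫⁻ ω, F ω ∂(chainLaw L i)
      = 1 + ∑' k, jumpRate L i k * ∫⁻ ω, G ω ∂(chainLaw L k) := by
  rw [lintegral_chainLaw_rate hq hF (fun h => absurd h h0)
    (G := fun s ω => ENNReal.ofReal s + G ω) (fun _ => hFG)]
  have h1 : ∀ s, survival L i s * ∑' k, jumpRate L i k *
      ∫⁻ ω, (ENNReal.ofReal s + G ω) ∂(chainLaw L k)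
      = exitRate L i * (survival L i s * ENNReal.ofReal s)
        + survival L i s * ∑' k, jumpRate L i k * ∫⁻ ω, G ω ∂(chainLaw L k) := by
    intro s
    simp_rw [lintegral_add_right _ hG, lintegral_const, measure_univ, mul_one, mul_add]
    rw [ENNReal.tsum_add, ENNReal.tsum_mul_right, ← exitRate]
    ring
  simp_rw [h1]
  rw [lintegral_add_left ((measurable_survival_mul_ofReal L i).const_mul _),
    lintegral_const_mul _ (measurable_survival_mul_ofReal L i),
    lintegral_mul_const _ (measurable_survival L i), lintegral_survival h0 hq,
    lintegral_survival_mul h0 hq, mul_add]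
  congr 1
  · rw [← mul_assoc (exitRate L i) (exitRate L i)⁻¹, ENNReal.mul_inv_cancel h0 hq, one_mul,
      ENNReal.mul_inv_cancel h0 hq]
  · rw [← mul_assoc, ENNReal.mul_inv_cancel h0 hq, one_mul]

lemma meanHit_first_step {L : S → S → ℝ} (hq : ∀ i, exitRate L i ≠ ∞) {i j : S} (hij : i ≠ j)
    (h0 : exitRate L i ≠ 0) :
    exitRate L i * meanHit L i j = 1 + ∑' k, jumpRate L i k * meanHit L k j := by
  simp_rw [meanHit_eq_firstHit hq]
  exact exitRate_mul_lintegral h0 (hq i) (measurable_firstHit L j) (measurable_firstHit L j)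
    fun s _ ω => firstHit_seqCons hij h0 (hq i) ω

/-- The expected hitting times of a non-explosive chain are bounded by every supersolution of the
first step equations. -/
lemma meanHit_le_of_supersolution {L : S → S → ℝ} (hq : ∀ i, exitRate L i ≠ ∞)
    (hne : ∀ i, ∀ᵐ ω ∂(chainLaw L i), ⨆ n, jumpTime L n ω = ∞) {j : S}
    (h0 : ∀ i, i ≠ j → exitRate L i ≠ 0) {w : S → ℝ≥0∞}
    (hw : ∀ i, i ≠ j → 1 + ∑' k, jumpRate L i k * w k ≤ exitRate L i * w i) (i : S) :
    meanHit L i j ≤ w i := by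
  have hmeas : ∀ n, Measurable fun ω => min (firstHit L j ω) (jumpTime L n ω) := fun n =>
    (measurable_firstHit L j).min (measurable_jumpTime L n)
  -- The hitting time is truncated at the n-th jump, so that the induction starts from zero.
  -- Non-explosion removes the truncation by monotone convergence.
  have key : ∀ n i, ∫⁻ ω, min (firstHit L j ω) (jumpTime L n ω) ∂(chainLaw L i) ≤ w i := by
    intro n
    induction n with
    | zero =>
      intro i
      simp [jumpTime]
    | succ n ih =>
      intro i
      by_cases hij : i = j
      · subst hij
        have : ∫⁻ ω, min (firstHit L i ω) (jumpTime L (n + 1) ω) ∂(chainLaw L i) = 0 := by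
          rw [lintegral_eq_zero_iff (hmeas (n + 1))]
          exact (ae_start L i).mono fun ω hω => by simp [firstHit_eq_zero hω]
        simp [this]
      · have h1 := exitRate_mul_lintegral (h0 i hij) (hq i) (hmeas (n + 1)) (hmeas n)
          fun s _ ω => by
            rw [firstHit_seqCons hij (h0 i hij) (hq i), jumpTime_seqCons (h0 i hij) (hq i),
              min_add_add_left]
        have h2 : exitRate L i * ∫⁻ ω, min (firstHit L j ω) (jumpTime L (n + 1) ω) ∂(chainLaw L i)
            ≤ exitRate L i * w i := by
          rw [h1]
          refine le_trans ?_ (hw i hij)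
          gcongr with k
          exact ih k
        exact (ENNReal.mul_le_mul_iff_right (h0 i hij) (hq i)).1 h2
  have hsup : meanHit L i j
      = ∫⁻ ω, ⨆ n, min (firstHit L j ω) (jumpTime L n ω) ∂(chainLaw L i) := by
    rw [meanHit_eq_firstHit hq]
    refine lintegral_congr_ae ((hne i).mono fun ω hω => ?_)
    simp only
    rw [← inf_iSup_eq, hω, inf_top_eq]
  rw [hsup, lintegral_iSup hmeas fun m n hmn ω => min_le_min_left _ (jumpTime_mono L ω hmn)]
  exact iSup_le fun n => key n i

/-- Total mass one means that almost surely the chain has a state at every integer time, so some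
jump time exceeds each integer. -/
lemma ae_iSup_jumpTime {L : S → S → ℝ} (hq : ∀ i, exitRate L i ≠ ∞) {i : S}
    (h : ∀ t, 0 ≤ t → ∑' j, trans L i j t = 1) :
    ∀ᵐ ω ∂(chainLaw L i), ⨆ n, jumpTime L n ω = ∞ := by
  have h1 : ∀ᵐ ω ∂(chainLaw L i), ∀ N : ℕ, ω ∈ ⋃ p : ℕ × S, jumpEvent L p.1 p.2 (N : ℝ) := by
    refine ae_all_iff.2 fun N => ?_
    have h2 := h N (Nat.cast_nonneg N)
    rw [tsum_trans hq] at h2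
    have hm : MeasurableSet (⋃ p : ℕ × S, jumpEvent L p.1 p.2 (N : ℝ)) :=
      MeasurableSet.iUnion fun p => measurableSet_jumpEvent L p.1 p.2 _
    rwa [← prob_compl_eq_zero_iff hm] at h2
  refine h1.mono fun ω hω => ?_
  refine ENNReal.eq_top_of_forall_nnreal_le fun r => ?_
  obtain ⟨N, hN⟩ := exists_nat_ge r
  obtain ⟨p, hp⟩ := Set.mem_iUnion.1 (hω N)
  have h3 : ((N : ℝ≥0∞)) < jumpTime L (p.1 + 1) ω := by simpa using hp.2.2.1
  calc (r : ℝ≥0∞) ≤ N := by exact_mod_cast hN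
    _ ≤ _ := h3.le
    _ ≤ _ := le_iSup (fun n => jumpTime L n ω) (p.1 + 1)

end Hitting

/-! ### Convergence to equilibrium -/

section Ergodic

variable {S : Type*} [Countable S] [MeasurableSpace S] [MeasurableSingletonClass S]

/-- `L` is the generator of an irreducible chain with finite exit rates, and `p` is a stationary
distribution charging every state. -/
structure IsStationaryChain (L : S → S → ℝ) (p : S → ℝ≥0∞) : Prop where
  exitRate_ne_top : ∀ i, exitRate L i ≠ ∞
  irreducible : IsIrreducibleGen L
  ne_zero : ∀ i, p i ≠ 0
  tsum_eq_one : ∑' i, p i = 1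
  stationary : ∀ t, 0 ≤ t → ∀ j, ∑' i, p i * trans L i j t = p j

/-- The squared distance of two extended nonnegative numbers, through their real values. -/
def sqDist (x y : ℝ≥0∞) : ℝ≥0∞ := ENNReal.ofReal ((x.toReal - y.toReal) ^ 2)

lemma sq_add_sq_eq {x y : ℝ≥0∞} (hx : x ≠ ∞) (hy : y ≠ ∞) :
    x ^ 2 + y ^ 2 = sqDist x y + 2 * (x * y) := by
  lift x to ℝ≥0 using hx
  lift y to ℝ≥0 using hy
  rw [sqDist, ← ENNReal.toReal_eq_toReal_iff' (by simp) (by finiteness),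
    ENNReal.toReal_add (by simp) (by simp), ENNReal.toReal_add (by finiteness) (by finiteness),
    ENNReal.toReal_ofReal (by positivity)]
  simp
  ring

/-- The second moment is the squared mean plus the variance. -/
lemma tsum_mul_sq {a g : S → ℝ≥0∞} (ha : ∑' i, a i = 1) (hg : ∀ i, g i ≤ 1) :
    ∑' i, a i * g i ^ 2
      = (∑' i, a i * g i) ^ 2 + ∑' i, a i * sqDist (g i) (∑' k, a k * g k) := by
  set m := ∑' i, a i * g i with hm
  have hm1 : m ≤ 1 := by
    rw [← ha]
    exact ENNReal.tsum_le_tsum fun i => mul_le_of_le_one_right' (hg i)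
  have hmt : m ≠ ∞ := (hm1.trans_lt ENNReal.one_lt_top).ne
  have h1 : ∑' i, a i * (g i ^ 2 + m ^ 2) = ∑' i, a i * (sqDist (g i) m + 2 * (g i * m)) :=
    tsum_congr fun i => by
      rw [sq_add_sq_eq ((hg i).trans_lt ENNReal.one_lt_top).ne hmt]
  have h2 : ∀ i, a i * (2 * (g i * m)) = 2 * m * (a i * g i) := fun i => by ring
  simp_rw [mul_add] at h1
  rw [ENNReal.tsum_add, ENNReal.tsum_add, ENNReal.tsum_mul_right, ha, one_mul] at h1
  simp_rw [h2] at h1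
  rw [ENNReal.tsum_mul_left, ← hm] at h1
  have h3 : 2 * m * m = m ^ 2 + m ^ 2 := by ring
  rw [h3, ← add_assoc] at h1
  rw [(ENNReal.add_left_inj (by finiteness)).1 h1, add_comm]

namespace IsStationaryChain

variable {L : S → S → ℝ} {p : S → ℝ≥0∞}

lemma ne_top (h : IsStationaryChain L p) (i : S) : p i ≠ ∞ := by
  have := ENNReal.le_tsum (f := p) i
  rw [h.tsum_eq_one] at this
  exact (this.trans_lt ENNReal.one_lt_top).ne

/-- Summing stationarity over `j` shows that the total masses have average one under `p`. Each is at
most one and every weight is positive, so none is smaller: a stationary law charging every state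
excludes explosion. -/
lemma tsum_trans_eq_one (h : IsStationaryChain L p) (i : S) {t : ℝ} (ht : 0 ≤ t) :
    ∑' j, trans L i j t = 1 := by
  have hle := fun i => tsum_trans_le_one h.exitRate_ne_top i t
  have h1 : ∑' i, p i * ∑' j, trans L i j t = 1 := by
    simp_rw [← ENNReal.tsum_mul_left]
    rw [ENNReal.tsum_comm, ← h.tsum_eq_one]
    exact tsum_congr fun j => h.stationary t ht j
  have h2 : ∑' i, p i * ∑' j, trans L i j t + ∑' i, p i * (1 - ∑' j, trans L i j t) = 1 := by
    rw [← ENNReal.tsum_add]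
    refine (tsum_congr fun i => ?_).trans h.tsum_eq_one
    rw [← mul_add, add_tsub_cancel_of_le (hle i), mul_one]
  rw [h1] at h2
  have h3 : ∑' i, p i * (1 - ∑' j, trans L i j t) = 0 := by
    have : (1 : ℝ≥0∞) + ∑' i, p i * (1 - ∑' j, trans L i j t) = 1 + 0 := by rw [h2, add_zero]
    exact (ENNReal.add_right_inj ENNReal.one_ne_top).1 this
  have h4 := (ENNReal.tsum_eq_zero.1 h3) i
  rw [mul_eq_zero, or_iff_right (h.ne_zero i), tsub_eq_zero_iff_le] at h4
  exact le_antisymm (hle i) h4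

lemma ae_iSup_jumpTime (h : IsStationaryChain L p) (i : S) :
    ∀ᵐ ω ∂(chainLaw L i), ⨆ n, jumpTime L n ω = ∞ :=
  HittingStein.ae_iSup_jumpTime h.exitRate_ne_top fun _ ht => h.tsum_trans_eq_one i ht

/-- P_{t+s}(k,j) is the mean of P_t(·,j) under P_s(k,·). Splitting the second moment into squared
mean and variance, and averaging over a stationary `k`, shows the energy loss to be an averaged
variance. -/
lemma energy_eq (h : IsStationaryChain L p) (j : S) {t s : ℝ} (ht : 0 ≤ t) (hs : 0 ≤ s) :
    ∑' i, p i * trans L i j t ^ 2 = ∑' k, p k * trans L k j (t + s) ^ 2 +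
      ∑' k, p k * ∑' i, trans L k i s * sqDist (trans L i j t) (trans L k j (t + s)) := by
  have h1 : ∀ k, ∑' i, trans L k i s * trans L i j t ^ 2 = trans L k j (t + s) ^ 2 +
      ∑' i, trans L k i s * sqDist (trans L i j t) (trans L k j (t + s)) := by
    intro k
    rw [add_comm t s, chapman_kolmogorov L k j hs ht]
    exact tsum_mul_sq (h.tsum_trans_eq_one k hs) fun i => trans_le_one h.exitRate_ne_top i j t
  rw [← ENNReal.tsum_add]
  simp_rw [← mul_add, ← h1, ← ENNReal.tsum_mul_left, ← mul_assoc]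
  rw [ENNReal.tsum_comm]
  simp_rw [ENNReal.tsum_mul_right]
  exact tsum_congr fun i => by rw [h.stationary s hs i]

/-- The energy decreases and is bounded, so its loss over a unit of time tends to zero. This loss
contains the squared distance with the weight p(k) P_1(k,i), which is positive by irreducibility. -/
lemma tendsto_sqDist_trans (h : IsStationaryChain L p) (i j k : S) :
    Tendsto (fun t => sqDist (trans L i j t) (trans L k j (t + 1))) atTop (𝓝 0) := by
  set φ : ℝ → ℝ≥0∞ := fun t => ∑' i, p i * trans L i j t ^ 2 with hφ
  have hφ1 : ∀ t, φ t ≤ 1 := fun t => by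
    rw [← h.tsum_eq_one]
    exact ENNReal.tsum_le_tsum fun i => mul_le_of_le_one_right'
      (pow_le_one' (trans_le_one h.exitRate_ne_top i j t) 2)
  -- The transition function is zero at negative times, so the energy is monotone only on the
  -- half-line.
  have hanti : Antitone fun t => φ (max t 0) := by
    intro s t hst
    have h1 := h.energy_eq j (le_max_right s 0)
      (sub_nonneg.2 (max_le_max_right 0 hst))
    rw [add_sub_cancel] at h1
    exact le_self_add.trans h1.ge
  have hlim : Tendsto φ atTop (𝓝 (⨅ t, φ (max t 0))) := by
    refine (tendsto_atTop_iInf hanti).congr' ?_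
    filter_upwards [eventually_ge_atTop 0] with t ht
    rw [max_eq_left ht]
  have hfin : (⨅ t, φ (max t 0)) ≠ ∞ :=
    ((iInf_le (fun t => φ (max t 0)) 0).trans_lt ((hφ1 _).trans_lt ENNReal.one_lt_top)).ne
  have hdiff : Tendsto (fun t => φ t - φ (t + 1)) atTop (𝓝 0) := by
    have := ENNReal.Tendsto.sub hlim (hlim.comp (tendsto_atTop_add_const_right _ 1 tendsto_id))
      (Or.inl hfin)
    rwa [tsub_self] at this
  have hc0 : p k * trans L k i 1 ≠ 0 :=
    mul_ne_zero (h.ne_zero k) (trans_pos h.irreducible k i one_pos).ne'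
  have hct : p k * trans L k i 1 ≠ ∞ := ENNReal.mul_ne_top (h.ne_top k)
    ((trans_le_one h.exitRate_ne_top k i 1).trans_lt ENNReal.one_lt_top).ne
  have hmul : Tendsto (fun t => (p k * trans L k i 1)⁻¹ * (φ t - φ (t + 1))) atTop (𝓝 0) := by
    have := ENNReal.Tendsto.const_mul hdiff (Or.inr (ENNReal.inv_ne_top.2 hc0))
    rwa [mul_zero] at this
  refine tendsto_of_tendsto_of_tendsto_of_le_of_le' tendsto_const_nhds hmul
    (Eventually.of_forall fun _ => zero_le) ?_
  filter_upwards [eventually_ge_atTop 0] with t ht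
  have h1 := h.energy_eq j ht zero_le_one
  have h2 : p k * trans L k i 1 * sqDist (trans L i j t) (trans L k j (t + 1))
      ≤ φ t - φ (t + 1) := by
    rw [hφ]
    simp only
    rw [h1, ENNReal.add_sub_cancel_left ((hφ1 (t + 1)).trans_lt ENNReal.one_lt_top).ne, mul_assoc]
    exact (mul_le_mul_right (ENNReal.le_tsum i) _).trans (ENNReal.le_tsum (f := fun k => p k *
      ∑' i, trans L k i 1 * sqDist (trans L i j t) (trans L k j (t + 1))) k)
  calc sqDist (trans L i j t) (trans L k j (t + 1))
      = (p k * trans L k i 1)⁻¹ * (p k * trans L k i 1 *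
        sqDist (trans L i j t) (trans L k j (t + 1))) := by
        rw [← mul_assoc, ENNReal.inv_mul_cancel hc0 hct, one_mul]
    _ ≤ _ := by gcongr

lemma toReal_trans_le_one (h : IsStationaryChain L p) (i j : S) (t : ℝ) :
    (trans L i j t).toReal ≤ 1 := by
  have := ENNReal.toReal_mono ENNReal.one_ne_top (trans_le_one h.exitRate_ne_top i j t)
  simpa using this

lemma summable_toReal (h : IsStationaryChain L p) : Summable fun i => (p i).toReal :=
  ENNReal.summable_toReal (by rw [h.tsum_eq_one]; exact ENNReal.one_ne_top)

lemma tsum_toReal (h : IsStationaryChain L p) : ∑' i, (p i).toReal = 1 := by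
  rw [← ENNReal.tsum_toReal_eq h.ne_top, h.tsum_eq_one, ENNReal.toReal_one]

/-- The transition probabilities of an irreducible positive recurrent chain converge to the
stationary distribution. -/
lemma tendsto_trans (h : IsStationaryChain L p) (k j : S) :
    Tendsto (trans L k j) atTop (𝓝 (p j)) := by
  have h1 : ∀ i, Tendsto (fun t => (trans L i j t).toReal - (trans L k j (t + 1)).toReal) atTop
      (𝓝 0) := by
    intro i
    have h2 := (ENNReal.tendsto_toReal ENNReal.zero_ne_top).comp (h.tendsto_sqDist_trans i j k)
    have h3 : (ENNReal.toReal ∘ fun t => sqDist (trans L i j t) (trans L k j (t + 1)))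
        = fun t => ((trans L i j t).toReal - (trans L k j (t + 1)).toReal) ^ 2 := by
      funext t
      simp only [Function.comp, sqDist]
      rw [ENNReal.toReal_ofReal (by positivity)]
    rw [h3, ENNReal.toReal_zero] at h2
    have h4 := h2.sqrt
    simp only [Real.sqrt_sq_eq_abs, Real.sqrt_zero] at h4
    exact (tendsto_zero_iff_abs_tendsto_zero _).2 h4
  -- The differences are averaged over `i`; by stationarity the first term averages to the constant
  -- p(j), which identifies the limit.
  have h2 : Tendsto (fun t => ∑' i, (p i).toReal *
      ((trans L i j t).toReal - (trans L k j (t + 1)).toReal)) atTop (𝓝 (∑' i : S, 0)) := by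
    refine tendsto_tsum_of_dominated_convergence (bound := fun i => (p i).toReal)
      h.summable_toReal (fun i => ?_) (Eventually.of_forall fun t i => ?_)
    · simpa using (h1 i).const_mul ((p i).toReal)
    · rw [norm_mul, Real.norm_of_nonneg ENNReal.toReal_nonneg]
      refine mul_le_of_le_one_right ENNReal.toReal_nonneg ?_
      rw [Real.norm_eq_abs, abs_le]
      have h3 := h.toReal_trans_le_one i j t
      have h4 := h.toReal_trans_le_one k j (t + 1)
      have h5 : 0 ≤ (trans L i j t).toReal := ENNReal.toReal_nonneg
      have h6 : 0 ≤ (trans L k j (t + 1)).toReal := ENNReal.toReal_nonneg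
      constructor <;> linarith
  rw [tsum_zero] at h2
  have h3 : ∀ t, 0 ≤ t → ∑' i, (p i).toReal *
      ((trans L i j t).toReal - (trans L k j (t + 1)).toReal)
      = (p j).toReal - (trans L k j (t + 1)).toReal := by
    intro t ht
    have h4 : ∀ i, p i * trans L i j t ≠ ∞ := fun i => ENNReal.mul_ne_top (h.ne_top i)
      ((trans_le_one h.exitRate_ne_top i j t).trans_lt ENNReal.one_lt_top).ne
    have h5 : ∑' i, (p i).toReal * (trans L i j t).toReal = (p j).toReal := by
      rw [← h.stationary t ht j, ENNReal.tsum_toReal_eq h4]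
      exact tsum_congr fun i => (ENNReal.toReal_mul).symm
    have h6 : Summable fun i => (p i).toReal * (trans L i j t).toReal := by
      refine h.summable_toReal.of_nonneg_of_le (fun i => by positivity) fun i => ?_
      exact mul_le_of_le_one_right ENNReal.toReal_nonneg (h.toReal_trans_le_one i j t)
    simp_rw [mul_sub]
    rw [h6.tsum_sub (h.summable_toReal.mul_right _), h5, tsum_mul_right, h.tsum_toReal, one_mul]
  have h4 : Tendsto (fun t => (trans L k j (t + 1)).toReal) atTop (𝓝 (p j).toReal) := by
    have h5 : Tendsto (fun t => (p j).toReal - (trans L k j (t + 1)).toReal) atTop (𝓝 0) :=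
      h2.congr' ((eventually_ge_atTop 0).mono h3)
    have h6 := (tendsto_const_nhds (x := (p j).toReal)).sub h5
    simpa using h6
  have h5 : Tendsto (fun t => (trans L k j t).toReal) atTop (𝓝 (p j).toReal) := by
    have h6 := h4.comp (tendsto_atTop_add_const_right atTop (-1 : ℝ) tendsto_id)
    simpa [Function.comp_def] using h6
  exact (ENNReal.tendsto_toReal_iff (fun t =>
    ((trans_le_one h.exitRate_ne_top k j t).trans_lt ENNReal.one_lt_top).ne) (h.ne_top j)).1 h5

end IsStationaryChain

end Ergodic

/-! ### The deviation kernel -/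

section Deviation

variable {S : Type*} [Countable S] [MeasurableSpace S] [MeasurableSingletonClass S]

/-- The integral `∫_0^∞ P_{T-r}(j,j) F(r) dr`. -/
def delayIntegral (L : S → S → ℝ) (j : S) (F : ℝ → ℝ≥0∞) (T : ℝ) : ℝ≥0∞ :=
  ∫⁻ r in Set.Ici 0, trans L j j (T - r) * F r

lemma trans_backward (L : S → S → ℝ) (i j : S) (t : ℝ) :
    trans L i j t = nJump L 0 i j t + stepConv L i (fun k => trans L k j) t := by
  have hm : ∀ n, Measurable fun s => survival L i s * ∑' k, jumpRate L i k * nJump L n k j (t - s) :=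
    fun n => (measurable_survival L i).mul (Measurable.tsum fun k =>
      ((measurable_nJump L n k j).comp (measurable_const.sub measurable_id)).const_mul _)
  rw [trans, tsum_eq_zero_add' ENNReal.summable]
  congr 1
  simp_rw [nJump_succ]
  rw [← lintegral_tsum fun n => (hm n).aemeasurable, stepConv]
  refine lintegral_congr fun s => ?_
  rw [ENNReal.tsum_mul_left, ENNReal.tsum_comm]
  simp_rw [ENNReal.tsum_mul_left, trans]

lemma occupation_le {L : S → S → ℝ} (hq : ∀ i, exitRate L i ≠ ∞) (i j : S) (T : ℝ) :
    occupation L i j T ≤ ENNReal.ofReal T := by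
  have h1 : ∀ t, trans L i j t ≤ (Set.Ici (0 : ℝ)).indicator 1 t := by
    intro t
    rcases lt_or_ge t 0 with h | h
    · rw [trans_of_neg L i j h]; exact zero_le
    · rw [Set.indicator_of_mem (by exact h)]; exact trans_le_one hq i j t
  calc occupation L i j T ≤ ∫⁻ t in Set.Iic T, (Set.Ici (0 : ℝ)).indicator 1 t :=
        lintegral_mono h1
    _ = ENNReal.ofReal T := by
        rw [lintegral_indicator_one measurableSet_Ici, Measure.restrict_apply measurableSet_Ici,
          Set.Ici_inter_Iic, Real.volume_Icc, sub_zero]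

lemma occupation_ne_top {L : S → S → ℝ} (hq : ∀ i, exitRate L i ≠ ∞) (i j : S) (T : ℝ) :
    occupation L i j T ≠ ∞ := ((occupation_le hq i j T).trans_lt ENNReal.ofReal_lt_top).ne

/-- The backward equation integrated up to `T`: the first stay in `a` contributes at most its mean
1/q, and the later occupation, being delayed, is at most the occupation up to `T` from the next
state. -/
lemma exitRate_mul_occupation_le {L : S → S → ℝ} {a : S} (h0 : exitRate L a ≠ 0)
    (hq : exitRate L a ≠ ∞) (T : ℝ) :
    exitRate L a * occupation L a a T ≤ 1 + ∑' k, jumpRate L a k * occupation L k a T := by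
  have hm1 : Measurable fun p : ℝ × ℝ => survival L a p.2 * ∑' k, jumpRate L a k *
      trans L k a (p.1 - p.2) :=
    ((measurable_survival L a).comp measurable_snd).mul (Measurable.tsum fun k =>
      ((measurable_trans L k a).comp (measurable_fst.sub measurable_snd)).const_mul _)
  have h1 : occupation L a a T ≤ (exitRate L a)⁻¹ +
      (exitRate L a)⁻¹ * ∑' k, jumpRate L a k * occupation L k a T := by
    unfold occupation
    simp_rw [trans_backward L a a, nJump_zero_self]
    rw [lintegral_add_left (measurable_survival L a), ← lintegral_survival h0 hq]
    refine add_le_add (setLIntegral_le_lintegral _ _) ?_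
    unfold stepConv
    rw [lintegral_lintegral_swap hm1.aemeasurable,
      ← lintegral_mul_const _ (measurable_survival L a)]
    refine lintegral_mono fun s => ?_
    rcases lt_or_ge s 0 with hs | hs
    · simp [survival_of_neg L a hs]
    · have hm2 : ∀ k, Measurable fun t => jumpRate L a k * trans L k a (t - s) := fun k =>
        ((measurable_trans L k a).comp (measurable_id.sub_const s)).const_mul _
      simp only
      rw [lintegral_const_mul _ (Measurable.tsum hm2), lintegral_tsum fun k => (hm2 k).aemeasurable]
      gcongr with k
      have hm3 : Measurable fun t => trans L k a (t - s) :=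
        (measurable_trans L k a).comp (measurable_id.sub_const s)
      rw [lintegral_const_mul _ hm3]
      refine mul_le_mul_right ?_ _
      rw [← lintegral_indicator measurableSet_Iic, ← lintegral_indicator measurableSet_Iic,
        ← lintegral_sub_right_eq_self ((Set.Iic T).indicator fun t => trans L k a t) s]
      refine lintegral_mono fun t => ?_
      by_cases ht : t ≤ T
      · rw [Set.indicator_of_mem (by exact ht), Set.indicator_of_mem (by
          simp only [Set.mem_Iic]; linarith)]
      · rw [Set.indicator_of_notMem (by exact ht)]
        exact zero_le
  calc exitRate L a * occupation L a a T ≤ exitRate L a * ((exitRate L a)⁻¹ +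
      (exitRate L a)⁻¹ * ∑' k, jumpRate L a k * occupation L k a T) := by gcongr
    _ = _ := by rw [mul_add, ← mul_assoc, ENNReal.mul_inv_cancel h0 hq, one_mul]

lemma intervalIntegrable_transition {L : S → S → ℝ} (hq : ∀ i, exitRate L i ≠ ∞) (i j : S)
    (T : ℝ) : IntervalIntegrable (fun t => transition L t.toNNReal i j) volume 0 T := by
  have h1 : (fun t : ℝ => transition L t.toNNReal i j)
      = fun t => (trans L i j (max t 0)).toReal := by
    funext t
    rw [transition_eq hq, Real.coe_toNNReal']
  rw [h1]
  have hm : Measurable fun t : ℝ => (trans L i j (max t 0)).toReal :=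
    ((measurable_trans L i j).comp (measurable_id.max measurable_const)).ennreal_toReal
  refine (intervalIntegrable_const (c := (1 : ℝ))).mono_fun hm.aestronglyMeasurable
    (Eventually.of_forall fun t => ?_)
  simp only
  rw [Real.norm_of_nonneg ENNReal.toReal_nonneg]
  have := ENNReal.toReal_mono ENNReal.one_ne_top (trans_le_one hq i j (max t 0))
  simpa using this

lemma integral_transition {L : S → S → ℝ} (hq : ∀ i, exitRate L i ≠ ∞) (i j : S) {T : ℝ}
    (hT : 0 ≤ T) :
    ∫ t in (0 : ℝ)..T, transition L t.toNNReal i j = (occupation L i j T).toReal := by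
  have h1 : ∫ t in (0 : ℝ)..T, transition L t.toNNReal i j
      = ∫ t in Set.Ioc 0 T, (trans L i j t).toReal := by
    rw [intervalIntegral.integral_of_le hT]
    refine setIntegral_congr_fun measurableSet_Ioc fun t ht => ?_
    rw [transition_eq hq, Real.coe_toNNReal _ ht.1.le]
  rw [h1, integral_toReal (measurable_trans L i j).aemeasurable
    (Eventually.of_forall fun t => (trans_le_one hq i j t).trans_lt ENNReal.one_lt_top)]
  congr 1
  rw [occupation, ← Set.Iic_union_Ioc_eq_Iic hT,
    lintegral_union measurableSet_Ioc (Set.Iic_disjoint_Ioc le_rfl)]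
  have h2 : ∫⁻ t in Set.Iic (0 : ℝ), trans L i j t = 0 := by
    rw [← setLIntegral_congr (Iio_ae_eq_Iic (a := (0 : ℝ)))]
    rw [setLIntegral_congr_fun measurableSet_Iio (g := fun _ => 0) fun t ht =>
      trans_of_neg L i j ht]
    simp
  rw [h2, zero_add]

lemma integral_transition_sub {L : S → S → ℝ} (hq : ∀ i, exitRate L i ≠ ∞) (i j : S) (c : ℝ)
    {T : ℝ} (hT : 0 ≤ T) :
    ∫ t in (0 : ℝ)..T, (transition L t.toNNReal i j - c) = (occupation L i j T).toReal - T * c := by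
  rw [intervalIntegral.integral_sub (intervalIntegrable_transition hq i j T)
    intervalIntegrable_const, integral_transition hq i j hT, intervalIntegral.integral_const]
  simp

/-- The mean hitting time of `j`, for the chain with initial distribution `p`. -/
def avgHit (L : S → S → ℝ) (p : S → ℝ≥0∞) (j : S) : ℝ≥0∞ := ∑' i, p i * meanHit L i j

/-- The tail of the hitting time of `j`, for the chain with initial distribution `p`. -/
def avgTail (L : S → S → ℝ) (p : S → ℝ≥0∞) (j : S) (r : ℝ) : ℝ≥0∞ :=
  ∑' i, p i * hitTail L i j r

@[fun_prop]
lemma measurable_avgTail (L : S → S → ℝ) (p : S → ℝ≥0∞) (j : S) : Measurable (avgTail L p j) :=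
  Measurable.tsum fun i => (measurable_hitTail L i j).const_mul _

lemma lintegral_avgTail {L : S → S → ℝ} (hq : ∀ i, exitRate L i ≠ ∞) (p : S → ℝ≥0∞) (j : S) :
    ∫⁻ r in Set.Ici 0, avgTail L p j r = avgHit L p j := by
  unfold avgTail avgHit
  rw [lintegral_tsum fun i => ((measurable_hitTail L i j).const_mul _).aemeasurable]
  refine tsum_congr fun i => ?_
  rw [lintegral_const_mul _ (measurable_hitTail L i j), lintegral_hitTail hq]

lemma delayIntegral_avgTail (L : S → S → ℝ) (p : S → ℝ≥0∞) (j : S) (T : ℝ) :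
    delayIntegral L j (avgTail L p j) T = ∑' i, p i * delayIntegral L j (hitTail L i j) T := by
  have hm : ∀ i, Measurable fun r => trans L j j (T - r) * hitTail L i j r := fun i =>
    ((measurable_trans L j j).comp (measurable_const.sub measurable_id)).mul
      (measurable_hitTail L i j)
  unfold delayIntegral avgTail
  simp_rw [← lintegral_const_mul _ (hm _)]
  rw [← lintegral_tsum fun i => ((hm i).const_mul _).aemeasurable]
  refine lintegral_congr fun r => ?_
  rw [← ENNReal.tsum_mul_left]
  exact tsum_congr fun i => by ring

namespace IsStationaryChain

variable {L : S → S → ℝ} {p : S → ℝ≥0∞}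

lemma delayIntegral_le (h : IsStationaryChain L p) (j : S) (F : ℝ → ℝ≥0∞) (T : ℝ) :
    delayIntegral L j F T ≤ ∫⁻ r in Set.Ici 0, F r :=
  lintegral_mono fun _ => mul_le_of_le_one_left' (trans_le_one h.exitRate_ne_top j j _)

lemma tendsto_trans_sub (h : IsStationaryChain L p) (j : S) (r : ℝ) :
    Tendsto (fun T => trans L j j (T - r)) atTop (𝓝 (p j)) :=
  (h.tendsto_trans j j).comp (tendsto_atTop_add_const_right atTop (-r) tendsto_id)

lemma tendsto_delayIntegral (h : IsStationaryChain L p) (j : S) {F : ℝ → ℝ≥0∞}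
    (hF : Measurable F) (hF1 : ∀ r, F r ≠ ∞) (hfin : ∫⁻ r in Set.Ici 0, F r ≠ ∞) :
    Tendsto (delayIntegral L j F) atTop (𝓝 (p j * ∫⁻ r in Set.Ici 0, F r)) := by
  rw [← lintegral_const_mul _ hF]
  refine tendsto_lintegral_filter_of_dominated_convergence F (Eventually.of_forall fun T =>
    ((measurable_trans L j j).comp (measurable_const.sub measurable_id)).mul hF)
    (Eventually.of_forall fun T => Eventually.of_forall fun r =>
      mul_le_of_le_one_left' (trans_le_one h.exitRate_ne_top j j _)) hfin
    (Eventually.of_forall fun r => ?_)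
  exact ENNReal.Tendsto.mul_const (h.tendsto_trans_sub j r) (Or.inr (hF1 r))

/-- Fatou's lemma along integer times. No integrability of `F` is assumed, so a bound on the delayed
integrals yields finiteness of a mean hitting time. -/
lemma mul_lintegral_le_of_delayIntegral (h : IsStationaryChain L p) (j : S) {F : ℝ → ℝ≥0∞}
    (hF : Measurable F) (hF1 : ∀ r, F r ≠ ∞) {c : ℝ≥0∞}
    (hc : ∀ᶠ n : ℕ in atTop, delayIntegral L j F n ≤ c) :
    p j * ∫⁻ r in Set.Ici 0, F r ≤ c := by
  have h1 : ∀ r, Tendsto (fun n : ℕ => trans L j j (n - r) * F r) atTop (𝓝 (p j * F r)) :=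
    fun r => ENNReal.Tendsto.mul_const
      ((h.tendsto_trans_sub j r).comp tendsto_natCast_atTop_atTop) (Or.inr (hF1 r))
  rw [← lintegral_const_mul _ hF]
  calc ∫⁻ r in Set.Ici 0, p j * F r
      = ∫⁻ r in Set.Ici 0, liminf (fun n : ℕ => trans L j j (n - r) * F r) atTop :=
        lintegral_congr fun r => (h1 r).liminf_eq.symm
    _ ≤ liminf (fun n : ℕ => delayIntegral L j F n) atTop :=
        lintegral_liminf_le fun n =>
          ((measurable_trans L j j).comp (measurable_const.sub measurable_id)).mul hF
    _ ≤ c := by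
        refine liminf_le_of_frequently_le' hc.frequently

/-! ### Finiteness of the mean hitting times. -/

lemma exitRate_ne_zero (h : IsStationaryChain L p) {i b : S} (hib : i ≠ b) :
    exitRate L i ≠ 0 := by
  intro h0
  refine (trans_pos h.irreducible i b one_pos).ne' ?_
  refine ENNReal.tsum_eq_zero.2 fun n => ?_
  cases n with
  | zero => rw [nJump_zero_of_ne L hib]; rfl
  | succ n => simp [nJump_succ, jumpRate_eq_zero_of_exitRate h0]

/-- The mean return time is finite. -/
lemma tsum_jumpRate_mul_meanHit_ne_top (h : IsStationaryChain L p) (a : S) :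
    ∑' k, jumpRate L a k * meanHit L k a ≠ ∞ := by
  by_cases h0 : exitRate L a = 0
  · simp [jumpRate_eq_zero_of_exitRate h0]
  have hq := h.exitRate_ne_top
  -- The jump rates out of `a` replace the initial distribution. Comparing the occupation identities
  -- from the neighbours with `exitRate_mul_occupation_le`, the neighbours' occupation times cancel
  -- and the bound 1 remains.
  have h1 : p a * ∫⁻ r in Set.Ici 0, avgTail L (jumpRate L a) a r ≤ 1 := by
    refine h.mul_lintegral_le_of_delayIntegral a (measurable_avgTail L _ a) (fun r => ?_)
      (Eventually.of_forall fun n => ?_)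
    · refine ne_top_of_le_ne_top (hq a) ?_
      exact ENNReal.tsum_le_tsum fun k => mul_le_of_le_one_right' (hitTail_le_one L k a r)
    · rw [delayIntegral_avgTail]
      have h2 := exitRate_mul_occupation_le h0 (hq a) n
      have h3 : exitRate L a * occupation L a a n
          = ∑' k, jumpRate L a k * delayIntegral L a (hitTail L k a) n
            + ∑' k, jumpRate L a k * occupation L k a n := by
        rw [exitRate, ← ENNReal.tsum_mul_right, ← ENNReal.tsum_add]
        refine tsum_congr fun k => ?_
        rw [← mul_add, occupation_eq_add hq k a, add_comm]
        rfl
      rw [h3] at h2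
      refine (ENNReal.add_le_add_iff_right ?_).1 h2
      refine ne_top_of_le_ne_top (ENNReal.mul_ne_top (hq a) (ENNReal.ofReal_ne_top (r := n))) ?_
      rw [exitRate, ← ENNReal.tsum_mul_right]
      exact ENNReal.tsum_le_tsum fun k => mul_le_mul_right (occupation_le hq k a n) _
  rw [lintegral_avgTail hq] at h1
  exact (ENNReal.lt_top_of_mul_ne_top_right (ne_top_of_le_ne_top ENNReal.one_ne_top h1)
    (h.ne_zero a)).ne

/-- Along a possible jump, expected hitting times increase by a bounded amount only. -/
lemma exists_meanHit_le_of_jumpRate_pos (h : IsStationaryChain L p) {a b : S}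
    (hab : jumpRate L a b ≠ 0) : ∃ C ≠ ∞, ∀ i, meanHit L i b ≤ meanHit L i a + C := by
  classical
  have hq := h.exitRate_ne_top
  set K := ∑' k, jumpRate L a k * meanHit L k a with hK
  have hKt : K ≠ ∞ := h.tsum_jumpRate_mul_meanHit_ne_top a
  have hrt : jumpRate L a b ≠ ∞ := ne_top_of_le_ne_top (hq a) (ENNReal.le_tsum b)
  -- With q the exit rate of `a` and r the rate from `a` to `b`: a return cycle from `a` has mean
  -- length (1 + K)/q, and the jump to `b` is chosen after q/r attempts on average. The product
  -- bounds the time needed from `a`.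
  refine ⟨(1 + K) / jumpRate L a b, ENNReal.div_ne_top (by finiteness) hab, fun i => ?_⟩
  set C := (1 + K) / jumpRate L a b with hC
  have hrC : jumpRate L a b * C = 1 + K := ENNReal.mul_div_cancel hab hrt
  -- The strategy "go to `a`, then spend `C`", corrected to zero at the target.
  set w : S → ℝ≥0∞ := fun i => if i = b then 0 else meanHit L i a + C with hw
  have hwle : ∀ i, w i ≤ meanHit L i a + C := fun i => by
    simp only [hw]; split_ifs <;> simp
  refine (meanHit_le_of_supersolution hq h.ae_iSup_jumpTime (j := b) (w := w)
    (fun i hi => h.exitRate_ne_zero hi) (fun i hi => ?_) i).trans (hwle i)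
  have hwi : w i = meanHit L i a + C := if_neg hi
  by_cases hia : i = a
  · subst hia
    rw [hwi, meanHit_self hq, zero_add]
    -- At `a` the inequality holds because `w` vanishes at `b`: the saving there is at least
    -- `jumpRate L a b * C = 1 + K`. Adding `K` on both sides avoids subtraction.
    have h1 : ∑' k, jumpRate L i k * w k + (1 + K) ≤ exitRate L i * C + K := by
      calc ∑' k, jumpRate L i k * w k + (1 + K)
          = ∑' k, (jumpRate L i k * w k + if k = b then 1 + K else 0) := by
            rw [ENNReal.tsum_add, tsum_ite_eq]
        _ ≤ ∑' k, (jumpRate L i k * C + jumpRate L i k * meanHit L k i) := by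
            refine ENNReal.tsum_le_tsum fun k => ?_
            by_cases hk : k = b
            · subst hk
              simp [hw, hrC]
            · simp only [hw, if_neg hk, add_zero, mul_add]
              rw [add_comm]
        _ = _ := by
            rw [ENNReal.tsum_add, ENNReal.tsum_mul_right, hK, exitRate]
    have h2 : 1 + ∑' k, jumpRate L i k * w k + K ≤ exitRate L i * C + K := by
      refine le_trans (le_of_eq ?_) h1
      ring
    exact (ENNReal.add_le_add_iff_right hKt).1 h2
  · rw [hwi, mul_add, meanHit_first_step hq hia (h.exitRate_ne_zero hi), add_assoc]
    gcongr
    calc ∑' k, jumpRate L i k * w k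
        ≤ ∑' k, (jumpRate L i k * meanHit L k a + jumpRate L i k * C) :=
          ENNReal.tsum_le_tsum fun k => by rw [← mul_add]; exact mul_le_mul_right (hwle k) _
      _ = _ := by rw [ENNReal.tsum_add, ENNReal.tsum_mul_right, exitRate]

lemma exists_meanHit_le (h : IsStationaryChain L p) (a b : S) :
    ∃ C ≠ ∞, ∀ i, meanHit L i b ≤ meanHit L i a + C := by
  induction h.irreducible a b with
  | refl => exact ⟨0, by simp, fun i => by simp⟩
  | @tail b c _ hbc ih =>
    obtain ⟨C, hC, hle⟩ := ih
    by_cases hne : c = b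
    · exact hne ▸ ⟨C, hC, hle⟩
    have hr : jumpRate L b c ≠ 0 := by
      rw [jumpRate, if_neg hne]
      simpa using hbc
    obtain ⟨C', hC', hle'⟩ := h.exists_meanHit_le_of_jumpRate_pos hr
    refine ⟨C + C', by finiteness, fun i => (hle' i).trans ?_⟩
    rw [← add_assoc]
    gcongr
    exact hle i

lemma meanHit_ne_top (h : IsStationaryChain L p) (i j : S) : meanHit L i j ≠ ∞ := by
  obtain ⟨C, hC, hle⟩ := h.exists_meanHit_le i j
  have := hle i
  rw [meanHit_self h.exitRate_ne_top, zero_add] at this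
  exact ne_top_of_le_ne_top hC this

lemma avgHit_ne_top (h : IsStationaryChain L p) {a : S} (ha : avgHit L p a ≠ ∞) (b : S) :
    avgHit L p b ≠ ∞ := by
  obtain ⟨C, hC, hle⟩ := h.exists_meanHit_le a b
  refine ne_top_of_le_ne_top (show avgHit L p a + C ≠ ∞ by finiteness) ?_
  calc avgHit L p b ≤ ∑' i, (p i * meanHit L i a + p i * C) :=
        ENNReal.tsum_le_tsum fun i => by rw [← mul_add]; exact mul_le_mul_right (hle i) _
    _ = _ := by rw [ENNReal.tsum_add, ENNReal.tsum_mul_right, h.tsum_eq_one, one_mul, avgHit]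

/-! ### Centred occupation times and their limits. -/

lemma tsum_mul_occupation (h : IsStationaryChain L p) (j : S) (T : ℝ) :
    ∑' i, p i * occupation L i j T = ENNReal.ofReal T * p j := by
  unfold occupation
  simp_rw [← lintegral_const_mul _ (measurable_trans L _ j)]
  rw [← lintegral_tsum fun i => ((measurable_trans L i j).const_mul _).aemeasurable]
  have h1 : ∀ t, ∑' i, p i * trans L i j t = (Set.Ici (0 : ℝ)).indicator (fun _ => p j) t := by
    intro t
    rcases lt_or_ge t 0 with ht | ht
    · rw [Set.indicator_of_notMem (by simpa using ht)]
      simp [trans_of_neg L _ j ht]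
    · rw [Set.indicator_of_mem (by exact ht), h.stationary t ht]
  simp_rw [h1]
  rw [lintegral_indicator_const measurableSet_Ici, Measure.restrict_apply measurableSet_Ici,
    Set.Ici_inter_Iic, Real.volume_Icc, sub_zero, mul_comm]

/-- The average of `occupation_eq_add` over a stationary start, for which the mean occupation time
of `j` is T p(j). -/
lemma occupation_self_eq (h : IsStationaryChain L p) (j : S) (T : ℝ) :
    occupation L j j T = ENNReal.ofReal T * p j + delayIntegral L j (avgTail L p j) T := by
  rw [← h.tsum_mul_occupation, delayIntegral_avgTail, ← ENNReal.tsum_add]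
  simp_rw [← mul_add]
  have h1 : ∀ i, occupation L i j T + delayIntegral L j (hitTail L i j) T
      = occupation L j j T := fun i => (occupation_eq_add h.exitRate_ne_top i j T).symm
  simp_rw [h1]
  rw [ENNReal.tsum_mul_right, h.tsum_eq_one, one_mul]

lemma delayIntegral_avgTail_ne_top (h : IsStationaryChain L p) (j : S) (T : ℝ) :
    delayIntegral L j (avgTail L p j) T ≠ ∞ := by
  refine ne_top_of_le_ne_top (occupation_ne_top h.exitRate_ne_top j j T) ?_
  rw [h.occupation_self_eq]
  exact le_add_self

lemma avgTail_ne_top (h : IsStationaryChain L p) (j : S) (r : ℝ) : avgTail L p j r ≠ ∞ := by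
  refine ne_top_of_le_ne_top ENNReal.one_ne_top ?_
  rw [← h.tsum_eq_one]
  exact ENNReal.tsum_le_tsum fun k => mul_le_of_le_one_right' (hitTail_le_one L k j r)

lemma delayIntegral_hitTail_ne_top (h : IsStationaryChain L p) (i j : S) (T : ℝ) :
    delayIntegral L j (hitTail L i j) T ≠ ∞ := by
  refine ne_top_of_le_ne_top (h.meanHit_ne_top i j) ?_
  rw [← lintegral_hitTail h.exitRate_ne_top]
  exact h.delayIntegral_le j _ T

/-- The centered occupation time is the difference of two integrals which converge. -/
lemma integral_transition_sub_eq (h : IsStationaryChain L p) (i j : S) {T : ℝ} (hT : 0 ≤ T) :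
    ∫ t in (0 : ℝ)..T, (transition L t.toNNReal i j - (p j).toReal)
      = (delayIntegral L j (avgTail L p j) T).toReal
        - (delayIntegral L j (hitTail L i j) T).toReal := by
  have hq := h.exitRate_ne_top
  have h1 := congrArg ENNReal.toReal (h.occupation_self_eq j T)
  have h2 : (occupation L j j T).toReal
      = (occupation L i j T + delayIntegral L j (hitTail L i j) T).toReal :=
    congrArg ENNReal.toReal (occupation_eq_add hq i j T)
  rw [ENNReal.toReal_add (ENNReal.mul_ne_top ENNReal.ofReal_ne_top (h.ne_top j))
    (h.delayIntegral_avgTail_ne_top j T), ENNReal.toReal_mul, ENNReal.toReal_ofReal hT] at h1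
  rw [ENNReal.toReal_add (occupation_ne_top hq i j T) (h.delayIntegral_hitTail_ne_top i j T)] at h2
  rw [integral_transition_sub hq i j _ hT]
  linarith

/-- The value of the deviation kernel in terms of expected hitting times. -/
lemma hasImproperIntegral_deviation (h : IsStationaryChain L p) {j : S}
    (hj : avgHit L p j ≠ ∞) (i : S) :
    HasImproperIntegral (fun t => transition L t.toNNReal i j - (p j).toReal)
      ((p j).toReal * (avgHit L p j).toReal - (p j).toReal * meanHitReal L i j) := by
  have hq := h.exitRate_ne_top
  refine ⟨fun T _ => (intervalIntegrable_transition hq i j T).sub intervalIntegrable_const, ?_⟩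
  have h1 := h.tendsto_delayIntegral j (measurable_avgTail L p j) (h.avgTail_ne_top j)
    (by rwa [lintegral_avgTail hq])
  have h2 := h.tendsto_delayIntegral j (measurable_hitTail L i j)
    (fun r => ((hitTail_le_one L i j r).trans_lt ENNReal.one_lt_top).ne)
    (by rw [lintegral_hitTail hq]; exact h.meanHit_ne_top i j)
  rw [lintegral_avgTail hq] at h1
  rw [lintegral_hitTail hq] at h2
  have h3 := ((ENNReal.tendsto_toReal (ENNReal.mul_ne_top (h.ne_top j) hj)).comp h1).sub
    ((ENNReal.tendsto_toReal (ENNReal.mul_ne_top (h.ne_top j) (h.meanHit_ne_top i j))).comp h2)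
  rw [ENNReal.toReal_mul, ENNReal.toReal_mul] at h3
  refine h3.congr' ?_
  filter_upwards [eventually_ge_atTop 0] with T hT
  exact (h.integral_transition_sub_eq i j hT).symm

/-- If the deviation kernel is finite at `(j, j)` then the mean hitting time of `j` from
stationarity is finite. -/
lemma avgHit_ne_top_of_hasImproperIntegral (h : IsStationaryChain L p) {j : S} {v : ℝ}
    (hv : HasImproperIntegral (fun t => transition L t.toNNReal j j - (p j).toReal) v) :
    avgHit L p j ≠ ∞ := by
  have hq := h.exitRate_ne_top
  have h1 : ∀ᶠ T in atTop, ∫ t in (0 : ℝ)..T, (transition L t.toNNReal j j - (p j).toReal) < v + 1 :=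
    hv.2.eventually_lt_const (by linarith)
  have h2 : p j * ∫⁻ r in Set.Ici 0, avgTail L p j r ≤ ENNReal.ofReal (v + 1) := by
    refine h.mul_lintegral_le_of_delayIntegral j (measurable_avgTail L p j) (h.avgTail_ne_top j) ?_
    refine tendsto_natCast_atTop_atTop.eventually
      (p := fun T : ℝ => delayIntegral L j (avgTail L p j) T ≤ ENNReal.ofReal (v + 1)) ?_
    filter_upwards [h1, eventually_ge_atTop 0] with T hT hT0
    rw [h.integral_transition_sub_eq j j hT0] at hT
    have h3 : delayIntegral L j (hitTail L j j) T = 0 := by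
      have := h.delayIntegral_le j (hitTail L j j) T
      rw [lintegral_hitTail hq, meanHit_self hq] at this
      exact le_antisymm this zero_le
    rw [h3, ENNReal.toReal_zero, sub_zero] at hT
    exact ENNReal.le_ofReal_iff_toReal_le (h.delayIntegral_avgTail_ne_top j T)
      (ENNReal.toReal_nonneg.trans hT.le) |>.2 hT.le
  rw [lintegral_avgTail hq] at h2
  exact (ENNReal.lt_top_of_mul_ne_top_right
    (ne_top_of_le_ne_top ENNReal.ofReal_ne_top h2) (h.ne_zero j)).ne

end IsStationaryChain

end Deviation

/-! ### Reversible chains: the Stein solution -/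

section Reversible

variable {S : Type*} [Countable S] [MeasurableSpace S] [MeasurableSingletonClass S]

lemma jumpRate_le (L : S → S → ℝ) (i j : S) : jumpRate L i j ≤ ENNReal.ofReal |L i j| := by
  unfold jumpRate
  split_ifs
  · exact zero_le
  · exact ENNReal.ofReal_le_ofReal (le_abs_self _)

lemma IsGenerator.exitRate_ne_top {L : S → S → ℝ} (hL : IsGenerator L) (i : S) :
    exitRate L i ≠ ∞ :=
  ne_top_of_le_ne_top (hL.row_sum i).summable.abs.tsum_ofReal_ne_top
    (ENNReal.tsum_le_tsum fun j => jumpRate_le L i j)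

lemma isStationaryChain_of_isStationaryLaw {L : S → S → ℝ} {π : S → ℝ} (hπ : ∀ i, 0 < π i)
    (hsum : HasSum π 1) (hL : IsGenerator L) (hirr : IsIrreducibleGen L)
    (hst : IsStationaryLaw L π) : IsStationaryChain L fun i => ENNReal.ofReal (π i) where
  exitRate_ne_top := hL.exitRate_ne_top
  irreducible := hirr
  ne_zero i := by simpa using hπ i
  tsum_eq_one := by
    rw [← ENNReal.ofReal_tsum_of_nonneg (fun i => (hπ i).le) hsum.summable, hsum.tsum_eq,
      ENNReal.ofReal_one]
  stationary t ht j := by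
    have h1 := hst t.toNNReal j
    have h2 : ∀ i, ENNReal.ofReal (π i * transition L t.toNNReal i j)
        = ENNReal.ofReal (π i) * trans L i j t := by
      intro i
      rw [ENNReal.ofReal_mul (hπ i).le, transition_eq hL.exitRate_ne_top, Real.coe_toNNReal _ ht,
        ENNReal.ofReal_toReal
          ((trans_le_one hL.exitRate_ne_top i j t).trans_lt ENNReal.one_lt_top).ne]
    rw [← h1.tsum_eq, ENNReal.ofReal_tsum_of_nonneg _ h1.summable]
    · exact tsum_congr fun i => (h2 i).symm
    · exact fun i => mul_nonneg (hπ i).le ENNReal.toReal_nonneg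

/-- The value at `(i, j)` of the deviation kernel, in terms of expected hitting times. -/
def deviation (L : S → S → ℝ) (p : S → ℝ≥0∞) (i j : S) : ℝ :=
  (p j).toReal * (avgHit L p j).toReal - (p j).toReal * meanHitReal L i j

lemma transition_nonneg (L : S → S → ℝ) (t : ℝ≥0) (i j : S) : 0 ≤ transition L t i j :=
  ENNReal.toReal_nonneg

lemma measurable_transition {L : S → S → ℝ} (hq : ∀ i, exitRate L i ≠ ∞) (i j : S) :
    Measurable fun t : ℝ => transition L t.toNNReal i j := by
  have h1 : (fun t : ℝ => transition L t.toNNReal i j)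
      = fun t => (trans L i j (max t 0)).toReal := by
    funext t
    rw [transition_eq hq, Real.coe_toNNReal']
  rw [h1]
  exact ((measurable_trans L i j).comp (measurable_id.max measurable_const)).ennreal_toReal

namespace IsStationaryChain

variable {L : S → S → ℝ} {p : S → ℝ≥0∞}

lemma toReal_pos (h : IsStationaryChain L p) (i : S) : 0 < (p i).toReal :=
  ENNReal.toReal_pos (h.ne_zero i) (h.ne_top i)

lemma mul_transition (h : IsStationaryChain L p)
    (hrev : ∀ i j t, p i * trans L i j t = p j * trans L j i t) (t : ℝ≥0) (i j : S) :
    (p i).toReal * transition L t i j = (p j).toReal * transition L t j i := by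
  rw [transition_eq h.exitRate_ne_top, transition_eq h.exitRate_ne_top, ← ENNReal.toReal_mul,
    ← ENNReal.toReal_mul, hrev]

lemma transition_le_one (h : IsStationaryChain L p) (t : ℝ≥0) (i j : S) :
    transition L t i j ≤ 1 := by
  rw [transition_eq h.exitRate_ne_top]
  exact h.toReal_trans_le_one i j t

/-- This makes P_t h converge for every h with π(|h|) finite, with a majorant independent of t. -/
lemma transition_le_div (h : IsStationaryChain L p)
    (hrev : ∀ i j t, p i * trans L i j t = p j * trans L j i t) (t : ℝ≥0) (i j : S) :
    transition L t i j ≤ (p j).toReal / (p i).toReal := by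
  rw [le_div_iff₀ (h.toReal_pos i), mul_comm, h.mul_transition hrev]
  exact mul_le_of_le_one_right ENNReal.toReal_nonneg (h.transition_le_one t j i)

lemma hasSum_transition (h : IsStationaryChain L p) (t : ℝ≥0) (i : S) :
    HasSum (fun j => transition L t i j) 1 := by
  have h1 := h.tsum_trans_eq_one i t.2
  have h2 : ∑' j, trans L i j t ≠ ∞ := h1 ▸ ENNReal.one_ne_top
  simp_rw [transition_eq h.exitRate_ne_top]
  have h3 := ENNReal.hasSum_toReal h2
  rwa [← ENNReal.tsum_toReal_eq (fun j => ENNReal.ne_top_of_tsum_ne_top h2 j),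
    show ∑' j, trans L i j t = 1 from h1, ENNReal.toReal_one] at h3

/-- Reversibility exchanges `i` and `j`, so the target is the fixed state `i`, and the two delayed
integrals are at most the mean hitting times of `i` from stationarity and from `j`. The bound is
free of `T` and will be summed over `j`. -/
lemma abs_integral_transition_sub_le (h : IsStationaryChain L p)
    (hrev : ∀ i j t, p i * trans L i j t = p j * trans L j i t) (i j : S)
    (hi : avgHit L p i ≠ ∞) {T : ℝ} (hT : 0 ≤ T) :
    |∫ t in (0 : ℝ)..T, (transition L t.toNNReal i j - (p j).toReal)|
      ≤ (p j).toReal / (p i).toReal * ((avgHit L p i).toReal + meanHitReal L j i) := by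
  have hq := h.exitRate_ne_top
  have h1 : ∀ t : ℝ, transition L t.toNNReal i j - (p j).toReal
      = (p j).toReal / (p i).toReal * (transition L t.toNNReal j i - (p i).toReal) := by
    intro t
    have := h.mul_transition hrev t.toNNReal i j
    have hp := (h.toReal_pos i).ne'
    field_simp
    linarith
  simp_rw [h1]
  rw [intervalIntegral.integral_const_mul, h.integral_transition_sub_eq j i hT, abs_mul,
    abs_of_nonneg (by positivity)]
  refine mul_le_mul_of_nonneg_left ?_ (by positivity)
  have h2 : (delayIntegral L i (avgTail L p i) T).toReal ≤ (avgHit L p i).toReal := by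
    refine ENNReal.toReal_mono hi ?_
    rw [← lintegral_avgTail hq]
    exact h.delayIntegral_le i _ T
  have h3 : (delayIntegral L i (hitTail L j i) T).toReal ≤ meanHitReal L j i := by
    refine ENNReal.toReal_mono (h.meanHit_ne_top j i) ?_
    rw [← lintegral_hitTail hq]
    exact h.delayIntegral_le i _ T
  have h4 : 0 ≤ (delayIntegral L i (avgTail L p i) T).toReal := ENNReal.toReal_nonneg
  have h5 : 0 ≤ (delayIntegral L i (hitTail L j i) T).toReal := ENNReal.toReal_nonneg
  rw [abs_le]
  constructor <;> linarith

lemma abs_deviation_le (h : IsStationaryChain L p)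
    (hrev : ∀ i j t, p i * trans L i j t = p j * trans L j i t)
    (hfin : ∀ j, avgHit L p j ≠ ∞) (i j : S) :
    |deviation L p i j|
      ≤ (p j).toReal / (p i).toReal * ((avgHit L p i).toReal + meanHitReal L j i) := by
  refine le_of_tendsto (h.hasImproperIntegral_deviation (hfin j) i).2.abs ?_
  filter_upwards [eventually_ge_atTop 0] with T hT
  exact h.abs_integral_transition_sub_le hrev i j (hfin i) hT

/-- The moment condition is given for one target `k`; changing the target costs a constant that is
uniform in the starting point. -/
lemma summable_mul_meanHitReal (h : IsStationaryChain L p) {g : S → ℝ}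
    (hg : Summable fun i => (p i).toReal * |g i|) {k : S}
    (hk : ∑' i, ENNReal.ofReal ((p i).toReal * |g i|) * meanHit L i k ≠ ∞) (i : S) :
    Summable fun j => (p j).toReal * |g j| * meanHitReal L j i := by
  obtain ⟨C, hC, hle⟩ := h.exists_meanHit_le k i
  have h1 : Summable fun j => (p j).toReal * |g j| * meanHitReal L j k := by
    have := ENNReal.summable_toReal hk
    refine this.congr fun j => ?_
    rw [ENNReal.toReal_mul, ENNReal.toReal_ofReal (by positivity), meanHitReal]
  refine (h1.add (hg.mul_right C.toReal)).of_nonneg_of_le (fun j => ?_) fun j => ?_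
  · have : 0 ≤ meanHitReal L j i := ENNReal.toReal_nonneg
    positivity
  · rw [← mul_add]
    refine mul_le_mul_of_nonneg_left ?_ (by positivity)
    rw [meanHitReal, meanHitReal, ← ENNReal.toReal_add (h.meanHit_ne_top j k) hC]
    have := h.meanHit_ne_top j k
    exact ENNReal.toReal_mono (by finiteness) (hle j)

/-- The Stein solution of a reversible chain is the sum of `g` against the deviation kernel. -/
lemma steinSolution (h : IsStationaryChain L p)
    (hrev : ∀ i j t, p i * trans L i j t = p j * trans L j i t)
    (hfin : ∀ j, avgHit L p j ≠ ∞) {g : S → ℝ}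
    (hg : Summable fun i => (p i).toReal * |g i|) {k : S}
    (hk : ∑' i, ENNReal.ofReal ((p i).toReal * |g i|) * meanHit L i k ≠ ∞) :
    IsSteinSolution L (fun i => (p i).toReal) g (fun i => ∑' j, g j * deviation L p i j) ∧
      ∀ i, Summable fun j => g j * deviation L p i j := by
  have hq := h.exitRate_ne_top
  have hbound : ∀ i, Summable fun j => |g j| *
      ((p j).toReal / (p i).toReal * ((avgHit L p i).toReal + meanHitReal L j i)) := by
    intro i
    have h1 := ((hg.mul_right (avgHit L p i).toReal).add
      (h.summable_mul_meanHitReal hg hk i)).mul_left (p i).toReal⁻¹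
    refine h1.congr fun j => ?_
    rw [div_eq_mul_inv]
    ring
  have hsum : ∀ i, Summable fun j => g j * deviation L p i j := fun i => by
    refine Summable.of_norm_bounded (hbound i) fun j => ?_
    rw [norm_mul]
    exact mul_le_mul_of_nonneg_left (h.abs_deviation_le hrev hfin i j) (norm_nonneg _)
  have hle : ∀ i j (t : ℝ≥0), |transition L t i j * g j|
      ≤ (p i).toReal⁻¹ * ((p j).toReal * |g j|) := by
    intro i j t
    rw [abs_mul, abs_of_nonneg (transition_nonneg L t i j), ← mul_assoc, mul_comm (p i).toReal⁻¹,
      ← div_eq_mul_inv]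
    exact mul_le_mul_of_nonneg_right (h.transition_le_div hrev t i j) (abs_nonneg _)
  have hst : ∀ i (t : ℝ≥0), Summable fun j => transition L t i j * g j := fun i t =>
    Summable.of_norm_bounded (hg.mul_left (p i).toReal⁻¹) fun j => hle i j t
  have hgs : Summable fun j => (p j).toReal * g j :=
    Summable.of_norm_bounded hg fun j => by
      rw [norm_mul, Real.norm_of_nonneg ENNReal.toReal_nonneg, Real.norm_eq_abs]
  refine ⟨fun i => ⟨hst i, fun T _ => ?_, ?_⟩, hsum⟩
  · refine IntervalIntegrable.sub ?_ intervalIntegrable_const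
    have hm : Measurable fun t : ℝ => ∑' j, transition L t.toNNReal i j * g j :=
      Measurable.tsum fun j => (measurable_transition hq i j).mul_const _
    refine (intervalIntegrable_const (c := ∑' j, (p i).toReal⁻¹ * ((p j).toReal * |g j|))).mono_fun
      hm.aestronglyMeasurable (Eventually.of_forall fun t => ?_)
    refine le_trans ?_ (le_abs_self _)
    exact tsum_of_norm_bounded (hg.mul_left (p i).toReal⁻¹).hasSum fun j => hle i j _
  -- Up to a finite `T`, sum and integral are exchanged with the majorant from `transition_le_div`;
  -- the passage to the limit in `h2` uses the bound that is uniform in `T`.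
  · have h1 : ∀ T : ℝ, HasSum (fun j => ∫ t in (0 : ℝ)..T,
        g j * (transition L t.toNNReal i j - (p j).toReal))
        (∫ t in (0 : ℝ)..T, (∑' j, transition L t.toNNReal i j * g j -
          ∑' j, (p j).toReal * g j)) := by
      intro T
      refine intervalIntegral.hasSum_integral_of_dominated_convergence
        (fun j _ => (p i).toReal⁻¹ * ((p j).toReal * |g j|) + (p j).toReal * |g j|)
        (fun j => ?_) (fun j => Eventually.of_forall fun t _ => ?_)
        (Eventually.of_forall fun t _ => (hg.mul_left _).add hg) intervalIntegrable_const
        (Eventually.of_forall fun t _ => ?_)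
      · exact (((measurable_transition hq i j).sub_const _).const_mul _).aestronglyMeasurable
      · rw [mul_sub, mul_comm (g j), mul_comm (g j)]
        refine (norm_sub_le _ _).trans (add_le_add (hle i j _) ?_)
        rw [norm_mul, Real.norm_of_nonneg ENNReal.toReal_nonneg, Real.norm_eq_abs]
      · refine ((hst i t.toNNReal).hasSum.sub hgs.hasSum).congr_fun ?_
        intro j
        ring
    have h2 : Tendsto (fun T : ℝ => ∑' j, ∫ t in (0 : ℝ)..T,
        g j * (transition L t.toNNReal i j - (p j).toReal)) atTop
        (𝓝 (∑' j, g j * deviation L p i j)) := by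
      refine tendsto_tsum_of_dominated_convergence (hbound i) (fun j => ?_) ?_
      · simp_rw [intervalIntegral.integral_const_mul]
        exact (h.hasImproperIntegral_deviation (hfin j) i).2.const_mul _
      · filter_upwards [eventually_ge_atTop 0] with T hT j
        rw [intervalIntegral.integral_const_mul, norm_mul]
        exact mul_le_mul_of_nonneg_left
          (h.abs_integral_transition_sub_le hrev i j (hfin i) hT) (norm_nonneg _)
    exact h2.congr fun T => (h1 T).tsum_eq

/-- Every row of the deviation kernel of a reversible chain has sum zero. -/
lemma hasSum_deviation (h : IsStationaryChain L p)
    (hrev : ∀ i j t, p i * trans L i j t = p j * trans L j i t)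
    -- The constant function one has Stein solution zero, since P_t 1 = 1; `steinSolution` expresses
    -- this solution as the row sum.
    (hfin : ∀ j, avgHit L p j ≠ ∞) (i : S) : HasSum (fun j => deviation L p i j) 0 := by
  have hg : Summable fun i => (p i).toReal * |(fun _ : S => (1 : ℝ)) i| := by
    simpa using h.summable_toReal
  have hk : ∑' j, ENNReal.ofReal ((p j).toReal * |(fun _ : S => (1 : ℝ)) j|) * meanHit L j i
      ≠ ∞ := by
    simpa [ENNReal.ofReal_toReal (h.ne_top _), avgHit] using hfin i
  obtain ⟨h1, h2⟩ := h.steinSolution hrev hfin hg hk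
  have h3 := (h1 i).2.2
  have h4 : ∀ t : ℝ, ∑' j, transition L t.toNNReal i j * 1 - ∑' j, (p j).toReal * 1 = 0 := by
    intro t
    simp only [mul_one]
    rw [(h.hasSum_transition _ i).tsum_eq, h.tsum_toReal, sub_self]
  simp_rw [h4] at h3
  simp only [intervalIntegral.integral_zero] at h3
  have h5 := h2 i
  simp only [one_mul] at h3 h5
  rw [tendsto_nhds_unique tendsto_const_nhds h3]
  exact h5.hasSum

/-- The entries of the deviation kernel are bounded by the average hitting time. -/
lemma ofReal_abs_deviation_le (h : IsStationaryChain L p)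
    (hrev : ∀ i j t, p i * trans L i j t = p j * trans L j i t)
    (hfin : ∀ j, avgHit L p j ≠ ∞) (i j : S) :
    ENNReal.ofReal |deviation L p i j| ≤ ∑' i, ∑' j, meanHit L i j * p i * p j := by
  have h0 : ∑' i, ∑' j, meanHit L i j * p i * p j = ∑' j, p j * avgHit L p j := by
    rw [ENNReal.tsum_comm]
    refine tsum_congr fun j => ?_
    rw [avgHit, ← ENNReal.tsum_mul_left]
    exact tsum_congr fun i => by ring
  rw [h0]
  by_cases htop : ∑' j, p j * avgHit L p j = ∞
  · rw [htop]; exact le_top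
  have h1 := ENNReal.summable_toReal htop
  simp_rw [ENNReal.toReal_mul] at h1
  -- Random target identity: as the row of `i` sums to zero, the mean hitting time from `i` of a
  -- target drawn from `p` equals the average hitting time.
  have h2 := h.hasSum_deviation hrev hfin i
  have h3 : Summable fun j => (p j).toReal * meanHitReal L i j :=
    (h1.sub h2.summable).congr fun j => by rw [deviation]; ring
  have h4 : ∑' j, (p j).toReal * (avgHit L p j).toReal
      = ∑' j, (p j).toReal * meanHitReal L i j := by
    have := h1.tsum_sub h3
    rw [show ∑' j, ((p j).toReal * (avgHit L p j).toReal - (p j).toReal * meanHitReal L i j) = 0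
      from h2.tsum_eq] at this
    linarith
  have h5 : ∑' j, p j * avgHit L p j
      = ENNReal.ofReal (∑' j, (p j).toReal * (avgHit L p j).toReal) := by
    have h6 : ∀ j, p j * avgHit L p j ≠ ∞ := fun j => ENNReal.ne_top_of_tsum_ne_top htop j
    simp_rw [← ENNReal.toReal_mul]
    rw [← ENNReal.tsum_toReal_eq h6, ENNReal.ofReal_toReal htop]
  rw [h5]
  refine ENNReal.ofReal_le_ofReal ?_
  have hpos : ∀ j, 0 ≤ meanHitReal L i j := fun j => ENNReal.toReal_nonneg
  have h6 : (p j).toReal * (avgHit L p j).toReal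
      ≤ ∑' j, (p j).toReal * (avgHit L p j).toReal :=
    h1.le_tsum j fun k _ => by positivity
  have h7 : (p j).toReal * meanHitReal L i j
      ≤ ∑' j, (p j).toReal * (avgHit L p j).toReal := by
    rw [h4]
    exact h3.le_tsum j fun k _ => mul_nonneg ENNReal.toReal_nonneg (hpos k)
  have h8 : 0 ≤ (p j).toReal * (avgHit L p j).toReal := by positivity
  have h9 : 0 ≤ (p j).toReal * meanHitReal L i j := mul_nonneg ENNReal.toReal_nonneg (hpos j)
  -- The entry is a difference of two numbers between zero and the average hitting time, so no
  -- factor 2 is lost.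
  rw [deviation, abs_le]
  constructor <;> linarith

end IsStationaryChain

end Reversible

/-! ### A criterion for non-explosion -/

section NonExplosion

variable {S : Type*} [Countable S] [MeasurableSpace S] [MeasurableSingletonClass S]

open Classical in
/-- The function `e^{-u}` on `[0, ∞]`. -/
def expNeg (u : ℝ≥0∞) : ℝ≥0∞ := if u = ∞ then 0 else ENNReal.ofReal (Real.exp (-u.toReal))

lemma expNeg_top : expNeg ∞ = 0 := if_pos rfl

lemma measurable_expNeg : Measurable expNeg :=
  Measurable.ite (measurableSet_singleton _) measurable_const (by fun_prop)

lemma expNeg_ofReal_add {s : ℝ} (hs : 0 ≤ s) (u : ℝ≥0∞) :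
    expNeg (ENNReal.ofReal s + u) = ENNReal.ofReal (Real.exp (-s)) * expNeg u := by
  rcases eq_or_ne u ∞ with rfl | hu
  · simp [expNeg_top]
  · rw [expNeg, expNeg, if_neg (by simp [hu]), if_neg hu,
      ENNReal.toReal_add ENNReal.ofReal_ne_top hu, ENNReal.toReal_ofReal hs,
      ← ENNReal.ofReal_mul (Real.exp_pos _).le, ← Real.exp_add]
    ring_nf

lemma expNeg_le_one (u : ℝ≥0∞) : expNeg u ≤ 1 := by
  unfold expNeg
  split_ifs
  · exact zero_le
  · rw [← ENNReal.ofReal_one]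
    exact ENNReal.ofReal_le_ofReal (Real.exp_le_one_iff.2 (by simp))

lemma expNeg_anti : Antitone expNeg := by
  intro u v huv
  rcases eq_or_ne v ∞ with rfl | hv
  · simp [expNeg_top]
  · rw [expNeg, expNeg, if_neg hv, if_neg (ne_top_of_le_ne_top hv huv)]
    exact ENNReal.ofReal_le_ofReal (Real.exp_le_exp.2 (neg_le_neg (ENNReal.toReal_mono hv huv)))

/-- The expectation of `e^{-J}`, where `J` is the time of the `n`-th jump. -/
def jumpLaplace (L : S → S → ℝ) (n : ℕ) (i : S) : ℝ≥0∞ :=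
  ∫⁻ ω, expNeg (jumpTime L n ω) ∂(chainLaw L i)

lemma jumpLaplace_le_one (L : S → S → ℝ) (n : ℕ) (i : S) : jumpLaplace L n i ≤ 1 := by
  calc jumpLaplace L n i ≤ ∫⁻ _, 1 ∂(chainLaw L i) := lintegral_mono fun ω => expNeg_le_one _
    _ = 1 := by simp

lemma jumpLaplace_anti (L : S → S → ℝ) (i : S) : Antitone fun n => jumpLaplace L n i :=
  fun _ _ h => lintegral_mono fun ω => expNeg_anti (jumpTime_mono L ω h)

lemma lintegral_survival_mul_exp {L : S → S → ℝ} {i : S} (hq : exitRate L i ≠ ∞) :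
    (1 + exitRate L i) * ∫⁻ s, survival L i s * ENNReal.ofReal (Real.exp (-s)) = 1 := by
  have hr : 0 < 1 + rate L i := by linarith [rate_nonneg L i]
  have h1 : ∫⁻ x, exponentialPDF (1 + rate L i) x = 1 := lintegral_exponentialPDF_eq_one hr
  have h2 : 1 + exitRate L i = ENNReal.ofReal (1 + rate L i) := by
    rw [ENNReal.ofReal_add zero_le_one (rate_nonneg L i), ENNReal.ofReal_one, rate,
      ENNReal.ofReal_toReal hq]
  have hm : Measurable fun s => survival L i s * ENNReal.ofReal (Real.exp (-s)) :=
    (measurable_survival L i).mul (by fun_prop)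
  rw [h2, ← lintegral_const_mul _ hm]
  refine Eq.trans (lintegral_congr fun s => ?_) h1
  rw [exponentialPDF_eq, survival]
  split_ifs with hs
  · rw [← ENNReal.ofReal_mul (Real.exp_pos _).le, ← Real.exp_add, ← ENNReal.ofReal_mul hr.le]
    ring_nf
  · simp

/-- The exponential factorizes over the first holding time and the rest of the path, and the first
factor integrates against the survival function to 1/(1 + q), with q the exit rate. -/
lemma jumpLaplace_succ {L : S → S → ℝ} {i : S} (hq : exitRate L i ≠ ∞) (n : ℕ) :
    (1 + exitRate L i) * jumpLaplace L (n + 1) i = ∑' k, jumpRate L i k * jumpLaplace L n k := by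
  have hm : ∀ n, Measurable fun ω : (ℕ → S) × (ℕ → ℝ) => expNeg (jumpTime L n ω) := fun n =>
    measurable_expNeg.comp (measurable_jumpTime L n)
  have hm2 : Measurable fun s => survival L i s * ENNReal.ofReal (Real.exp (-s)) :=
    (measurable_survival L i).mul (by fun_prop)
  rw [jumpLaplace, lintegral_chainLaw_rate hq (hm (n + 1))
    (G := fun s ω => ENNReal.ofReal (Real.exp (-s)) * expNeg (jumpTime L n ω))]
  · simp_rw [lintegral_const_mul _ (hm n)]
    have h1 : ∀ s, survival L i s * ∑' k, jumpRate L i k * (ENNReal.ofReal (Real.exp (-s)) *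
        ∫⁻ ω, expNeg (jumpTime L n ω) ∂(chainLaw L k))
        = survival L i s * ENNReal.ofReal (Real.exp (-s)) *
          ∑' k, jumpRate L i k * jumpLaplace L n k := by
      intro s
      rw [mul_assoc, ← ENNReal.tsum_mul_left (a := ENNReal.ofReal (Real.exp (-s)))]
      congr 1
      exact tsum_congr fun k => by rw [jumpLaplace]; ring
    simp_rw [h1]
    rw [lintegral_mul_const _ hm2, ← mul_assoc, lintegral_survival_mul_exp hq, one_mul]
  · intro _ ω hω
    have : jumpTime L (n + 1) ω = ∞ := by
      rw [← top_le_iff, ← hω]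
      exact jumpTime_mono L ω (by omega)
    rw [this, expNeg_top]
  · intro h0 s hs ω
    rw [jumpTime_seqCons h0 hq, expNeg_ofReal_add hs]

/-- The chain does not explode if the Laplace transforms of its jump times tend to zero. -/
lemma tsum_trans_eq_one_of_jumpLaplace {L : S → S → ℝ} (hq : ∀ i, exitRate L i ≠ ∞) {i : S}
    (h : Tendsto (fun n => jumpLaplace L n i) atTop (𝓝 0)) {t : ℝ} (ht : 0 ≤ t) :
    ∑' j, trans L i j t = 1 := by
  rw [tsum_trans hq]
  have hm : MeasurableSet (⋃ p : ℕ × S, jumpEvent L p.1 p.2 t) :=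
    MeasurableSet.iUnion fun p => measurableSet_jumpEvent L p.1 p.2 _
  rw [← prob_compl_eq_zero_iff hm]
  -- Having no state at time `t` forces every jump time J to be at most `t`, and the indicator of J
  -- ≤ t is at most e^t e^{-J}.
  have hle : ∀ n, chainLaw L i (⋃ p : ℕ × S, jumpEvent L p.1 p.2 t)ᶜ
      ≤ ENNReal.ofReal (Real.exp t) * jumpLaplace L n i := by
    intro n
    have hsub : (⋃ p : ℕ × S, jumpEvent L p.1 p.2 t)ᶜ ⊆ {ω | jumpTime L n ω ≤ ENNReal.ofReal t} := by
      intro ω hω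
      by_contra hc
      classical
      have hex : ∃ m, ENNReal.ofReal t < jumpTime L m ω := ⟨n, not_le.1 hc⟩
      obtain ⟨m, hm⟩ : ∃ m, Nat.find hex = m + 1 := by
        refine Nat.exists_eq_succ_of_ne_zero fun h0 => ?_
        have := Nat.find_spec hex
        rw [h0] at this
        simp [jumpTime] at this
      refine hω (Set.mem_iUnion.2 ⟨(m, ω.1 m), ht, ?_, ?_, rfl⟩)
      · exact not_lt.1 (Nat.find_min hex (by omega))
      · have := Nat.find_spec hex
        rwa [hm] at this
    have hmn : MeasurableSet {ω | jumpTime L n ω ≤ ENNReal.ofReal t} :=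
      measurableSet_le (measurable_jumpTime L n) measurable_const
    refine (measure_mono hsub).trans ?_
    have hmE : Measurable fun ω : (ℕ → S) × (ℕ → ℝ) => expNeg (jumpTime L n ω) :=
      measurable_expNeg.comp (measurable_jumpTime L n)
    rw [← lintegral_indicator_one hmn, jumpLaplace, ← lintegral_const_mul _ hmE]
    refine lintegral_mono fun ω => ?_
    by_cases hω : ω ∈ {ω | jumpTime L n ω ≤ ENNReal.ofReal t}
    · rw [Set.indicator_of_mem hω, Pi.one_apply]
      have h1 : jumpTime L n ω ≠ ∞ := ne_top_of_le_ne_top ENNReal.ofReal_ne_top hω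
      have h2 : (jumpTime L n ω).toReal ≤ t := ENNReal.toReal_le_of_le_ofReal ht hω
      rw [expNeg, if_neg h1, ← ENNReal.ofReal_mul (Real.exp_pos _).le, ← Real.exp_add,
        ← ENNReal.ofReal_one]
      exact ENNReal.ofReal_le_ofReal (Real.one_le_exp (by linarith))
    · rw [Set.indicator_of_notMem hω]
      exact zero_le
  have hlim : Tendsto (fun n => ENNReal.ofReal (Real.exp t) * jumpLaplace L n i) atTop (𝓝 0) := by
    have := ENNReal.Tendsto.const_mul (a := ENNReal.ofReal (Real.exp t)) h
      (Or.inr ENNReal.ofReal_ne_top)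
    rwa [mul_zero] at this
  exact le_antisymm (ge_of_tendsto' hlim hle) zero_le

end NonExplosion


/-! ### Birth-death recursions on `ℕ` -/

section Recursion

/-- From `k` on, `x` grows at least like ε times the harmonic series. -/
lemma false_of_harmonic_increments {x : ℕ → ℝ} {ε C : ℝ} {k : ℕ} (hε : 0 < ε)
    (hx : ∀ i, k ≤ i → ε / (i + 1) ≤ x (i + 1) - x i) (hC : ∀ i, x i ≤ C) : False := by
  have key : ∀ n, k ≤ n → ε * (∑ i ∈ Finset.range n, 1 / ((i : ℝ) + 1)
      - ∑ i ∈ Finset.range k, 1 / ((i : ℝ) + 1)) ≤ x n - x k := by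
    intro n hn
    induction n, hn using Nat.le_induction with
    | base => simp
    | succ n hn ih =>
      have h1 := hx n hn
      rw [Finset.sum_range_succ]
      have h2 : ε / ((n : ℝ) + 1) = ε * (1 / ((n : ℝ) + 1)) := by ring
      rw [h2] at h1
      linarith
  obtain ⟨n, hn, hkn⟩ := ((Real.tendsto_sum_range_one_div_nat_succ_atTop.eventually_gt_atTop
    ((C - x k) / ε + ∑ i ∈ Finset.range k, 1 / ((i : ℝ) + 1))).and (eventually_ge_atTop k)).exists
  have h1 := key n hkn
  have h2 : (C - x k) / ε < ∑ i ∈ Finset.range n, 1 / ((i : ℝ) + 1)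
      - ∑ i ∈ Finset.range k, 1 / ((i : ℝ) + 1) := by linarith
  rw [div_lt_iff₀ hε] at h2
  have := hC n
  linarith

/-- A lower bound on the flux becomes one on the increment, because the conductance (i+1)p of the
edge is at most i + 1. -/
lemma mul_div_self_le {a c ε : ℝ} {i : ℕ} {p : ℝ} (hε : 0 < ε) (hp0 : 0 ≤ p) (hp1 : p ≤ 1)
    (h : ε ≤ ((i : ℝ) + 1) * p * (a - c)) : ε / (i + 1) ≤ a - c := by
  have hi : (0 : ℝ) < i + 1 := by positivity
  rw [div_le_iff₀ hi]
  have hac : 0 < a - c := by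
    by_contra hc
    have : ((i : ℝ) + 1) * p * (a - c) ≤ 0 :=
      mul_nonpos_of_nonneg_of_nonpos (by positivity) (not_lt.1 hc)
    linarith
  have : ((i : ℝ) + 1) * p * (a - c) ≤ ((i : ℝ) + 1) * 1 * (a - c) := by gcongr
  linarith

variable {P : ℕ → ℝ}

/-- A bounded nonnegative solution of `ℒu = u` vanishes. -/
lemma mul_eq_zero_of_resolvent_recursion (h0 : ∀ n, 0 ≤ P n) (h1 : ∀ n, P n ≤ 1)
    {u : ℕ → ℝ} {C : ℝ} (hu0 : ∀ n, 0 ≤ u n) (hu1 : ∀ n, u n ≤ C)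
    (hu : ∀ n, P n * u n
      = (n + 1) * P (n + 1) * (u (n + 1) - u n) - n * P n * (u n - u (n - 1))) (k : ℕ) :
    P k * u k = 0 := by
  -- The right-hand sides are differences of fluxes through consecutive edges and telescope; at n =
  -- 0 the factor n removes the term with the truncated n - 1.
  have flux : ∀ n : ℕ, ∑ m ∈ Finset.range (n + 1), P m * u m
      = (n + 1) * P (n + 1) * (u (n + 1) - u n) := by
    intro n
    induction n with
    | zero => simpa using hu 0
    | succ n ih =>
      rw [Finset.sum_range_succ, ih, hu (n + 1)]
      push_cast
      simp
  have hnn : ∀ n, 0 ≤ P n * u n := fun n => mul_nonneg (h0 n) (hu0 n)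
  by_contra hk
  have hε : 0 < P k * u k := lt_of_le_of_ne (hnn k) (Ne.symm hk)
  refine false_of_harmonic_increments (k := k) hε (fun i hi => ?_) hu1
  refine mul_div_self_le hε (h0 (i + 1)) (h1 (i + 1)) ?_
  rw [← flux i]
  exact Finset.single_le_sum (f := fun m => P m * u m) (fun m _ => hnn m)
    (Finset.mem_range.2 (by omega))

/-- The expected time to go from `i` to `j`, when `P` is the stationary law and deaths occur at
rate `i`. -/
def passageTime (P : ℕ → ℝ) (j i : ℕ) : ℝ :=
  ∑ k ∈ Finset.Ico i j, (∑ l ∈ Finset.range (k + 1), P l) / ((k + 1) * P (k + 1)) +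
    ∑ k ∈ Finset.Ico j i, (1 - ∑ l ∈ Finset.range (k + 1), P l) / ((k + 1) * P (k + 1))

lemma sum_range_le_one (h0 : ∀ n, 0 ≤ P n) (hP : HasSum P 1) (k : ℕ) :
    ∑ l ∈ Finset.range k, P l ≤ 1 :=
  sum_le_hasSum _ (fun n _ => h0 n) hP

lemma passageTime_nonneg (h0 : ∀ n, 0 ≤ P n) (hP : HasSum P 1) (j i : ℕ) :
    0 ≤ passageTime P j i := by
  refine add_nonneg (Finset.sum_nonneg fun k _ => ?_) (Finset.sum_nonneg fun k _ => ?_)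
  · exact div_nonneg (Finset.sum_nonneg fun n _ => h0 n) (mul_nonneg (by positivity) (h0 _))
  · exact div_nonneg (sub_nonneg.2 (sum_range_le_one h0 hP _))
      (mul_nonneg (by positivity) (h0 _))

lemma passageTime_self (j : ℕ) : passageTime P j j = 0 := by simp [passageTime]

lemma eq_zero_of_le (hz : ∀ n, P n = 0 → P (n + 1) = 0) {m n : ℕ} (hmn : m ≤ n)
    (hm : P m = 0) : P n = 0 := by
  induction n, hmn using Nat.le_induction with
  | base => exact hm
  | succ n _ ih => exact hz n ih

lemma passageTime_flux_of_le (hz : ∀ n, P n = 0 → P (n + 1) = 0)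
    (hP : HasSum P 1) {j i : ℕ} (hji : j ≤ i) :
    ((i : ℝ) + 1) * P (i + 1) * (passageTime P j (i + 1) - passageTime P j i)
      = 1 - ∑ l ∈ Finset.range (i + 1), P l := by
  have h1 : passageTime P j (i + 1) - passageTime P j i
      = (1 - ∑ l ∈ Finset.range (i + 1), P l) / ((i + 1) * P (i + 1)) := by
    simp only [passageTime]
    rw [Finset.sum_Ico_succ_top hji, Finset.Ico_eq_empty (by omega : ¬ i + 1 < j),
      Finset.Ico_eq_empty (by omega : ¬ i < j)]
    simp
  rw [h1]
  rcases eq_or_ne (P (i + 1)) 0 with h | h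
  -- Beyond the last state both sides vanish: all the mass lies in {0, …, i}.
  · have h2 : HasSum P (∑ l ∈ Finset.range (i + 1), P l) :=
      hasSum_sum_of_ne_finset_zero fun n hn => eq_zero_of_le hz (by simpa using hn) h
    rw [h2.unique hP]
    simp
  · have : (i : ℝ) + 1 ≠ 0 := by positivity
    field_simp

lemma passageTime_flux_of_lt {j i : ℕ} (hij : i < j) (hi : P (i + 1) ≠ 0) :
    ((i : ℝ) + 1) * P (i + 1) * (passageTime P j (i + 1) - passageTime P j i)
      = - ∑ l ∈ Finset.range (i + 1), P l := by
  have h1 : passageTime P j (i + 1) - passageTime P j i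
      = - ((∑ l ∈ Finset.range (i + 1), P l) / ((i + 1) * P (i + 1))) := by
    simp only [passageTime]
    rw [Finset.sum_eq_sum_Ico_succ_bot hij, Finset.Ico_eq_empty (by omega : ¬ j < i + 1),
      Finset.Ico_eq_empty (by omega : ¬ j < i)]
    simp
  have : (i : ℝ) + 1 ≠ 0 := by positivity
  rw [h1]
  field_simp

/-- On either side of `j` the fluxes through the edges above and below `i` differ by -P(i). At i = 0
the factor i removes the term with the truncated i - 1. -/
lemma passageTime_recursion (hz : ∀ n, P n = 0 → P (n + 1) = 0)
    (hP : HasSum P 1) {j i : ℕ} (hj : P j ≠ 0) (hij : i ≠ j) :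
    P i + (i + 1) * P (i + 1) * (passageTime P j (i + 1) - passageTime P j i)
      - i * P i * (passageTime P j i - passageTime P j (i - 1)) = 0 := by
  have hne : ∀ n, n ≤ j → P n ≠ 0 := fun n hn h => hj (eq_zero_of_le hz hn h)
  rcases lt_or_gt_of_ne hij with h | h
  · rw [passageTime_flux_of_lt h (hne _ h)]
    rcases i with _ | i
    · simp
    · have := passageTime_flux_of_lt (P := P) (j := j) (i := i) (by omega) (hne _ h.le)
      rw [Nat.add_sub_cancel]
      push_cast
      rw [this, Finset.sum_range_succ]
      ring
  · rw [passageTime_flux_of_le hz hP h.le]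
    rcases i with _ | i
    · omega
    · have := passageTime_flux_of_le hz hP (j := j) (i := i) (by omega)
      rw [Nat.add_sub_cancel]
      push_cast
      rw [this, Finset.sum_range_succ]
      ring

/-- The nonnegative solution of the hitting time recursion that is dominated by `passageTime`
is `passageTime` itself. -/
lemma eq_passageTime (h0 : ∀ n, 0 ≤ P n) (h1 : ∀ n, P n ≤ 1)
    (hz : ∀ n, P n = 0 → P (n + 1) = 0) (hP : HasSum P 1) {j : ℕ} (hj : P j ≠ 0) {v : ℕ → ℝ}
    (hv0 : ∀ n, 0 ≤ v n) (hvj : v j = 0) (hvw : ∀ n, P n ≠ 0 → v n ≤ passageTime P j n)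
    (hv : ∀ i, i ≠ j → P i + (i + 1) * P (i + 1) * (v (i + 1) - v i)
      - i * P i * (v i - v (i - 1)) = 0) {i : ℕ} (hi : P i ≠ 0) :
    v i = passageTime P j i := by
  have hne : ∀ m n, n ≤ m → P m ≠ 0 → P n ≠ 0 := fun m n hn hm h => hm (eq_zero_of_le hz hn h)
  have down : ∀ i : ℕ, i < j → ((i : ℝ) + 1) * P (i + 1) * (v (i + 1) - v i)
      = - ∑ l ∈ Finset.range (i + 1), P l := by
    intro i
    induction i with
    | zero =>
      intro h
      have := hv 0 (by omega)
      simp at this ⊢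
      linarith
    | succ i ih =>
      intro h
      have h2 := hv (i + 1) (by omega)
      have h3 := ih (by omega)
      rw [Nat.add_sub_cancel] at h2
      push_cast at h2 ⊢
      rw [Finset.sum_range_succ]
      linarith
  -- The deficit of the flux of `v` against that of `passageTime` just above `j`; by the recursion
  -- it is the same on all higher edges. Below `j` no deficit is possible, since there is no flux
  -- below 0.
  set γ : ℝ := 1 - ∑ l ∈ Finset.range (j + 1), P l
    - ((j : ℝ) + 1) * P (j + 1) * (v (j + 1) - v j) with hγ
  have up : ∀ i : ℕ, j ≤ i → ((i : ℝ) + 1) * P (i + 1) * (v (i + 1) - v i)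
      = 1 - ∑ l ∈ Finset.range (i + 1), P l - γ := by
    intro i hi
    induction i, hi using Nat.le_induction with
    | base => rw [hγ]; ring
    | succ i hi ih =>
      have h2 := hv (i + 1) (by omega)
      rw [Nat.add_sub_cancel] at h2
      push_cast at h2 ⊢
      rw [Finset.sum_range_succ]
      linarith
  have hγ0 : 0 ≤ γ := by
    have h2 := passageTime_flux_of_le hz hP (le_refl j)
    rw [passageTime_self] at h2
    rw [hγ, ← h2, hvj]
    rcases eq_or_ne (P (j + 1)) 0 with h | h
    · simp [h]
    · have h3 := hvw (j + 1) h
      have h4 : 0 ≤ ((j : ℝ) + 1) * P (j + 1) := mul_nonneg (by positivity) (h0 _)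
      have h5 := mul_le_mul_of_nonneg_left h3 h4
      linarith
  -- If γ > 0, then once the tail of `P` is below γ/2 the flux of `v` is at most -γ/2, so `v` falls
  -- at least harmonically and becomes negative.
  have hγ1 : γ = 0 := by
    by_contra hne0
    have hpos : 0 < γ := lt_of_le_of_ne hγ0 (Ne.symm hne0)
    have hlim : Tendsto (fun i => 1 - ∑ l ∈ Finset.range (i + 1), P l) atTop (𝓝 0) := by
      have := (hP.tendsto_sum_nat.comp (tendsto_add_atTop_nat 1)).const_sub 1
      simpa using this
    obtain ⟨K, hK⟩ := eventually_atTop.1 (hlim.eventually (gt_mem_nhds (half_pos hpos)))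
    refine false_of_harmonic_increments (x := fun i => - v i) (k := max K j) (half_pos hpos)
      (fun i hi => ?_) (C := 0) (fun i => by simpa using hv0 i)
    refine mul_div_self_le (half_pos hpos) (h0 (i + 1)) (h1 (i + 1)) ?_
    have h2 := up i (le_trans (le_max_right _ _) hi)
    have h3 := hK i (le_trans (le_max_left _ _) hi)
    have h4 : ((i : ℝ) + 1) * P (i + 1) * (- v (i + 1) - - v i)
        = - (((i : ℝ) + 1) * P (i + 1) * (v (i + 1) - v i)) := by ring
    rw [h4, h2]
    linarith
  have step : ∀ i, P (i + 1) ≠ 0 →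
      v (i + 1) - v i = passageTime P j (i + 1) - passageTime P j i := by
    intro i hi
    have hc : ((i : ℝ) + 1) * P (i + 1) ≠ 0 := mul_ne_zero (by positivity) hi
    refine mul_left_cancel₀ hc ?_
    rcases lt_or_ge i j with h | h
    · rw [down i h, passageTime_flux_of_lt h hi]
    · rw [up i h, passageTime_flux_of_le hz hP h, hγ1, sub_zero]
  have hj0 : v j = passageTime P j j := by rw [hvj, passageTime_self]
  rcases le_total i j with h | h
  · have : ∀ n, n ≤ j → v (j - n) = passageTime P j (j - n) := by
      intro n
      induction n with
      | zero => intro _; exact hj0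
      | succ n ih =>
        intro hn
        have h2 := ih (by omega)
        have h3 : j - n = j - (n + 1) + 1 := by omega
        have h4 := step (j - (n + 1)) (hne j _ (by omega) hj)
        rw [← h3] at h4
        linarith
    have h2 := this (j - i) (by omega)
    rwa [Nat.sub_sub_self h] at h2
  · induction i, h using Nat.le_induction with
    | base => exact hj0
    | succ i h ih =>
      have h2 := step i hi
      have h3 := ih (hne (i + 1) i (by omega) hi)
      linarith

end Recursion


/-! ### The birth-death generator -/

section BirthDeath

variable {N : ℕ∞}

open Classical in
/-- The extension by zero of a function on `{0, …, N}` to `ℕ`. -/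
def zeroExt {M : Type*} [Zero M] (x : StateSpace N → M) (n : ℕ) : M :=
  if h : (n : ℕ∞) ≤ N then x ⟨n, h⟩ else 0

lemma zeroExt_val {M : Type*} [Zero M] (x : StateSpace N → M) (i : StateSpace N) :
    zeroExt x i.1 = x i := dif_pos i.2

lemma zeroExt_next {M : Type*} [Zero M] (x : StateSpace N → M) (i : StateSpace N)
    (hi : ((i.1 + 1 : ℕ) : ℕ∞) ≤ N) : zeroExt x (i.1 + 1) = x (next i hi) := dif_pos hi

lemma zeroExt_of_not_le {M : Type*} [Zero M] (x : StateSpace N → M) {n : ℕ}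
    (hn : ¬ (n : ℕ∞) ≤ N) : zeroExt x n = 0 := dif_neg hn

lemma hasSum_single_mul {R : Type*} [Semiring R] [TopologicalSpace R] (n : ℕ) (c : R)
    (x : StateSpace N → R) :
    HasSum (fun k : StateSpace N => (if k.1 = n then c else 0) * x k) (c * zeroExt x n) := by
  by_cases hn : (n : ℕ∞) ≤ N
  · have : c * zeroExt x n = (fun k : StateSpace N => (if k.1 = n then c else 0) * x k) ⟨n, hn⟩ := by
      simp [zeroExt, hn]
    rw [this]
    refine hasSum_single _ fun k hk => ?_
    have : k.1 ≠ n := fun h => hk (Subtype.ext h)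
    simp [this]
  · rw [zeroExt_of_not_le x hn, mul_zero]
    have : (fun k : StateSpace N => (if k.1 = n then c else 0) * x k) = fun _ => 0 := by
      funext k
      have : k.1 ≠ n := fun h => hn (h ▸ k.2)
      simp [this]
    rw [this]
    exact hasSum_zero

/-- The birth rates of the chain with stationary law `π` and death rates `i`. -/
def bdRate (π : StateSpace N → ℝ) (i : StateSpace N) : ℝ := (i.1 + 1) * zeroExt π (i.1 + 1) / π i

/-- The birth-death generator with stationary law `π` and death rates `i`. -/
def bdGen (π : StateSpace N → ℝ) (i k : StateSpace N) : ℝ :=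
  (if k.1 = i.1 + 1 then bdRate π i else 0) + (if k.1 = i.1 - 1 then (i.1 : ℝ) else 0)
    + (if k.1 = i.1 then -(bdRate π i + i.1) else 0)

variable {π : StateSpace N → ℝ}

lemma zeroExt_nonneg (hπ : ∀ i, 0 < π i) (n : ℕ) : 0 ≤ zeroExt π n := by
  unfold zeroExt
  split_ifs with h
  · exact (hπ _).le
  · exact le_rfl

lemma zeroExt_eq_zero_iff (hπ : ∀ i, 0 < π i) {n : ℕ} : zeroExt π n = 0 ↔ ¬ (n : ℕ∞) ≤ N := by
  refine ⟨fun h hn => ?_, fun h => zeroExt_of_not_le π h⟩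
  rw [zeroExt, dif_pos hn] at h
  exact (hπ _).ne' h

lemma zeroExt_succ_eq_zero (hπ : ∀ i, 0 < π i) (n : ℕ) (hn : zeroExt π n = 0) :
    zeroExt π (n + 1) = 0 := by
  rw [zeroExt_eq_zero_iff hπ] at hn ⊢
  exact fun h => hn (le_trans (by exact_mod_cast n.le_succ) h)

lemma hasSum_zeroExt {s : ℝ} (hπs : HasSum π s) : HasSum (zeroExt π) s := by
  refine (Function.Injective.hasSum_iff (Subtype.val_injective (p := fun n : ℕ => (n : ℕ∞) ≤ N))
    fun n hn => zeroExt_of_not_le π fun h => hn ⟨⟨n, h⟩, rfl⟩).1 ?_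
  have : zeroExt π ∘ Subtype.val = π := funext fun i => zeroExt_val π i
  rwa [this]

lemma bdRate_nonneg (hπ : ∀ i, 0 < π i) (i : StateSpace N) : 0 ≤ bdRate π i :=
  div_nonneg (mul_nonneg (by positivity) (zeroExt_nonneg hπ _)) (hπ i).le

lemma mul_bdRate (hπ : ∀ i, 0 < π i) (i : StateSpace N) :
    π i * bdRate π i = (i.1 + 1) * zeroExt π (i.1 + 1) :=
  mul_div_cancel₀ _ (hπ i).ne'

lemma bdRate_eq_zero {i : StateSpace N} (hi : ¬ ((i.1 + 1 : ℕ) : ℕ∞) ≤ N) : bdRate π i = 0 := by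
  rw [bdRate, zeroExt_of_not_le π hi]
  simp

lemma bdGen_up {i k : StateSpace N} (h : k.1 = i.1 + 1) : bdGen π i k = bdRate π i := by
  have h1 : k.1 ≠ i.1 - 1 := by omega
  have h2 : k.1 ≠ i.1 := by omega
  rw [bdGen, if_pos h, if_neg h1, if_neg h2]
  simp

lemma bdGen_down {i k : StateSpace N} (h : i.1 = k.1 + 1) : bdGen π i k = i.1 := by
  have h1 : k.1 ≠ i.1 + 1 := by omega
  have h2 : k.1 ≠ i.1 := by omega
  have h3 : k.1 = i.1 - 1 := by omega
  rw [bdGen, if_neg h1, if_pos h3, if_neg h2]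
  simp

lemma isBirthDeath_bdGen : IsBirthDeath (bdGen π) := by
  intro i k h
  have h1 : k.1 ≠ i.1 + 1 := by omega
  have h2 : k.1 ≠ i.1 := by omega
  have h3 : k.1 ≠ i.1 - 1 := by omega
  rw [bdGen, if_neg h1, if_neg h2, if_neg h3]
  simp

lemma bdGen_next (i : StateSpace N) (hi : ((i.1 + 1 : ℕ) : ℕ∞) ≤ N) :
    bdGen π i (next i hi) = (i.1 + 1) * π (next i hi) / π i := by
  rw [bdGen_up rfl, bdRate, zeroExt_next π i hi]

lemma birthRate_bdGen (i : StateSpace N) : birthRate (bdGen π) i = bdRate π i := by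
  unfold birthRate
  split_ifs with h
  · exact bdGen_up rfl
  · rw [bdRate_eq_zero h]

lemma bdGen_prev (i : StateSpace N) (hi : ((i.1 + 1 : ℕ) : ℕ∞) ≤ N) :
    bdGen π (next i hi) i = i.1 + 1 := by
  rw [bdGen_down rfl]
  simp [next]

lemma isReversible_bdGen (hπ : ∀ i, 0 < π i) : IsReversible (bdGen π) π := by
  have key : ∀ i k : StateSpace N, k.1 = i.1 + 1 → π i * bdGen π i k = π k * bdGen π k i := by
    intro i k h
    rw [bdGen_up h, bdGen_down h, mul_bdRate hπ, ← h, zeroExt_val, h]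
    push_cast
    ring
  intro i k
  by_cases h1 : k.1 = i.1 + 1
  · exact key i k h1
  by_cases h2 : i.1 = k.1 + 1
  · exact (key k i h2).symm
  by_cases h3 : i = k
  · rw [h3]
  have h4 : i.1 ≠ k.1 := fun h => h3 (Subtype.ext h)
  rw [isBirthDeath_bdGen i k (by omega), isBirthDeath_bdGen k i (by omega)]
  simp

lemma isGenerator_bdGen (hπ : ∀ i, 0 < π i) : IsGenerator (bdGen π) where
  nonneg i k hik := by
    have h2 : k.1 ≠ i.1 := fun h => hik (Subtype.ext h.symm)
    rw [bdGen, if_neg h2, add_zero]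
    refine add_nonneg ?_ ?_
    · split_ifs
      · exact bdRate_nonneg hπ i
      · exact le_rfl
    · split_ifs <;> positivity
  row_sum i := by
    have h1 := hasSum_single_mul (N := N) (i.1 + 1) (bdRate π i) fun _ => (1 : ℝ)
    have h2 := hasSum_single_mul (N := N) (i.1 - 1) (i.1 : ℝ) fun _ => (1 : ℝ)
    have h3 := hasSum_single_mul (N := N) i.1 (-(bdRate π i + i.1)) fun _ => (1 : ℝ)
    have h := (h1.add h2).add h3
    simp only [mul_one] at h
    have e2 : zeroExt (N := N) (fun _ => (1 : ℝ)) (i.1 - 1) = 1 :=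
      dif_pos (le_trans (by exact_mod_cast Nat.sub_le _ _) i.2)
    have e3 : zeroExt (N := N) (fun _ => (1 : ℝ)) i.1 = 1 := zeroExt_val _ i
    rw [e2, e3] at h
    have e1 : bdRate π i * zeroExt (N := N) (fun _ => (1 : ℝ)) (i.1 + 1) = bdRate π i := by
      by_cases hi : ((i.1 + 1 : ℕ) : ℕ∞) ≤ N
      · rw [zeroExt_next _ i hi, mul_one]
      · rw [bdRate_eq_zero hi, zero_mul]
    rw [e1, mul_one, mul_one, add_neg_cancel] at h
    exact h

lemma isIrreducibleGen_bdGen (hπ : ∀ i, 0 < π i) : IsIrreducibleGen (bdGen π) := by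
  have key : ∀ (n : ℕ) (hn : (n : ℕ∞) ≤ N),
      Relation.ReflTransGen (fun a b => 0 < bdGen π a b) (zeroState N) ⟨n, hn⟩ ∧
      Relation.ReflTransGen (fun a b => 0 < bdGen π a b) ⟨n, hn⟩ (zeroState N) := by
    intro n
    induction n with
    | zero => exact fun hn => ⟨Relation.ReflTransGen.refl, Relation.ReflTransGen.refl⟩
    | succ n ih =>
      intro hn
      have hn' : (n : ℕ∞) ≤ N := le_trans (by exact_mod_cast n.le_succ) hn
      have hup : 0 < bdGen π ⟨n, hn'⟩ ⟨n + 1, hn⟩ := by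
        have := bdGen_next (π := π) ⟨n, hn'⟩ hn
        rw [next] at this
        rw [this]
        exact div_pos (mul_pos (by positivity) (hπ _)) (hπ _)
      have hdown : 0 < bdGen π ⟨n + 1, hn⟩ ⟨n, hn'⟩ := by
        rw [bdGen_down rfl]
        positivity
      exact ⟨(ih hn').1.tail hup, (ih hn').2.head hdown⟩
  intro i j
  exact (key i.1 i.2).2.trans (key j.1 j.2).1

lemma jumpRate_bdGen (i k : StateSpace N) :
    jumpRate (bdGen π) i k = (if k.1 = i.1 + 1 then ENNReal.ofReal (bdRate π i) else 0)
      + (if k.1 = i.1 - 1 then (i.1 : ℝ≥0∞) else 0) := by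
  rw [jumpRate]
  by_cases h1 : k = i
  · subst h1
    rw [if_pos rfl, if_neg (by omega)]
    -- The truncated i - 1 equals i only at i = 0, where the death rate is zero.
    split_ifs with h2
    · have : k.1 = 0 := by omega
      simp [this]
    · simp
  have h0 : k.1 ≠ i.1 := fun h => h1 (Subtype.ext h)
  rw [if_neg h1]
  by_cases h2 : k.1 = i.1 + 1
  · rw [bdGen_up h2, if_pos h2, if_neg (by omega), add_zero]
  by_cases h3 : i.1 = k.1 + 1
  · rw [bdGen_down h3, if_neg h2, if_pos (by omega), zero_add, ENNReal.ofReal_natCast]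
  · rw [isBirthDeath_bdGen i k (by omega), if_neg h2, if_neg (by omega)]
    simp

lemma tsum_jumpRate_bdGen_mul (i : StateSpace N) (x : StateSpace N → ℝ≥0∞) :
    ∑' k, jumpRate (bdGen π) i k * x k
      = ENNReal.ofReal (bdRate π i) * zeroExt x (i.1 + 1) + i.1 * zeroExt x (i.1 - 1) := by
  simp_rw [jumpRate_bdGen, add_mul]
  rw [ENNReal.tsum_add, (hasSum_single_mul _ _ x).tsum_eq, (hasSum_single_mul _ _ x).tsum_eq]

lemma exitRate_bdGen (hπ : ∀ i, 0 < π i) (i : StateSpace N) :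
    exitRate (bdGen π) i = ENNReal.ofReal (bdRate π i + i.1) := by
  have h := tsum_jumpRate_bdGen_mul (π := π) i fun _ => 1
  simp only [mul_one] at h
  have e2 : zeroExt (N := N) (fun _ => (1 : ℝ≥0∞)) (i.1 - 1) = 1 :=
    dif_pos (le_trans (by exact_mod_cast Nat.sub_le _ _) i.2)
  rw [exitRate, h, e2, mul_one, ENNReal.ofReal_add (bdRate_nonneg hπ i) (by positivity),
    ENNReal.ofReal_natCast]
  by_cases hi : ((i.1 + 1 : ℕ) : ℕ∞) ≤ N
  · rw [zeroExt_next _ i hi, mul_one]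
  · rw [bdRate_eq_zero hi]
    simp

lemma toReal_zeroExt (x : StateSpace N → ℝ≥0∞) (n : ℕ) :
    (zeroExt x n).toReal = zeroExt (fun i => (x i).toReal) n := by
  unfold zeroExt
  split_ifs <;> simp

lemma zeroExt_ne_top {x : StateSpace N → ℝ≥0∞} (hx : ∀ i, x i ≠ ∞) (n : ℕ) :
    zeroExt x n ≠ ∞ := by
  unfold zeroExt
  split_ifs
  · exact hx _
  · simp

lemma toReal_tsum_jumpRate_bdGen_mul (hπ : ∀ i, 0 < π i) (i : StateSpace N)
    {x : StateSpace N → ℝ≥0∞} (hx : ∀ i, x i ≠ ∞) :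
    (∑' k, jumpRate (bdGen π) i k * x k).toReal
      = bdRate π i * zeroExt (fun i => (x i).toReal) (i.1 + 1)
        + i.1 * zeroExt (fun i => (x i).toReal) (i.1 - 1) := by
  rw [tsum_jumpRate_bdGen_mul, ENNReal.toReal_add
    (ENNReal.mul_ne_top ENNReal.ofReal_ne_top (zeroExt_ne_top hx _))
    (ENNReal.mul_ne_top (ENNReal.natCast_ne_top _) (zeroExt_ne_top hx _)), ENNReal.toReal_mul,
    ENNReal.toReal_mul, toReal_zeroExt, toReal_zeroExt, ENNReal.toReal_ofReal (bdRate_nonneg hπ i),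
    ENNReal.toReal_natCast]

lemma tendsto_zeroExt {x : ℕ → StateSpace N → ℝ≥0∞} {y : StateSpace N → ℝ≥0∞}
    (h : ∀ i, Tendsto (fun n => x n i) atTop (𝓝 (y i))) (m : ℕ) :
    Tendsto (fun n => zeroExt (x n) m) atTop (𝓝 (zeroExt y m)) := by
  unfold zeroExt
  split_ifs
  · exact h _
  · exact tendsto_const_nhds

lemma le_one_of_hasSum {p : ℕ → ℝ} (h0 : ∀ n, 0 ≤ p n) (h : HasSum p 1) (n : ℕ) : p n ≤ 1 := by
  simpa using sum_le_hasSum {n} (fun n _ => h0 n) h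

/-- The transforms decrease in n, and the recursion of `jumpLaplace_succ`, a sum of only two terms
here, passes to the limit `U`. So `U` is bounded and satisfies LU = U; multiplied by π this is the
recursion whose bounded nonnegative solutions vanish. -/
lemma tendsto_jumpLaplace_bdGen (hπ : ∀ i, 0 < π i) (hs : HasSum π 1) (i : StateSpace N) :
    Tendsto (fun n => jumpLaplace (bdGen π) n i) atTop (𝓝 0) := by
  have hq := (isGenerator_bdGen hπ).exitRate_ne_top
  set U : StateSpace N → ℝ≥0∞ := fun i => ⨅ n, jumpLaplace (bdGen π) n i with hU
  have hlim : ∀ i, Tendsto (fun n => jumpLaplace (bdGen π) n i) atTop (𝓝 (U i)) := fun i =>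
    tendsto_atTop_iInf (jumpLaplace_anti _ i)
  have hU1 : ∀ i, U i ≤ 1 := fun i => (iInf_le _ 0).trans (jumpLaplace_le_one _ _ _)
  have hUt : ∀ i, U i ≠ ∞ := fun i => ne_top_of_le_ne_top ENNReal.one_ne_top (hU1 i)
  have hrec : ∀ i, (1 + exitRate (bdGen π) i) * U i = ∑' k, jumpRate (bdGen π) i k * U k := by
    intro i
    have hl : Tendsto (fun n => (1 + exitRate (bdGen π) i) * jumpLaplace (bdGen π) (n + 1) i)
        atTop (𝓝 ((1 + exitRate (bdGen π) i) * U i)) :=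
      ENNReal.Tendsto.const_mul ((hlim i).comp (tendsto_add_atTop_nat 1))
        (Or.inr (ENNReal.add_ne_top.2 ⟨ENNReal.one_ne_top, hq i⟩))
    have hr : Tendsto (fun n => ∑' k, jumpRate (bdGen π) i k * jumpLaplace (bdGen π) n k)
        atTop (𝓝 (∑' k, jumpRate (bdGen π) i k * U k)) := by
      simp_rw [tsum_jumpRate_bdGen_mul i]
      exact (ENNReal.Tendsto.const_mul (tendsto_zeroExt hlim _)
        (Or.inr ENNReal.ofReal_ne_top)).add (ENNReal.Tendsto.const_mul (tendsto_zeroExt hlim _)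
        (Or.inr (ENNReal.natCast_ne_top _)))
    refine tendsto_nhds_unique hl ?_
    simpa only [jumpLaplace_succ (hq i)] using hr
  have hrecR : ∀ i, (1 + (bdRate π i + i.1)) * (U i).toReal
      = bdRate π i * zeroExt (fun i => (U i).toReal) (i.1 + 1)
        + i.1 * zeroExt (fun i => (U i).toReal) (i.1 - 1) := by
    intro i
    have h := congrArg ENNReal.toReal (hrec i)
    rw [toReal_tsum_jumpRate_bdGen_mul hπ i hUt, ENNReal.toReal_mul,
      ENNReal.toReal_add ENNReal.one_ne_top (hq i), exitRate_bdGen hπ,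
      ENNReal.toReal_ofReal (add_nonneg (bdRate_nonneg hπ i) (by positivity)),
      ENNReal.toReal_one] at h
    exact h
  set u : ℕ → ℝ := zeroExt fun i => (U i).toReal with hu
  have hP := hasSum_zeroExt hs
  have hP0 := zeroExt_nonneg hπ
  have hu0 : ∀ n, 0 ≤ u n := by
    intro n
    rw [hu, zeroExt]
    split_ifs
    · exact ENNReal.toReal_nonneg
    · exact le_rfl
  have hu1 : ∀ n, u n ≤ 1 := by
    intro n
    rw [hu, zeroExt]
    split_ifs
    · exact ENNReal.toReal_le_of_le_ofReal zero_le_one (by simpa using hU1 _)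
    · exact zero_le_one
  have hz := mul_eq_zero_of_resolvent_recursion hP0 (le_one_of_hasSum hP0 hP) hu0 hu1 (fun n => by
    by_cases hn : (n : ℕ∞) ≤ N
    · have h1 := hrecR ⟨n, hn⟩
      have h2 := mul_bdRate hπ ⟨n, hn⟩
      have h3 : u n = (U ⟨n, hn⟩).toReal := dif_pos hn
      have h4 : zeroExt π n = π ⟨n, hn⟩ := dif_pos hn
      simp only at h1 h2
      rw [← h3] at h1
      rw [h4, ← h2]
      linear_combination π ⟨n, hn⟩ * h1
    · have h1 : zeroExt π n = 0 := zeroExt_of_not_le π hn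
      rw [h1, zeroExt_succ_eq_zero hπ n h1]
      ring) i.1
  rw [zeroExt_val, hu, zeroExt_val] at hz
  have h1 : (U i).toReal = 0 := by
    rcases mul_eq_zero.1 hz with h | h
    · exact absurd h (hπ i).ne'
    · exact h
  have h2 : U i = 0 := by
    rcases (ENNReal.toReal_eq_zero_iff _).1 h1 with h | h
    · exact h
    · exact absurd h (hUt i)
  rw [← h2]
  exact hlim i

/-- By reversibility the sum over i of π(i) P_t(i,j) is π(j) times the total mass of P_t(j,·), which
is one by non-explosion. -/
lemma isStationaryLaw_bdGen (hπ : ∀ i, 0 < π i) (hs : HasSum π 1) :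
    IsStationaryLaw (bdGen π) π := by
  intro t j
  have hq := (isGenerator_bdGen hπ).exitRate_ne_top
  have h1 : ∑' i, trans (bdGen π) j i t = 1 :=
    tsum_trans_eq_one_of_jumpLaplace hq (tendsto_jumpLaplace_bdGen hπ hs j) t.2
  have h2 : HasSum (fun i => π j * (trans (bdGen π) j i t).toReal) (π j * 1) := by
    refine HasSum.mul_left _ ?_
    have h3 : ∑' i, trans (bdGen π) j i t ≠ ∞ := by rw [h1]; exact ENNReal.one_ne_top
    have h4 := (ENNReal.summable_toReal h3).hasSum
    rwa [← ENNReal.tsum_toReal_eq (fun i => ENNReal.ne_top_of_tsum_ne_top h3 i), h1,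
      ENNReal.toReal_one] at h4
  rw [mul_one] at h2
  refine h2.congr_fun fun i => ?_
  have h3 := congrArg ENNReal.toReal
    (trans_reversible (fun i => (hπ i).le) (isReversible_bdGen hπ) i j t)
  rw [ENNReal.toReal_mul, ENNReal.toReal_mul, ENNReal.toReal_ofReal (hπ i).le,
    ENNReal.toReal_ofReal (hπ j).le] at h3
  rw [transition_eq hq, h3]

end BirthDeath


/-! ### Hitting times of the birth-death chain -/

section BirthDeathHitting

variable {N : ℕ∞} {π : StateSpace N → ℝ}

lemma isStationaryChain_bdGen (hπ : ∀ i, 0 < π i) (hs : HasSum π 1) :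
    IsStationaryChain (bdGen π) fun i => ENNReal.ofReal (π i) :=
  isStationaryChain_of_isStationaryLaw hπ hs (isGenerator_bdGen hπ) (isIrreducibleGen_bdGen hπ)
    (isStationaryLaw_bdGen hπ hs)

lemma ofReal_bdRate_mul_zeroExt (i : StateSpace N) {x : ℕ → ℝ} (hπ : ∀ i, 0 < π i) :
    ENNReal.ofReal (bdRate π i) * zeroExt (fun k : StateSpace N => ENNReal.ofReal (x k.1)) (i.1 + 1)
      = ENNReal.ofReal (bdRate π i * x (i.1 + 1)) := by
  by_cases hi : ((i.1 + 1 : ℕ) : ℕ∞) ≤ N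
  · rw [zeroExt_next _ i hi, ENNReal.ofReal_mul (bdRate_nonneg hπ i)]
    rfl
  · rw [bdRate_eq_zero hi]
    simp

/-- `passageTime` solves the first step equations exactly, hence is a supersolution. Its value
beyond the last state is irrelevant, because the birth rate vanishes there. -/
lemma meanHit_bdGen_le (hπ : ∀ i, 0 < π i) (hs : HasSum π 1) (i j : StateSpace N) :
    meanHit (bdGen π) i j ≤ ENNReal.ofReal (passageTime (zeroExt π) j.1 i.1) := by
  have h := isStationaryChain_bdGen hπ hs
  have hw0 := passageTime_nonneg (zeroExt_nonneg hπ) (hasSum_zeroExt hs) j.1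
  refine meanHit_le_of_supersolution (w := fun i => ENNReal.ofReal (passageTime (zeroExt π) j.1 i.1))
    h.exitRate_ne_top h.ae_iSup_jumpTime (fun k hk => h.exitRate_ne_zero hk) (fun k hk => ?_) i
  have h1 := passageTime_recursion (zeroExt_succ_eq_zero hπ) (hasSum_zeroExt hs) (j := j.1)
    (i := k.1) (by rw [zeroExt_val]; exact (hπ j).ne') fun e => hk (Subtype.ext e)
  rw [zeroExt_val, ← mul_bdRate hπ] at h1
  have h2 : 1 + (bdRate π k * passageTime (zeroExt π) j.1 (k.1 + 1)
      + k.1 * passageTime (zeroExt π) j.1 (k.1 - 1))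
      = (bdRate π k + k.1) * passageTime (zeroExt π) j.1 k.1 := by
    refine mul_left_cancel₀ (hπ k).ne' ?_
    linear_combination h1
  have h3 : zeroExt (fun i : StateSpace N => ENNReal.ofReal (passageTime (zeroExt π) j.1 i.1))
      (k.1 - 1) = ENNReal.ofReal (passageTime (zeroExt π) j.1 (k.1 - 1)) :=
    dif_pos (le_trans (by exact_mod_cast Nat.sub_le _ _) k.2)
  rw [tsum_jumpRate_bdGen_mul, ofReal_bdRate_mul_zeroExt k hπ, h3, exitRate_bdGen hπ,
    ← ENNReal.ofReal_natCast, ← ENNReal.ofReal_mul (by positivity),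
    ← ENNReal.ofReal_mul (add_nonneg (bdRate_nonneg hπ k) (by positivity)), ← h2,
    ENNReal.ofReal_add zero_le_one (add_nonneg (mul_nonneg (bdRate_nonneg hπ k) (hw0 _))
      (mul_nonneg (by positivity) (hw0 _))), ENNReal.ofReal_one,
    ENNReal.ofReal_add (mul_nonneg (bdRate_nonneg hπ k) (hw0 _))
      (mul_nonneg (by positivity) (hw0 _))]

/-- The mean hitting times, extended by zero, satisfy all hypotheses of `eq_passageTime`: the
previous bound gives domination, and the first step equations times π give the recursion. -/
lemma meanHit_bdGen (hπ : ∀ i, 0 < π i) (hs : HasSum π 1) (i j : StateSpace N) :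
    meanHit (bdGen π) i j = ENNReal.ofReal (passageTime (zeroExt π) j.1 i.1) := by
  have h := isStationaryChain_bdGen hπ hs
  have hle := fun k => meanHit_bdGen_le hπ hs k j
  have hnt : ∀ k, meanHit (bdGen π) k j ≠ ∞ := fun k => h.meanHit_ne_top k j
  have hP := hasSum_zeroExt hs
  have hP0 := zeroExt_nonneg hπ
  have hw0 := passageTime_nonneg hP0 hP j.1
  set v : ℕ → ℝ := zeroExt fun k => meanHitReal (bdGen π) k j with hv
  have hvi : ∀ k : StateSpace N, v k.1 = meanHitReal (bdGen π) k j := fun k => zeroExt_val _ k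
  have key := eq_passageTime hP0 (le_one_of_hasSum hP0 hP) (zeroExt_succ_eq_zero hπ) hP
    (j := j.1) (v := v) (i := i.1) (by rw [zeroExt_val]; exact (hπ j).ne')
    (fun n => by
      rw [hv, zeroExt]
      split_ifs
      · exact ENNReal.toReal_nonneg
      · exact le_rfl)
    (by rw [hvi, meanHitReal, meanHit_self h.exitRate_ne_top, ENNReal.toReal_zero])
    (fun n hn => by
      have hn' : (n : ℕ∞) ≤ N := by
        by_contra hc
        exact hn (zeroExt_of_not_le π hc)
      have := hvi ⟨n, hn'⟩
      simp only at this
      rw [this, meanHitReal]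
      exact ENNReal.toReal_le_of_le_ofReal (hw0 n) (hle ⟨n, hn'⟩))
    (fun n hnj => by
      by_cases hn : (n : ℕ∞) ≤ N
      · have hne : (⟨n, hn⟩ : StateSpace N) ≠ j := fun e => hnj (congrArg Subtype.val e)
        have h1 := congrArg ENNReal.toReal
          (meanHit_first_step h.exitRate_ne_top hne (h.exitRate_ne_zero hne))
        have hfin : ∑' k, jumpRate (bdGen π) ⟨n, hn⟩ k * meanHit (bdGen π) k j ≠ ∞ := by
          rw [tsum_jumpRate_bdGen_mul]
          exact ENNReal.add_ne_top.2 ⟨ENNReal.mul_ne_top ENNReal.ofReal_ne_top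
            (zeroExt_ne_top hnt _), ENNReal.mul_ne_top (ENNReal.natCast_ne_top _)
            (zeroExt_ne_top hnt _)⟩
        rw [ENNReal.toReal_add ENNReal.one_ne_top hfin, toReal_tsum_jumpRate_bdGen_mul hπ _ hnt,
          ENNReal.toReal_mul, exitRate_bdGen hπ,
          ENNReal.toReal_ofReal (add_nonneg (bdRate_nonneg hπ _) (by positivity)),
          ENNReal.toReal_one] at h1
        have h2 := mul_bdRate hπ ⟨n, hn⟩
        have h3 : v n = (meanHit (bdGen π) ⟨n, hn⟩ j).toReal := dif_pos hn
        have h4 : zeroExt π n = π ⟨n, hn⟩ := dif_pos hn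
        have h5 : zeroExt (fun k => (meanHit (bdGen π) k j).toReal) = v := rfl
        simp only [h5] at h1
        simp only at h2
        rw [← h3] at h1
        rw [h4, ← h2]
        linear_combination - π ⟨n, hn⟩ * h1
      · have h1 : zeroExt π n = 0 := zeroExt_of_not_le π hn
        rw [h1, zeroExt_succ_eq_zero hπ n h1]
        ring)
    (by rw [zeroExt_val]; exact (hπ i).ne')
  rw [← key, hvi, meanHitReal, ENNReal.ofReal_toReal (hnt i)]

lemma tsum_eq_sum_finset (g : ℕ → ℝ≥0∞) {A : Set (StateSpace N)} {F : Finset ℕ}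
    (hA : ∀ k : StateSpace N, k ∈ A ↔ k.1 ∈ F) (hg : ∀ n ∈ F, g n ≠ 0 → (n : ℕ∞) ≤ N) :
    ∑' k : A, g k.1.1 = ∑ n ∈ F, g n := by
  have h1 := tsum_image (s := A) g (Set.injOn_of_injective
    (Subtype.val_injective (p := fun n : ℕ => (n : ℕ∞) ≤ N)))
  rw [← h1, ← Finset.tsum_subtype' F g, tsum_subtype, tsum_subtype]
  refine tsum_congr fun n => ?_
  by_cases hn : (n : ℕ∞) ≤ N
  · by_cases hF : n ∈ F
    · have h2 : n ∈ Subtype.val '' A := ⟨⟨n, hn⟩, (hA ⟨n, hn⟩).2 hF, rfl⟩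
      rw [Set.indicator_of_mem h2, Set.indicator_of_mem (by exact hF)]
    · have h2 : n ∉ Subtype.val '' A := by
        rintro ⟨k, hk, rfl⟩
        exact hF ((hA k).1 hk)
      rw [Set.indicator_of_notMem h2, Set.indicator_of_notMem (by exact hF)]
  · rw [Set.indicator_of_notMem]
    · by_cases hF : n ∈ F
      · rw [Set.indicator_of_mem (by exact hF)]
        by_contra hc
        exact hn (hg n hF (Ne.symm hc))
      · rw [Set.indicator_of_notMem (by exact hF)]
    · rintro ⟨k, hk, rfl⟩
      exact hn k.2

lemma mass_Iic (hπ : ∀ i, 0 < π i) (k : StateSpace N) :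
    mass π (Set.Iic k) = ENNReal.ofReal (∑ l ∈ Finset.range (k.1 + 1), zeroExt π l) := by
  rw [ENNReal.ofReal_sum_of_nonneg fun n _ => zeroExt_nonneg hπ n, mass,
    ← tsum_eq_sum_finset (A := Set.Iic k) (fun n => ENNReal.ofReal (zeroExt π n))]
  · simp only [zeroExt_val]
  · intro m
    rw [Set.mem_Iic, Finset.mem_range, Nat.lt_succ_iff]
    rfl
  · intro n hn _
    exact le_trans (by exact_mod_cast Nat.lt_succ_iff.1 (Finset.mem_range.1 hn)) k.2

lemma mass_Ioi (hπ : ∀ i, 0 < π i) (hs : HasSum π 1) (k : StateSpace N) :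
    mass π (Set.Ioi k) = ENNReal.ofReal (1 - ∑ l ∈ Finset.range (k.1 + 1), zeroExt π l) := by
  have h1 : mass π (Set.Iic k) + mass π (Set.Ioi k) = 1 := by
    have h0 : mass π (Set.Iic k) + mass π (Set.Iic k)ᶜ = ∑' i, ENNReal.ofReal (π i) :=
      Summable.tsum_add_tsum_compl (f := fun i => ENNReal.ofReal (π i)) ENNReal.summable
        ENNReal.summable
    rw [← Set.compl_Iic, h0, ← ENNReal.ofReal_tsum_of_nonneg (fun i => (hπ i).le) hs.summable, hs.tsum_eq,
      ENNReal.ofReal_one]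
  rw [mass_Iic hπ] at h1
  rw [ENNReal.ofReal_sub _ (Finset.sum_nonneg fun n _ => zeroExt_nonneg hπ n), ENNReal.ofReal_one]
  exact ENNReal.eq_sub_of_add_eq' ENNReal.one_ne_top (by rw [add_comm]; exact h1)

lemma meanHit_bdGen_eq_tsum (hπ : ∀ i, 0 < π i) (hs : HasSum π 1) (i j : StateSpace N) :
    meanHit (bdGen π) i j =
      ∑' k : Set.Ico i j, mass π (Set.Iic k.1) /
        ENNReal.ofReal (birthRate (bdGen π) k * π k) +
      ∑' k : Set.Ico j i, mass π (Set.Ioi k.1) /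
        ENNReal.ofReal (birthRate (bdGen π) k * π k) := by
  have hP := hasSum_zeroExt hs
  have hP0 := zeroExt_nonneg hπ
  have hc : ∀ k : ℕ, (0 : ℝ) ≤ (k + 1) * zeroExt π (k + 1) := fun k =>
    mul_nonneg (by positivity) (hP0 _)
  have hm : ∀ k : ℕ, 0 ≤ ∑ l ∈ Finset.range (k + 1), zeroExt π l := fun k =>
    Finset.sum_nonneg fun n _ => hP0 n
  have hT : ∀ k : ℕ, 0 ≤ 1 - ∑ l ∈ Finset.range (k + 1), zeroExt π l := fun k =>
    sub_nonneg.2 (sum_range_le_one hP0 hP _)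
  have hle : ∀ (a b : StateSpace N), ∀ n ∈ Finset.Ico a.1 b.1, ((n + 1 : ℕ) : ℕ∞) ≤ N := by
    intro a b n hn
    exact le_trans (by exact_mod_cast (Finset.mem_Ico.1 hn).2) b.2
  have hpos : ∀ (a b : StateSpace N), ∀ n ∈ Finset.Ico a.1 b.1,
      (0 : ℝ) < (n + 1) * zeroExt π (n + 1) := by
    intro a b n hn
    refine mul_pos (by positivity) (lt_of_le_of_ne (hP0 _) (Ne.symm fun h0 => ?_))
    exact (zeroExt_eq_zero_iff hπ).1 h0 (hle a b n hn)
  have hmem : ∀ a b k : StateSpace N, k ∈ Set.Ico a b ↔ k.1 ∈ Finset.Ico a.1 b.1 := by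
    intro a b k
    rw [Set.mem_Ico, Finset.mem_Ico]
    rfl
  have hNle : ∀ (a b : StateSpace N), ∀ n ∈ Finset.Ico a.1 b.1, (n : ℕ∞) ≤ N := fun a b n hn =>
    le_trans (by exact_mod_cast n.le_succ) (hle a b n hn)
  rw [meanHit_bdGen hπ hs, passageTime, ENNReal.ofReal_add
    (Finset.sum_nonneg fun n _ => div_nonneg (hm n) (hc n))
    (Finset.sum_nonneg fun n _ => div_nonneg (hT n) (hc n)),
    ENNReal.ofReal_sum_of_nonneg fun n _ => div_nonneg (hm n) (hc n),
    ENNReal.ofReal_sum_of_nonneg fun n _ => div_nonneg (hT n) (hc n)]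
  congr 1
  · rw [Finset.sum_congr rfl fun n hn => ENNReal.ofReal_div_of_pos (hpos i j n hn),
      ← tsum_eq_sum_finset (A := Set.Ico i j) _ (hmem i j) fun n hn _ => hNle i j n hn]
    refine tsum_congr fun k => ?_
    rw [mass_Iic hπ, birthRate_bdGen, mul_comm (bdRate _ _), mul_bdRate hπ]
  · rw [Finset.sum_congr rfl fun n hn => ENNReal.ofReal_div_of_pos (hpos j i n hn),
      ← tsum_eq_sum_finset (A := Set.Ico j i) _ (hmem j i) fun n hn _ => hNle j i n hn]
    refine tsum_congr fun k => ?_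
    rw [mass_Ioi hπ hs, birthRate_bdGen, mul_comm (bdRate _ _), mul_bdRate hπ]

end BirthDeathHitting


/-! ### The Stein solution on `{0, …, N}` -/

section SteinOnStateSpace

variable {N : ℕ∞} {L : StateSpace N → StateSpace N → ℝ} {π : StateSpace N → ℝ}

lemma deviation_ofReal_eq (hπ : ∀ i, 0 < π i) (i j : StateSpace N) :
    deviation L (fun i => ENNReal.ofReal (π i)) i j
      = π j * (avgHit L (fun i => ENNReal.ofReal (π i)) j).toReal - π j * meanHitReal L i j := by
  rw [deviation, ENNReal.toReal_ofReal (hπ j).le]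

/-- Existence of the diagonal entry at `a` alone gives finiteness at `a`; conversely finiteness at
`a` passes to all targets by `avgHit_ne_top`. -/
lemma exists_isDeviationKernel_iff (hπ : ∀ i, 0 < π i) (hs : HasSum π 1) (hL : IsGenerator L)
    (hirr : IsIrreducibleGen L) (hst : IsStationaryLaw L π) (a : StateSpace N) :
    (∃ D, IsDeviationKernel L π D) ↔ ∑' i, ENNReal.ofReal (π i) * meanHit L i a < ∞ := by
  have h := isStationaryChain_of_isStationaryLaw hπ hs hL hirr hst
  have hp : ∀ i, (ENNReal.ofReal (π i)).toReal = π i := fun i => ENNReal.toReal_ofReal (hπ i).le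
  constructor
  · rintro ⟨D, hD⟩
    have h1 := hD a a
    rw [← hp a] at h1
    exact (h.avgHit_ne_top_of_hasImproperIntegral h1).lt_top
  · intro ha
    refine ⟨deviation L fun i => ENNReal.ofReal (π i), fun i j => ?_⟩
    have h1 := h.hasImproperIntegral_deviation (h.avgHit_ne_top (a := a) ha.ne j) i
    rw [hp j] at h1
    rwa [deviation_ofReal_eq hπ]

lemma IsDeviationKernel.avgHit_ne_top (hπ : ∀ i, 0 < π i) (hs : HasSum π 1) (hL : IsGenerator L)
    (hirr : IsIrreducibleGen L) (hst : IsStationaryLaw L π) {D : StateSpace N → StateSpace N → ℝ}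
    (hD : IsDeviationKernel L π D) (j : StateSpace N) :
    avgHit L (fun i => ENNReal.ofReal (π i)) j ≠ ∞ :=
  ((exists_isDeviationKernel_iff hπ hs hL hirr hst j).1 ⟨D, hD⟩).ne

lemma IsDeviationKernel.eq_deviation (hπ : ∀ i, 0 < π i) (hs : HasSum π 1) (hL : IsGenerator L)
    (hirr : IsIrreducibleGen L) (hst : IsStationaryLaw L π) {D : StateSpace N → StateSpace N → ℝ}
    (hD : IsDeviationKernel L π D) (i j : StateSpace N) :
    D i j = deviation L (fun i => ENNReal.ofReal (π i)) i j := by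
  have h := isStationaryChain_of_isStationaryLaw hπ hs hL hirr hst
  have h1 := h.hasImproperIntegral_deviation (hD.avgHit_ne_top hπ hs hL hirr hst j) i
  rw [ENNReal.toReal_ofReal (hπ j).le] at h1
  rw [deviation_ofReal_eq hπ]
  exact tendsto_nhds_unique (hD i j).2 h1.2

lemma hasSum_mul_meanHitReal (hπ : ∀ i, 0 < π i) {j : StateSpace N}
    (hj : avgHit L (fun i => ENNReal.ofReal (π i)) j ≠ ∞) :
    HasSum (fun i => π i * meanHitReal L i j)
      (avgHit L (fun i => ENNReal.ofReal (π i)) j).toReal := by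
  have h1 := ENNReal.hasSum_toReal hj
  rw [← ENNReal.tsum_toReal_eq fun i => ENNReal.ne_top_of_tsum_ne_top hj i] at h1
  refine h1.congr_fun fun i => ?_
  rw [ENNReal.toReal_mul, ENNReal.toReal_ofReal (hπ i).le]
  rfl

lemma isSteinSolution_tsum_mul_deviation (hπ : ∀ i, 0 < π i) (hs : HasSum π 1)
    (hL : IsGenerator L) (hirr : IsIrreducibleGen L) (hst : IsStationaryLaw L π)
    (hrev : IsReversible L π) (hfin : ∀ j, avgHit L (fun i => ENNReal.ofReal (π i)) j ≠ ∞)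
    {g : StateSpace N → ℝ} {k : StateSpace N} (hg : Summable fun i => π i * |g i|)
    (hk : ∑' i, ENNReal.ofReal (π i * |g i|) * meanHit L i k < ∞) :
    IsSteinSolution L π g
        (fun i => ∑' j, g j * deviation L (fun i => ENNReal.ofReal (π i)) i j) ∧
      ∀ i, Summable fun j => g j * deviation L (fun i => ENNReal.ofReal (π i)) i j := by
  have h := isStationaryChain_of_isStationaryLaw hπ hs hL hirr hst
  have hp : ∀ i, (ENNReal.ofReal (π i)).toReal = π i := fun i => ENNReal.toReal_ofReal (hπ i).le
  have h1 := h.steinSolution (trans_reversible (fun i => (hπ i).le) hrev) hfin (g := g) (k := k)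
    (by simpa only [hp] using hg) (by simpa only [hp] using hk.ne)
  simpa only [hp] using h1

lemma deviation_sub_deviation (hπ : ∀ i, 0 < π i) (i k j : StateSpace N) :
    deviation L (fun i => ENNReal.ofReal (π i)) k j - deviation L (fun i => ENNReal.ofReal (π i)) i j
      = π j * (meanHitReal L i j - meanHitReal L k j) := by
  rw [deviation_ofReal_eq hπ, deviation_ofReal_eq hπ]
  ring

lemma hasSum_grad_tsum_mul_deviation (hπ : ∀ i, 0 < π i) {g : StateSpace N → ℝ}
    (hg : ∀ i, Summable fun j => g j * deviation L (fun i => ENNReal.ofReal (π i)) i j)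
    (i : StateSpace N) (hi : ((i.1 + 1 : ℕ) : ℕ∞) ≤ N) :
    HasSum (fun j => g j * π j * (meanHitReal L i j - meanHitReal L (next i hi) j))
      (grad (fun i => ∑' j, g j * deviation L (fun i => ENNReal.ofReal (π i)) i j) i hi) := by
  refine ((hg (next i hi)).hasSum.sub (hg i).hasSum).congr_fun fun j => ?_
  rw [← mul_sub, deviation_sub_deviation hπ, mul_assoc]

lemma isSteinSolution_dirac (hπ : ∀ i, 0 < π i) (hs : HasSum π 1)
    (hL : IsGenerator L) (hirr : IsIrreducibleGen L) (hst : IsStationaryLaw L π)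
    (hrev : IsReversible L π) (hfin : ∀ j, avgHit L (fun i => ENNReal.ofReal (π i)) j ≠ ∞)
    (j : StateSpace N) :
    IsSteinSolution L π (dirac j) fun i => deviation L (fun i => ENNReal.ofReal (π i)) i j := by
  have h := isStationaryChain_of_isStationaryLaw hπ hs hL hirr hst
  have h0 : ∀ i, i ≠ j → dirac j i = 0 := fun i hi => if_neg hi
  have h1 := (isSteinSolution_tsum_mul_deviation hπ hs hL hirr hst hrev hfin (g := dirac j) (k := j)
    (summable_of_ne_finset_zero (s := {j}) fun i hi => by
      rw [h0 i (by simpa using hi)]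
      simp)
    (by
      -- With target `j` the moment condition is trivial: the Dirac mass lives at `j`, whose mean
      -- hitting time from itself is zero.
      have : ∀ i, ENNReal.ofReal (π i * |dirac j i|) * meanHit L i j = 0 := by
        intro i
        by_cases hi : i = j
        · rw [hi, meanHit_self h.exitRate_ne_top, mul_zero]
        · rw [h0 i hi]
          simp
      simp [this])).1
  have h2 : ∀ i, ∑' l, dirac j l * deviation L (fun i => ENNReal.ofReal (π i)) i l
      = deviation L (fun i => ENNReal.ofReal (π i)) i j := by
    intro i
    rw [tsum_eq_single j fun l hl => by rw [h0 l hl, zero_mul], dirac, if_pos rfl, one_mul]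
  simpa only [h2] using h1

lemma supNorm_deviation_le (hπ : ∀ i, 0 < π i) (hs : HasSum π 1)
    (hL : IsGenerator L) (hirr : IsIrreducibleGen L) (hst : IsStationaryLaw L π)
    (hrev : IsReversible L π) (hfin : ∀ j, avgHit L (fun i => ENNReal.ofReal (π i)) j ≠ ∞)
    (j : StateSpace N) :
    supNorm (fun i => deviation L (fun i => ENNReal.ofReal (π i)) i j) ≤ tAv L π := by
  have h := isStationaryChain_of_isStationaryLaw hπ hs hL hirr hst
  exact iSup_le fun i =>
    h.ofReal_abs_deviation_le (trans_reversible (fun i => (hπ i).le) hrev) hfin i j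

lemma gradNorm_deviation (hπ : ∀ i, 0 < π i) (j : StateSpace N) :
    gradNorm (fun i => deviation L (fun i => ENNReal.ofReal (π i)) i j)
      = ENNReal.ofReal (π j) * ⨆ (i : StateSpace N) (hi : ((i.1 + 1 : ℕ) : ℕ∞) ≤ N),
        ENNReal.ofReal |meanHitReal L i j - meanHitReal L (next i hi) j| := by
  simp_rw [ENNReal.mul_iSup, gradNorm]
  refine iSup_congr fun i => iSup_congr fun hi => ?_
  rw [grad, deviation_sub_deviation hπ, abs_mul, abs_of_pos (hπ j), ENNReal.ofReal_mul (hπ j).le]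

lemma mul_iSup_le_tDev (L : StateSpace N → StateSpace N → ℝ) (π : StateSpace N → ℝ)
    (j : StateSpace N) :
    ENNReal.ofReal (π j) * (⨆ (i : StateSpace N) (hi : ((i.1 + 1 : ℕ) : ℕ∞) ≤ N),
        ENNReal.ofReal |meanHitReal L i j - meanHitReal L (next i hi) j|) ≤ tDev L π := by
  simp_rw [ENNReal.mul_iSup]
  refine iSup₂_le fun i hi => ?_
  rw [mul_comm]
  exact (ENNReal.le_tsum (f := fun j => ENNReal.ofReal
    |meanHitReal L i j - meanHitReal L (next i hi) j| * ENNReal.ofReal (π j)) j).trans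
    (le_iSup₂ (f := fun i k => ∑' j, ENNReal.ofReal |meanHitReal L i j - meanHitReal L k j| *
      ENNReal.ofReal (π j)) i (next i hi))

end SteinOnStateSpace

end HittingStein

end

theorem theorem1 (N : ℕ∞) (π : StateSpace N → ℝ) (hπ_pos : ∀ i, 0 < π i) (hπ_sum : HasSum π 1) :
    -- every generator of an irreducible chain with stationary distribution `π`
    (∀ L : StateSpace N → StateSpace N → ℝ,
      IsGenerator L → IsIrreducibleGen L → IsStationaryLaw L π →
      -- the deviation kernel exists and is finite iff `∑ π(i) 𝔼_i(τ_0) < ∞`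
      ((∃ D, IsDeviationKernel L π D) ↔
        ∑' i, ENNReal.ofReal (π i) * meanHit L i (zeroState N) < ∞) ∧
      (∀ D, IsDeviationKernel L π D → IsReversible L π →
        -- formulas for the deviation kernel
        (∀ i j, meanHit L i j < ∞) ∧
        (∀ j, Summable (fun i => π i * meanHitReal L i j) ∧
          D j j = π j * ∑' i, π i * meanHitReal L i j) ∧
        (∀ i j, D i j = D j j - π j * meanHitReal L i j) ∧
        -- the Stein solution and its gradient
        (∀ (h : StateSpace N → ℝ) (k : StateSpace N),
          Summable (fun i => π i * |h i|) →
          ∑' i, ENNReal.ofReal (π i * |h i|) * meanHit L i k < ∞ →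
          ∃ f, IsSteinSolution L π h f ∧
            (∀ i, HasSum (fun j => h j * D i j) (f i)) ∧
            (∀ i hi, HasSum
              (fun j => h j * π j * (meanHitReal L i j - meanHitReal L (next i hi) j))
              (grad f i hi))) ∧
        -- bounds for Dirac masses
        (∀ j, ∃ f, IsSteinSolution L π (dirac j) f ∧
          supNorm f ≤ 2 * tAv L π ∧
          gradNorm f = ENNReal.ofReal (π j) *
            (⨆ (i : StateSpace N) (hi : ((i.1 + 1 : ℕ) : ℕ∞) ≤ N),
              ENNReal.ofReal |meanHitReal L i j - meanHitReal L (next i hi) j|) ∧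
          gradNorm f ≤ tDev L π))) ∧
    -- a birth-death chain can always be chosen, with explicit expected hitting times
    (∃ L : StateSpace N → StateSpace N → ℝ,
      IsBirthDeath L ∧ IsGenerator L ∧ IsIrreducibleGen L ∧ IsStationaryLaw L π ∧ IsReversible L π ∧
      (∀ i hi, L i (next i hi) = (i.1 + 1) * π (next i hi) / π i) ∧
      (∀ i hi, L (next i hi) i = i.1 + 1) ∧
      (∀ i j, meanHit L i j =
        ∑' k : Set.Ico i j, mass π (Set.Iic k.1) / ENNReal.ofReal (birthRate L k * π k) +
        ∑' k : Set.Ico j i, mass π (Set.Ioi k.1) / ENNReal.ofReal (birthRate L k * π k))) := by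
  refine ⟨fun L hL hirr hst => ⟨exists_isDeviationKernel_iff hπ_pos hπ_sum hL hirr hst _,
    fun D hD hrev => ?_⟩, bdGen π, isBirthDeath_bdGen, isGenerator_bdGen hπ_pos,
    isIrreducibleGen_bdGen hπ_pos, isStationaryLaw_bdGen hπ_pos hπ_sum, isReversible_bdGen hπ_pos,
    bdGen_next, bdGen_prev, meanHit_bdGen_eq_tsum hπ_pos hπ_sum⟩
  have h := isStationaryChain_of_isStationaryLaw hπ_pos hπ_sum hL hirr hst
  have hfin := hD.avgHit_ne_top hπ_pos hπ_sum hL hirr hst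
  have hDe := hD.eq_deviation hπ_pos hπ_sum hL hirr hst
  have hDjj : ∀ j, D j j = π j * (avgHit L (fun i => ENNReal.ofReal (π i)) j).toReal := by
    intro j
    rw [hDe, deviation_ofReal_eq hπ_pos, meanHitReal, meanHit_self h.exitRate_ne_top]
    simp
  refine ⟨fun i j => (h.meanHit_ne_top i j).lt_top, fun j => ?_, fun i j => ?_,
    fun g k hg hk => ?_, fun j => ?_⟩
  · have h1 := hasSum_mul_meanHitReal hπ_pos (hfin j)
    exact ⟨h1.summable, by rw [hDjj, h1.tsum_eq]⟩
  · rw [hDjj, hDe, deviation_ofReal_eq hπ_pos]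
  · obtain ⟨h1, h2⟩ := isSteinSolution_tsum_mul_deviation hπ_pos hπ_sum hL hirr hst hrev hfin hg hk
    refine ⟨_, h1, fun i => ?_, hasSum_grad_tsum_mul_deviation hπ_pos h2⟩
    simp_rw [hDe]
    exact (h2 i).hasSum
  · refine ⟨_, isSteinSolution_dirac hπ_pos hπ_sum hL hirr hst hrev hfin j, ?_,
      gradNorm_deviation hπ_pos j, ?_⟩
    -- The bound holds already without the factor 2.
    · refine (supNorm_deviation_le hπ_pos hπ_sum hL hirr hst hrev hfin j).trans ?_
      rw [two_mul]
      exact le_self_add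
    · rw [gradNorm_deviation hπ_pos]
      exact mul_iSup_le_tDev L π j
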